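/- Let $k$ be a separable complex Hilbert space. For $t>0$ let $$H_t=\bigoplus_{n\in 2\mathbb N_0}L^2([0,t],k)^{\wedge n}$$ be the even part of the antisymmetric Fock space over $L^2([0,t],k)$, where $\langle v_1\wedge\dots\wedge v_n,\,w_1\wedge\dots\wedge w_n\rangle=\det(\langle v_i,w_j\rangle)$ and $\Omega_t\in H_t$ is the vacuum vector. Let $U_{s,t}:H_s\otimes H_t\to H_{s+t}$ be the isometry determined by $$(\xi_1\wedge\dots\wedge\xi_m)\otimes(\eta_1\wedge\dots\wedge\eta_n)\mapsto T_s\eta_1\wedge\dots\wedge T_s\eta_n\wedge\xi_1\wedge\dots\wedge\xi_m ,$$ where $T_s$ is the right shift, $(T_sf)(x)=f(x-s)$ for $x\ge s$ and $0$ otherwise. This is the Clifford super-product system $H^k_{2\mathbb N_0}$. Its total space $\{(t,x):t>0,\ x\in H_t\}$ carries the Borel structure inherited from $(0,\infty)\times\Gamma(L^2(\mathbb R,k))$, where $\Gamma$ denotes the antisymmetric Fock space. Let $\mathrm{Aut}(H^k_{2\mathbb N_0})$ be the group (under composition) of families $\theta=(\theta_t)_{t>0}$ of unitaries $\theta_t$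 of $H_t$ such that $\theta_{s+t}U_{s,t}=U_{s,t}(\theta_s\otimes\theta_t)$ for all $s,t>0$ and $(t,x)\mapsto(t,\theta_tx)$ is a Borel isomorphism of the total space. Let $\mathcal M(\mathbb R_+;\mathcal U(k\otimes k))$ be the group, under pointwise multiplication, of (weakly, equivalently strongly) measurable functions from $\mathbb R_+$ to the unitary group of the Hilbert space $k\otimes k$, where functions that agree almost everywhere are identified. **Theorem.** There is a group isomorphism $$(\mathbb R,+)\times\mathcal M(\mathbb R_+;\mathcal U(k\otimes k))\;\longrightarrow\;\mathrm{Aut}(H^k_{2\mathbb N_0}),\qquad(\lambda,F)\mapsto U_{(\lambda,F)},$$ given as follows. We have $U_{(\lambda,F)}(t)\Omega_t=e^{i\lambda t}\Omega_t$; a two-particle vector $f\in L^2([0,t],k)^{\wedge 2}$, regarded as a function with values in $k\otimes k$, is mapped to the antisymmetric function given by $$(U_{(\lambda,F)}(t)f)(x,y)=e^{i\lambda t}F(|x-y|)f(x,y)\qquad(x>y);$$ and, in general, $f\in L^2([0,t],k)^{\wedge 2n}$, regarded as a function with values in $k^{\otimes 2n}$, is mapped to the antisymmetric function given by $$(U_{(\lambda,F)}(t)f)(x_1,\dots,x_{2n})=e^{i\lambda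 t}\bigl(F(|x_1-x_2|)\otimes F(|x_3-x_4|)\otimes\dots\otimes F(|x_{2n-1}-x_{2n}|)\bigr)f(x_1,\dots,x_{2n})\qquad(x_1>x_2>\dots>x_{2n}).$$ Equivalently, for $\xi_1,\dots,\xi_{2n},\eta_1,\dots,\eta_{2n}\in L^2([0,t],k)$, the number $\langle\eta_1\wedge\dots\wedge\eta_{2n},\,U_{(\lambda,F)}(t)(\xi_1\wedge\dots\wedge\xi_{2n})\rangle$ equals $$e^{i\lambda t}\int_{x_1>\dots>x_{2n}}\ \sum_{\sigma,\tau\in S_{2n}}\mathrm{sgn}(\sigma)\,\mathrm{sgn}(\tau)\prod_{j=1}^{n}\bigl\langle \eta_{\sigma(2j-1)}(x_{2j-1})\otimes\eta_{\sigma(2j)}(x_{2j}),\;F(|x_{2j-1}-x_{2j}|)\,\xi_{\tau(2j-1)}(x_{2j-1})\otimes\xi_{\tau(2j)}(x_{2j})\bigr\rangle\,dx .$$ -/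

import Mathlib

open MeasureTheory
open scoped TensorProduct NNReal
namespace CliffordSystem
noncomputable section

section Fock
variable {V W V' : Type*} [NormedAddCommGroup V] [InnerProductSpace ℂ V]
  [NormedAddCommGroup W] [InnerProductSpace ℂ W]
  [NormedAddCommGroup V'] [InnerProductSpace ℂ V']

/-- The inner product of `v₁ ∧ ⋯ ∧ vₙ` and `w₁ ∧ ⋯ ∧ wₘ`: zero for `n ≠ m`, and
`det ⟪vᵢ, wⱼ⟫` for `n = m`. -/
def wedgeKernel (a b : Σ n : ℕ, Fin n → V) : ℂ :=
  if h : a.1 = b.1 then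
    Matrix.det (Matrix.of fun i j => inner ℂ (a.2 i) (b.2 (Fin.cast h j)))
  else 0

theorem wedgeKernel_same {n : ℕ} (v w : Fin n → V) :
    wedgeKernel ⟨n, v⟩ ⟨n, w⟩ = Matrix.det (Matrix.of fun i j => inner ℂ (v i) (w j)) := by
  simp [wedgeKernel]

theorem wedgeKernel_ne {a b : Σ n : ℕ, Fin n → V} (h : a.1 ≠ b.1) : wedgeKernel a b = 0 := by
  simp [wedgeKernel, h]

theorem wedgeKernel_conj (a b : Σ n : ℕ, Fin n → V) :
    starRingEnd ℂ (wedgeKernel b a) = wedgeKernel a b := by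
  obtain ⟨n, v⟩ := a
  obtain ⟨m, w⟩ := b
  by_cases h : n = m
  · subst h
    rw [wedgeKernel_same, wedgeKernel_same, starRingEnd_apply, ← Matrix.det_conjTranspose]
    congr 1
    ext i j
    simp [Matrix.conjTranspose_apply]
  · rw [wedgeKernel_ne, wedgeKernel_ne] <;> simp [h, Ne.symm h]

open scoped ComplexOrder in
theorem prodKernel_posSemidef {ι : Type*} [Fintype ι] {n : ℕ} (v : ι → Fin n → V)
    (s : Finset (Fin n)) :
    Matrix.PosSemidef (Matrix.of fun a b : ι => ∏ i ∈ s, inner ℂ (v a i) (v b i)) := by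
  classical
  induction s using Finset.induction_on with
  | empty =>
    have : (Matrix.of fun a b : ι => ∏ i ∈ (∅ : Finset (Fin n)), inner ℂ (v a i) (v b i))
      = Matrix.gram ℂ (fun _ : ι => (1 : ℂ)) := by
      ext; simp [Matrix.gram]
    rw [this]
    exact Matrix.posSemidef_gram _ _
  | insert a s ha ih =>
    have : (Matrix.of fun x y : ι => ∏ i ∈ insert a s, inner ℂ (v x i) (v y i))
      = Matrix.hadamard (Matrix.gram ℂ (fun x : ι => v x a))
        (Matrix.of fun x y : ι => ∏ i ∈ s, inner ℂ (v x i) (v y i)) := by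
      ext; simp [Matrix.gram, Finset.prod_insert ha]
    rw [this]
    exact (Matrix.posSemidef_gram _ _).hadamard ih

theorem sum_sign_prod_eq_det {n : ℕ} (M : Matrix (Fin n) (Fin n) ℂ) :
    ∑ σ : Equiv.Perm (Fin n), ∑ τ : Equiv.Perm (Fin n),
      ((Equiv.Perm.sign σ : ℤ) : ℂ) * ((Equiv.Perm.sign τ : ℤ) : ℂ) * ∏ i, M (σ i) (τ i)
      = (n.factorial : ℂ) * M.det := by
  have key : ∀ τ : Equiv.Perm (Fin n), ∑ σ : Equiv.Perm (Fin n),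
      ((Equiv.Perm.sign σ : ℤ) : ℂ) * ((Equiv.Perm.sign τ : ℤ) : ℂ) * ∏ i, M (σ i) (τ i)
      = M.det := by
    intro τ
    rw [Matrix.det_apply']
    refine Fintype.sum_equiv (Equiv.mulRight τ⁻¹) _ _ fun σ => ?_
    have h : ∏ i, M (σ i) (τ i) = ∏ i, M ((σ * τ⁻¹) i) i := by
      rw [← Equiv.prod_comp τ (fun i => M ((σ * τ⁻¹) i) i)]
      simp
    rw [h]
    simp
  rw [Finset.sum_comm, Finset.sum_congr rfl fun τ _ => key τ]
  simp [Fintype.card_perm]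

open scoped ComplexOrder in
theorem detKernel_posSemidef {ι : Type*} [Fintype ι] {n : ℕ} (v : ι → Fin n → V) :
    Matrix.PosSemidef (Matrix.of fun a b : ι =>
      Matrix.det (Matrix.of fun i j => inner ℂ (v a i) (v b j))) := by
  classical
  have hP := prodKernel_posSemidef (fun p : ι × Equiv.Perm (Fin n) => v p.1 ∘ p.2) Finset.univ
  refine Matrix.PosSemidef.of_dotProduct_mulVec_nonneg ?_ fun x => ?_
  · ext a b
    simpa [Matrix.conjTranspose_apply, wedgeKernel_same] using
      wedgeKernel_conj (⟨n, v a⟩ : Σ n : ℕ, Fin n → V) ⟨n, v b⟩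
  · have h := hP.dotProduct_mulVec_nonneg
      (fun p : ι × Equiv.Perm (Fin n) => x p.1 * ((Equiv.Perm.sign p.2 : ℤ) : ℂ))
    have hfac : (0 : ℂ) < (n.factorial : ℂ) := by exact_mod_cast n.factorial_pos
    refine le_of_mul_le_mul_left ?_ hfac
    rw [mul_zero]
    convert h using 1
    simp only [dotProduct, Matrix.mulVec, Fintype.sum_prod_type, Pi.star_apply, Matrix.of_apply,
      Finset.mul_sum]
    refine Finset.sum_congr rfl fun a _ => ?_
    rw [Finset.sum_comm]
    refine Finset.sum_congr rfl fun b _ => ?_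
    rw [mul_left_comm, ← mul_assoc (n.factorial : ℂ), ← sum_sign_prod_eq_det, Finset.sum_mul,
      Finset.mul_sum]
    refine Finset.sum_congr rfl fun σ _ => ?_
    rw [Finset.sum_mul, Finset.mul_sum]
    refine Finset.sum_congr rfl fun τ _ => ?_
    simp
    ring

open scoped ComplexOrder in
theorem wedgeKernel_posSemidef {ι : Type*} [Fintype ι] (v : ι → Σ n : ℕ, Fin n → V) :
    Matrix.PosSemidef (Matrix.of fun a b : ι => wedgeKernel (v a) (v b)) := by
  classical
  let u : ∀ n : ℕ, ι → Fin n → V := fun n a =>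
    if h : (v a).1 = n then fun i => (v a).2 (Fin.cast h.symm i) else 0
  let c : ℕ → ι → ℂ := fun n a => if (v a).1 = n then 1 else 0
  have : (Matrix.of fun a b : ι => wedgeKernel (v a) (v b)) =
      ∑ n ∈ Finset.univ.image (fun a => (v a).1),
        Matrix.hadamard (Matrix.vecMulVec (c n) (star (c n)))
          (Matrix.of fun a b : ι => Matrix.det (Matrix.of fun i j => inner ℂ (u n a i) (u n b j))) := by
    ext a b
    rw [Matrix.sum_apply, Finset.sum_eq_single (v a).1]
    · by_cases h : (v a).1 = (v b).1
      · simp [wedgeKernel, Matrix.vecMulVec_apply, c, u, h]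
      · simp [wedgeKernel, Matrix.vecMulVec_apply, c, h, Ne.symm h]
    · intro n _ hn
      simp [Matrix.vecMulVec_apply, c, Ne.symm hn]
    · intro h
      exact absurd (Finset.mem_image_of_mem _ (Finset.mem_univ a)) h
  rw [this]
  exact Matrix.posSemidef_sum _ fun n _ =>
    (Matrix.posSemidef_vecMulVec_self_star _).hadamard (detKernel_posSemidef _)

/-- The sesquilinear extension of `wedgeKernel` to formal linear combinations. -/
def formalInner (f g : (Σ n : ℕ, Fin n → V) →₀ ℂ) : ℂ :=
  f.sum fun a z => g.sum fun b w => starRingEnd ℂ z * w * wedgeKernel a b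

theorem formalInner_conj (f g : (Σ n : ℕ, Fin n → V) →₀ ℂ) :
    starRingEnd ℂ (formalInner g f) = formalInner f g := by
  unfold formalInner
  rw [Finsupp.sum_comm]
  simp only [map_finsuppSum, map_mul, Complex.conj_conj, wedgeKernel_conj]
  refine Finsupp.sum_congr fun a _ => Finsupp.sum_congr fun b _ => ?_
  ring

theorem formalInner_add (f g h : (Σ n : ℕ, Fin n → V) →₀ ℂ) :
    formalInner (f + g) h = formalInner f h + formalInner g h := by
  classical
  refine Finsupp.sum_add_index' (fun a => by simp) fun a z w => ?_
  rw [← Finsupp.sum_add]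
  refine Finsupp.sum_congr fun b _ => ?_
  rw [map_add]
  ring

theorem formalInner_smul (f g : (Σ n : ℕ, Fin n → V) →₀ ℂ) (r : ℂ) :
    formalInner (r • f) g = starRingEnd ℂ r * formalInner f g := by
  refine (Finsupp.sum_smul_index (fun a => by simp)).trans ?_
  unfold formalInner
  rw [Finsupp.mul_sum]
  refine Finsupp.sum_congr fun b _ => ?_
  rw [Finsupp.mul_sum]
  refine Finsupp.sum_congr fun b _ => ?_
  rw [map_mul]
  ring

open scoped ComplexOrder in
theorem formalInner_self_nonneg (f : (Σ n : ℕ, Fin n → V) →₀ ℂ) : 0 ≤ formalInner f f := by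
  have h := (wedgeKernel_posSemidef
    (fun a : f.support => (a : Σ n : ℕ, Fin n → V))).dotProduct_mulVec_nonneg (fun a => f a)
  convert h using 1
  simp only [formalInner, Finsupp.sum, dotProduct, Matrix.mulVec, Finset.mul_sum]
  rw [← Finset.sum_coe_sort]
  refine Finset.sum_congr rfl fun a _ => ?_
  rw [← Finset.sum_coe_sort]
  refine Finset.sum_congr rfl fun b _ => ?_
  simp
  ring

/-- Formal linear combinations of wedge products `v₁ ∧ ⋯ ∧ vₙ`. -/
def FockPre (V : Type*) : Type _ := (Σ n : ℕ, Fin n → V) →₀ ℂ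

instance {V : Type*} : AddCommGroup (FockPre V) :=
  inferInstanceAs (AddCommGroup ((Σ n : ℕ, Fin n → V) →₀ ℂ))

instance {V : Type*} : Module ℂ (FockPre V) :=
  inferInstanceAs (Module ℂ ((Σ n : ℕ, Fin n → V) →₀ ℂ))

/-- The formal wedge product `v₁ ∧ ⋯ ∧ vₙ`, as a generator. -/
def FockPre.gen {V : Type*} (a : Σ n : ℕ, Fin n → V) : FockPre V := Finsupp.single a (1 : ℂ)

theorem FockPre.induction {V : Type*} {p : FockPre V → Prop} (x : FockPre V) (h0 : p 0)
    (hadd : ∀ x y, p x → p y → p (x + y)) (hgen : ∀ (c : ℂ) a, p (c • FockPre.gen a)) : p x := by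
  refine Finsupp.induction_linear (motive := p) x h0 hadd fun a c => ?_
  have : (Finsupp.single a c : (Σ n : ℕ, Fin n → V) →₀ ℂ) = c • FockPre.gen a :=
    (Finsupp.smul_single_one a c).symm
  rw [this]
  exact hgen c a

/-- The linear extension of a function on the formal wedge products. -/
def FockPre.lift {V E : Type*} [AddCommGroup E] [Module ℂ E]
    (f : (Σ n : ℕ, Fin n → V) → E) : FockPre V →ₗ[ℂ] E :=
  Finsupp.linearCombination ℂ f

theorem FockPre.lift_gen {V E : Type*} [AddCommGroup E] [Module ℂ E]
    (f : (Σ n : ℕ, Fin n → V) → E) (a : Σ n : ℕ, Fin n → V) :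
    FockPre.lift f (FockPre.gen a) = f a := by
  simp only [FockPre.lift, FockPre.gen]
  exact (Finsupp.linearCombination_single ℂ 1 a).trans (one_smul ℂ _)

instance : PreInnerProductSpace.Core ℂ (FockPre V) where
  inner f g := formalInner f g
  conj_inner_symm f g := formalInner_conj f g
  add_left f g h := formalInner_add f g h
  smul_left f g r := formalInner_smul f g r
  re_inner_nonneg f := (Complex.nonneg_iff.1 (formalInner_self_nonneg f)).1

instance : SeminormedAddCommGroup (FockPre V) :=
  InnerProductSpace.Core.toSeminormedAddCommGroup (𝕜 := ℂ)

instance : InnerProductSpace ℂ (FockPre V) := .ofCore _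

theorem FockPre.inner_gen (a b : Σ n : ℕ, Fin n → V) :
    inner ℂ (FockPre.gen a) (FockPre.gen b) = wedgeKernel a b := by
  change formalInner (Finsupp.single a 1) (Finsupp.single b 1) = _
  simp [formalInner]

/-- The antisymmetric Fock space `Γ(V)`. -/
abbrev Fock (V : Type*) [NormedAddCommGroup V] [InnerProductSpace ℂ V] : Type _ :=
  UniformSpace.Completion (FockPre V)

/-- `v₁ ∧ ⋯ ∧ vₙ ∈ Γ(V)`; for `n = 0` this is the vacuum vector. -/
def wedge {n : ℕ} (v : Fin n → V) : Fock V := ((FockPre.gen ⟨n, v⟩ : FockPre V) : Fock V)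

theorem inner_wedge {n : ℕ} (v w : Fin n → V) :
    inner ℂ (wedge v) (wedge w) = Matrix.det (Matrix.of fun i j => inner ℂ (v i) (w j)) := by
  rw [wedge, wedge, UniformSpace.Completion.inner_coe, FockPre.inner_gen, wedgeKernel_same]

theorem inner_wedge_of_ne {n m : ℕ} (h : n ≠ m) (v : Fin n → V) (w : Fin m → V) :
    inner ℂ (wedge v) (wedge w) = 0 := by
  rw [wedge, wedge, UniformSpace.Completion.inner_coe, FockPre.inner_gen, wedgeKernel_ne h]

theorem wedgeKernel_append (f : V →ₗᵢ[ℂ] W) (g : V' →ₗᵢ[ℂ] W)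
    (h : ∀ v v', inner ℂ (f v) (g v') = 0) (a c : Σ n : ℕ, Fin n → V) (b d : Σ n : ℕ, Fin n → V') :
    wedgeKernel (⟨b.1 + a.1, Fin.append (g ∘ b.2) (f ∘ a.2)⟩ : Σ n : ℕ, Fin n → W)
      ⟨d.1 + c.1, Fin.append (g ∘ d.2) (f ∘ c.2)⟩ = wedgeKernel a c * wedgeKernel b d := by
  classical
  have h' : ∀ v v', inner ℂ (g v') (f v) = 0 := fun v v' => by
    rw [← inner_conj_symm, h, map_zero]
  obtain ⟨n, a⟩ := a
  obtain ⟨m, c⟩ := c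
  obtain ⟨p, b⟩ := b
  obtain ⟨q, d⟩ := d
  by_cases h1 : n = m
  · subst h1
    by_cases h2 : p = q
    · subst h2
      rw [wedgeKernel_same, wedgeKernel_same, wedgeKernel_same,
        ← Matrix.det_submatrix_equiv_self finSumFinEquiv, mul_comm,
        ← Matrix.det_fromBlocks_zero₂₁ _ 0 _]
      congr 1
      ext i j
      rcases i with i | i <;> rcases j with j | j <;> simp [h, h', finSumFinEquiv]
    · rw [wedgeKernel_ne, wedgeKernel_ne (a := ⟨p, b⟩) (b := ⟨q, d⟩) h2, mul_zero]
      simpa using h2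
  · rw [wedgeKernel_ne (a := ⟨n, a⟩) (b := ⟨m, c⟩) h1, zero_mul]
    by_cases h2 : p + n = q + m
    · rw [wedgeKernel, dif_pos h2]
      change Matrix.det (Matrix.of fun i j : Fin (p + n) =>
        inner ℂ (Fin.append (g ∘ b) (f ∘ a) i)
          (Fin.append (g ∘ d) (f ∘ c) (Fin.cast h2 j))) = 0
      rw [Matrix.det_apply']
      refine Finset.sum_eq_zero fun σ _ => ?_
      suffices hs : ∃ i : Fin (p + n), Matrix.of (fun i j : Fin (p + n) =>
          inner ℂ (Fin.append (g ∘ b) (f ∘ a) i) (Fin.append (g ∘ d) (f ∘ c) (Fin.cast h2 j)))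
            (σ i) i = 0 by
        obtain ⟨i, hi⟩ := hs
        exact mul_eq_zero_of_right _ (Finset.prod_eq_zero (Finset.mem_univ i) hi)
      by_contra hcon
      push Not at hcon
      have key : ∀ i : Fin (p + n), ((σ i : ℕ) < p ↔ (i : ℕ) < q) := by
        intro i
        have hi := hcon i
        rw [Matrix.of_apply] at hi
        generalize hk : σ i = k at hi
        have hk' : (Fin.cast h2 i : Fin (q + m)).val = i.val := rfl
        generalize Fin.cast h2 i = l at hi hk'
        rw [← hk']
        induction k using Fin.addCases with
        | left k =>
          induction l using Fin.addCases with
          | left l => simp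
          | right l => simp [h'] at hi
        | right k =>
          induction l using Fin.addCases with
          | left l => simp [h] at hi
          | right l => simp
      have hcard : (Finset.univ.filter fun i : Fin (p + n) => (i : ℕ) < p).card
          = (Finset.univ.filter fun i : Fin (p + n) => (i : ℕ) < q).card := by
        refine (Finset.card_bij (fun i _ => σ i) ?_ ?_ ?_).symm
        · intro i hi
          simpa [key] using hi
        · intro i _ j _ hij
          exact σ.injective hij
        · intro j hj
          refine ⟨σ.symm j, ?_, by simp⟩
          have := key (σ.symm j)
          simp only [Equiv.apply_symm_apply] at this
          simpa [← this] using hj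
      rw [Fin.card_filter_val_lt, Fin.card_filter_val_lt] at hcard
      omega
    · exact wedgeKernel_ne h2

/-- The bilinear map `(v, v') ↦ g v' ∧ f v` on formal linear combinations. -/
def formalMul {V W V' : Type*} (f : V → W) (g : V' → W) : FockPre V →ₗ[ℂ] FockPre V' →ₗ[ℂ] FockPre W :=
  FockPre.lift fun a => FockPre.lift fun b =>
    FockPre.gen ⟨b.1 + a.1, Fin.append (g ∘ b.2) (f ∘ a.2)⟩

theorem formalMul_gen {V W V' : Type*} (f : V → W) (g : V' → W) (a : Σ n : ℕ, Fin n → V)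
    (b : Σ n : ℕ, Fin n → V') : formalMul f g (FockPre.gen a) (FockPre.gen b) =
      FockPre.gen ⟨b.1 + a.1, Fin.append (g ∘ b.2) (f ∘ a.2)⟩ := by
  rw [formalMul, FockPre.lift_gen, FockPre.lift_gen]

theorem inner_formalMul (f : V →ₗᵢ[ℂ] W) (g : V' →ₗᵢ[ℂ] W)
    (h : ∀ v v', inner ℂ (f v) (g v') = 0) (x x' : FockPre V) (y y' : FockPre V') :
    inner ℂ (formalMul f g x y) (formalMul f g x' y') = inner ℂ x x' * inner ℂ y y' := by
  induction x using FockPre.induction with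
  | h0 => simp
  | hadd x₁ x₂ h₁ h₂ => simp only [map_add, LinearMap.add_apply, inner_add_left, h₁, h₂, add_mul]
  | hgen r a =>
  induction x' using FockPre.induction with
  | h0 => simp
  | hadd x₁ x₂ h₁ h₂ => simp only [map_add, LinearMap.add_apply, inner_add_right, h₁, h₂, add_mul]
  | hgen r' a' =>
  induction y using FockPre.induction with
  | h0 => simp
  | hadd x₁ x₂ h₁ h₂ => simp only [map_add, inner_add_left, h₁, h₂, mul_add]
  | hgen s b =>
  induction y' using FockPre.induction with
  | h0 => simp
  | hadd x₁ x₂ h₁ h₂ => simp only [map_add, inner_add_right, h₁, h₂, mul_add]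
  | hgen s' b' =>
    simp only [map_smul, LinearMap.smul_apply, inner_smul_left, inner_smul_right, formalMul_gen,
      FockPre.inner_gen, wedgeKernel_append f g h]
    ring

theorem norm_formalMul (f : V →ₗᵢ[ℂ] W) (g : V' →ₗᵢ[ℂ] W)
    (h : ∀ v v', inner ℂ (f v) (g v') = 0) (x : FockPre V) (y : FockPre V') :
    ‖formalMul f g x y‖ = ‖x‖ * ‖y‖ := by
  have := inner_formalMul f g h x x y y
  rw [inner_self_eq_norm_sq_to_K, inner_self_eq_norm_sq_to_K, inner_self_eq_norm_sq_to_K] at this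
  have h2 : ‖formalMul f g x y‖ ^ 2 = (‖x‖ * ‖y‖) ^ 2 := by
    rw [mul_pow]
    exact_mod_cast this
  exact (sq_eq_sq₀ (norm_nonneg _) (by positivity)).1 h2

/-- For isometries `f : V → W` and `g : V' → W` with orthogonal ranges, the bilinear map
`Γ(V) × Γ(V') → Γ(W)` given by
`(v₁ ∧ ⋯ ∧ vₘ, v'₁ ∧ ⋯ ∧ v'ₙ) ↦ g v'₁ ∧ ⋯ ∧ g v'ₙ ∧ f v₁ ∧ ⋯ ∧ f vₘ`,
extended by continuity. It is multiplicative for the inner products, that is, it is an isometry on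
`Γ(V) ⊗ Γ(V')`. -/
def wedgeMul (f : V →ₗᵢ[ℂ] W) (g : V' →ₗᵢ[ℂ] W) (h : ∀ v v', inner ℂ (f v) (g v') = 0) :
    Fock V →L[ℂ] Fock V' →L[ℂ] Fock W :=
  let B : FockPre V →L[ℂ] FockPre V' →L[ℂ] FockPre W :=
    (formalMul f g).mkContinuous₂ 1 fun x y => by rw [norm_formalMul f g h, one_mul]
  let C : FockPre V →L[ℂ] FockPre V' →L[ℂ] Fock W :=
    (ContinuousLinearMap.compL ℂ (FockPre V') (FockPre W) (Fock W)
      UniformSpace.Completion.toComplL).comp B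
  ((C.extend UniformSpace.Completion.toComplL).flip.extend UniformSpace.Completion.toComplL).flip

theorem wedgeMul_coe (f : V →ₗᵢ[ℂ] W) (g : V' →ₗᵢ[ℂ] W)
    (h : ∀ v v', inner ℂ (f v) (g v') = 0) (x : FockPre V) (y : FockPre V') :
    wedgeMul f g h (x : Fock V) (y : Fock V') = (formalMul f g x y : Fock W) := by
  simp only [wedgeMul, ContinuousLinearMap.flip_apply]
  rw [← UniformSpace.Completion.coe_toComplL (𝕜 := ℂ) (E := FockPre V'),
    ContinuousLinearMap.extend_eq _ UniformSpace.Completion.denseRange_coe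
      (UniformSpace.Completion.isUniformInducing_coe _), ContinuousLinearMap.flip_apply,
    ← UniformSpace.Completion.coe_toComplL (𝕜 := ℂ) (E := FockPre V),
    ContinuousLinearMap.extend_eq _ UniformSpace.Completion.denseRange_coe
      (UniformSpace.Completion.isUniformInducing_coe _)]
  rfl

theorem wedgeMul_wedge (f : V →ₗᵢ[ℂ] W) (g : V' →ₗᵢ[ℂ] W)
    (h : ∀ v v', inner ℂ (f v) (g v') = 0) {m n : ℕ} (v : Fin m → V) (v' : Fin n → V') :
    wedgeMul f g h (wedge v) (wedge v') = wedge (Fin.append (g ∘ v') (f ∘ v)) := by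
  rw [wedge, wedge, wedgeMul_coe, formalMul_gen]
  rfl

theorem inner_wedgeMul (f : V →ₗᵢ[ℂ] W) (g : V' →ₗᵢ[ℂ] W)
    (h : ∀ v v', inner ℂ (f v) (g v') = 0) (x x' : Fock V) (y y' : Fock V') :
    inner ℂ (wedgeMul f g h x y) (wedgeMul f g h x' y') = inner ℂ x x' * inner ℂ y y' := by
  induction x using UniformSpace.Completion.induction_on with
  | hp => exact isClosed_eq (by fun_prop) (by fun_prop)
  | ih x =>
  induction x' using UniformSpace.Completion.induction_on with
  | hp => exact isClosed_eq (by fun_prop) (by fun_prop)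
  | ih x' =>
  induction y using UniformSpace.Completion.induction_on with
  | hp => exact isClosed_eq (by fun_prop) (by fun_prop)
  | ih y =>
  induction y' using UniformSpace.Completion.induction_on with
  | hp => exact isClosed_eq (by fun_prop) (by fun_prop)
  | ih y' =>
    simp only [wedgeMul_coe, UniformSpace.Completion.inner_coe, inner_formalMul f g h]

/-- The even part `⨁_{n ∈ 2ℕ₀} V^{∧ n}` of `Γ(V)`. -/
def evenFock (V : Type*) [NormedAddCommGroup V] [InnerProductSpace ℂ V] :
    Submodule ℂ (Fock V) :=
  (Submodule.span ℂ {x | ∃ (n : ℕ) (v : Fin (2 * n) → V), x = wedge v}).topologicalClosure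

theorem wedge_mem_evenFock {n : ℕ} (v : Fin n → V) (hn : Even n) : wedge v ∈ evenFock V := by
  obtain ⟨m, hm⟩ := hn
  obtain rfl : n = 2 * m := by omega
  exact Submodule.le_topologicalClosure _ (Submodule.subset_span ⟨m, v, rfl⟩)

theorem wedgeMul_mem_evenFock (f : V →ₗᵢ[ℂ] W) (g : V' →ₗᵢ[ℂ] W)
    (h : ∀ v v', inner ℂ (f v) (g v') = 0) {x : Fock V} {y : Fock V'}
    (hx : x ∈ evenFock V) (hy : y ∈ evenFock V') : wedgeMul f g h x y ∈ evenFock W := by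
  have hc : IsClosed (evenFock W : Set (Fock W)) := Submodule.isClosed_topologicalClosure _
  have h1 : ∀ (m : ℕ) (v : Fin (2 * m) → V), wedgeMul f g h (wedge v) y ∈ evenFock W := by
    intro m v
    have hle : evenFock V' ≤ (evenFock W).comap (wedgeMul f g h (wedge v)).toLinearMap := by
      refine Submodule.topologicalClosure_minimal _ (Submodule.span_le.2 ?_)
        (hc.preimage (wedgeMul f g h (wedge v)).continuous)
      rintro _ ⟨n, v', rfl⟩
      change wedgeMul f g h (wedge v) (wedge v') ∈ evenFock W
      rw [wedgeMul_wedge]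
      exact wedge_mem_evenFock _ ⟨n + m, by ring⟩
    exact hle hy
  have hle : evenFock V ≤ (evenFock W).comap ((wedgeMul f g h).flip y).toLinearMap := by
    refine Submodule.topologicalClosure_minimal _ (Submodule.span_le.2 ?_)
      (hc.preimage ((wedgeMul f g h).flip y).continuous)
    rintro _ ⟨m, v, rfl⟩
    exact h1 m v
  exact hle hx

/-- The second quantization `Γ(f) : Γ(V) → Γ(W)` of an isometry `f`, that is,
`v₁ ∧ ⋯ ∧ vₙ ↦ f v₁ ∧ ⋯ ∧ f vₙ`. -/
def secondQuantization (f : V →ₗᵢ[ℂ] W) : Fock V →L[ℂ] Fock W :=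
  let L : FockPre V →ₗ[ℂ] FockPre W := FockPre.lift fun a => FockPre.gen ⟨a.1, f ∘ a.2⟩
  have hL : ∀ x y, inner ℂ (L x) (L y) = inner ℂ x y := by
    intro x y
    induction x using FockPre.induction with
    | h0 => simp
    | hadd x₁ x₂ h₁ h₂ => simp only [map_add, inner_add_left, h₁, h₂]
    | hgen r a =>
    induction y using FockPre.induction with
    | h0 => simp
    | hadd x₁ x₂ h₁ h₂ => simp only [map_add, inner_add_right, h₁, h₂]
    | hgen s b =>
      simp only [map_smul, inner_smul_left, inner_smul_right, L, FockPre.lift_gen,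
        FockPre.inner_gen, wedgeKernel, Function.comp_apply, LinearIsometry.inner_map_map]
  ((UniformSpace.Completion.toComplL : FockPre W →L[ℂ] Fock W).comp
    (L.isometryOfInner hL).toContinuousLinearMap).extend UniformSpace.Completion.toComplL

theorem secondQuantization_wedge (f : V →ₗᵢ[ℂ] W) {n : ℕ} (v : Fin n → V) :
    secondQuantization f (wedge v) = wedge (f ∘ v) := by
  rw [wedge, secondQuantization, ← UniformSpace.Completion.coe_toComplL (𝕜 := ℂ) (E := FockPre V)]
  refine (ContinuousLinearMap.extend_eq _ UniformSpace.Completion.denseRange_coe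
    (UniformSpace.Completion.isUniformInducing_coe _) _).trans ?_
  simp only [ContinuousLinearMap.comp_apply]
  change ((FockPre.lift _ (FockPre.gen _) : FockPre W) : Fock W) = _
  rw [FockPre.lift_gen]
  rfl

end Fock

section System
variable (k : Type*) [NormedAddCommGroup k] [InnerProductSpace ℂ k]

/-- The index set `(0, ∞)` of the system. -/
abbrev Time : Type := {t : ℝ // 0 < t}

/-- `L²(ℝ, k)`. -/
abbrev L2Line : Type _ := Lp k 2 (volume : Measure ℝ)

/-- `L²([0, t], k)`, as the space of functions in `L²(ℝ, k)` vanishing outside `[0, t]`. -/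
def L2Interval (t : Time) : Submodule ℂ (L2Line k) where
  carrier := {f | ∀ᵐ x, x ∉ Set.Icc (0 : ℝ) t → f x = 0}
  add_mem' {f g} hf hg := by
    filter_upwards [hf, hg, Lp.coeFn_add f g] with x h1 h2 h3 hx
    rw [h3, Pi.add_apply, h1 hx, h2 hx, add_zero]
  zero_mem' := by
    filter_upwards [Lp.coeFn_zero k 2 (volume : Measure ℝ)] with x h _
    rw [h, Pi.zero_apply]
  smul_mem' c f hf := by
    filter_upwards [hf, Lp.coeFn_smul c f] with x h1 h2 hx
    rw [h2, Pi.smul_apply, h1 hx, smul_zero]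

variable {k}

theorem mem_L2Interval_iff {t : Time} {f : L2Line k} :
    f ∈ L2Interval k t ↔ ∀ᵐ x, x ∉ Set.Icc (0 : ℝ) t → f x = 0 := Iff.rfl

theorem L2Interval_le (s t : Time) : L2Interval k s ≤ L2Interval k (s + t) := fun f hf => by
  rw [mem_L2Interval_iff] at hf ⊢
  filter_upwards [hf] with x h hx
  refine h fun hx' => hx ⟨hx'.1, hx'.2.trans ?_⟩
  simpa using t.2.le

/-- The inclusion `L²([0, s], k) ⊆ L²([0, s + t], k)`. -/
def inclusion (s t : Time) : L2Interval k s →ₗᵢ[ℂ] L2Interval k (s + t) where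
  toLinearMap := Submodule.inclusion (L2Interval_le s t)
  norm_map' _ := rfl

/-- The right shift `(T_s f)(x) = f (x - s)` on `L²(ℝ, k)`. -/
def shiftLine (s : Time) : L2Line k →ₗᵢ[ℂ] L2Line k :=
  Lp.compMeasurePreservingₗᵢ ℂ (fun x => x - (s : ℝ))
    (measurePreserving_sub_right volume (s : ℝ))

theorem shiftLine_ae (s : Time) (f : L2Line k) :
    ∀ᵐ x, shiftLine s f x = f (x - s) :=
  Lp.coeFn_compMeasurePreserving f (measurePreserving_sub_right volume (s : ℝ))

theorem shiftLine_mem (s t : Time) {f : L2Line k} (hf : f ∈ L2Interval k t) :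
    shiftLine s f ∈ L2Interval k (s + t) := by
  rw [mem_L2Interval_iff] at hf ⊢
  have h := (measurePreserving_sub_right volume (s : ℝ)).quasiMeasurePreserving.ae hf
  filter_upwards [h, shiftLine_ae s f] with x h1 h2 hx
  refine h2.trans (h1 fun hx' => hx ⟨?_, ?_⟩)
  · linarith [hx'.1, s.2]
  · have := hx'.2
    rw [Positive.coe_add]
    linarith

/-- The right shift `T_s : L²([0, t], k) → L²([0, s + t], k)`. -/
def shift (s t : Time) : L2Interval k t →ₗᵢ[ℂ] L2Interval k (s + t) where
  toFun f := ⟨shiftLine s f, shiftLine_mem s t f.2⟩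
  map_add' f g := Subtype.ext (map_add (shiftLine s) (f : L2Line k) g)
  map_smul' c f := Subtype.ext (map_smul (shiftLine s) c (f : L2Line k))
  norm_map' f := (shiftLine s).norm_map (f : L2Line k)

theorem inner_inclusion_shift (s t : Time) (f : L2Interval k s) (g : L2Interval k t) :
    inner ℂ (inclusion s t f) (shift s t g) = 0 := by
  change inner ℂ (f : L2Line k) (shiftLine s (g : L2Line k)) = 0
  rw [L2.inner_def]
  have h := (measurePreserving_sub_right volume (s : ℝ)).quasiMeasurePreserving.ae g.2
  have hs : ∀ᵐ x : ℝ, x ≠ s := by simp [ae_iff, measure_singleton]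
  refine integral_eq_zero_of_ae ?_
  filter_upwards [h, shiftLine_ae s (g : L2Line k), f.2, hs] with x h1 h2 h3 h4
  by_cases hx : x ∈ Set.Icc (0 : ℝ) s
  · have : (g : L2Line k) (x - s) = 0 :=
      h1 fun hx' => h4 (le_antisymm hx.2 (by linarith [hx'.1]))
    rw [h2, this, inner_zero_right, Pi.zero_apply]
  · rw [h3 hx, inner_zero_left, Pi.zero_apply]

variable (k)

/-- The fibre `H_t = ⨁_{n ∈ 2ℕ₀} L²([0, t], k)^{∧ n}` of the Clifford super-product system. -/
abbrev Fiber (t : Time) : Type _ := evenFock (L2Interval k t)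

variable {k}

/-- The map `(x, y) ↦ U_{s,t} (x ⊗ y)` from `H_s × H_t` to `H_{s+t}`. -/
def mul (s t : Time) (x : Fiber k s) (y : Fiber k t) : Fiber k (s + t) :=
  ⟨wedgeMul (inclusion s t) (shift s t) (inner_inclusion_shift s t) x y,
    wedgeMul_mem_evenFock _ _ _ x.2 y.2⟩

/-- `ξ₁ ∧ ⋯ ∧ ξ₂ₙ` as an element of the fibre `H_t`. -/
def evenWedge (t : Time) {n : ℕ} (ξ : Fin (2 * n) → L2Interval k t) : Fiber k t :=
  ⟨wedge ξ, wedge_mem_evenFock ξ (even_two_mul n)⟩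

variable (k)

/-- The total space `{(t, x) : t > 0, x ∈ H_t}`. -/
def TotalSpace : Type _ := Σ t : Time, Fiber k t

/-- The Borel structure of the total space: as a subset of `(0, ∞) × Γ(L²(ℝ, k))`. -/
instance : MeasurableSpace (TotalSpace k) :=
  MeasurableSpace.comap (fun p : TotalSpace k => p.1) inferInstance ⊔
  MeasurableSpace.comap (fun p : TotalSpace k =>
      secondQuantization (L2Interval k p.1).subtypeₗᵢ (p.2 : Fock (L2Interval k p.1)))
    (borel (Fock (L2Line k)))

variable {k} in
/-- The map `(t, x) ↦ (t, θ_t x)` of the total space. -/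
def totalMap (θ : ∀ t : Time, Fiber k t ≃ₗᵢ[ℂ] Fiber k t) (p : TotalSpace k) : TotalSpace k :=
  ⟨p.1, θ p.1 p.2⟩

/-- The automorphism group of the Clifford super-product system: families of unitaries `θ_t` of
`H_t` with `θ_{s+t} U_{s,t} = U_{s,t} (θ_s ⊗ θ_t)` that form a Borel isomorphism of the total
space. -/
def Aut : Subgroup (∀ t : Time, Fiber k t ≃ₗᵢ[ℂ] Fiber k t) where
  carrier := {θ | (∀ (s t : Time) (x : Fiber k s) (y : Fiber k t),
      θ (s + t) (mul s t x y) = mul s t (θ s x) (θ t y)) ∧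
    Measurable (totalMap θ) ∧ Measurable (totalMap fun t => (θ t).symm)}
  mul_mem' {θ φ} hθ hφ := by
    refine ⟨fun s t x y => ?_, hθ.2.1.comp hφ.2.1, hφ.2.2.comp hθ.2.2⟩
    change θ (s + t) (φ (s + t) (mul s t x y)) = mul s t (θ s (φ s x)) (θ t (φ t y))
    rw [hφ.1, hθ.1]
  one_mem' := ⟨fun _ _ _ _ => rfl, measurable_id, measurable_id⟩
  inv_mem' {θ} hθ := by
    refine ⟨fun s t x y => ?_, hθ.2.2, hθ.2.1⟩
    change (θ (s + t)).symm (mul s t x y) = mul s t ((θ s).symm x) ((θ t).symm y)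
    rw [LinearIsometryEquiv.symm_apply_eq, hθ.1, LinearIsometryEquiv.apply_symm_apply,
      LinearIsometryEquiv.apply_symm_apply]

/-- The Hilbert space tensor product `k ⊗ k`. -/
abbrev TensorSquare : Type _ := UniformSpace.Completion (k ⊗[ℂ] k)

instance [TopologicalSpace.SeparableSpace k] :
    TopologicalSpace.SeparableSpace (TensorSquare k) := by
  have h1 : TopologicalSpace.IsSeparable
      (Set.range fun x : k × k => x.1 ⊗ₜ[ℂ] x.2) :=
    TopologicalSpace.isSeparable_range TensorProduct.continuous_tmul
  have h2 := h1.span (R := ℂ)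
  have h3 : Submodule.span ℂ (Set.range fun x : k × k => x.1 ⊗ₜ[ℂ] x.2) = ⊤ := by
    rw [← TensorProduct.span_tmul_eq_top]
    congr 1
    ext z
    simp
  rw [h3] at h2
  have h4 : TopologicalSpace.SeparableSpace (k ⊗[ℂ] k) :=
    TopologicalSpace.isSeparable_univ_iff.1 h2
  exact UniformSpace.Completion.denseRange_coe.separableSpace
    (UniformSpace.Completion.continuous_coe _)

theorem countable_of_orthonormal {E ι : Type*} [NormedAddCommGroup E] [InnerProductSpace ℂ E]
    [TopologicalSpace.SeparableSpace E] {b : ι → E} (hb : Orthonormal ℂ b) : Countable ι := by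
  have h : Pairwise fun i j => Disjoint (Metric.ball (b i) (1 / 2)) (Metric.ball (b j) (1 / 2)) := by
    intro i j hij
    refine Metric.ball_disjoint_ball ?_
    have h0 : inner ℂ (b i) (b j) = 0 := hb.2 hij
    have h1 := norm_sub_sq (𝕜 := ℂ) (b i) (b j)
    rw [hb.1, hb.1, h0, map_zero] at h1
    rw [dist_eq_norm]
    nlinarith [norm_nonneg (b i - b j)]
  exact Pairwise.countable_of_isOpen_disjoint h (fun i => Metric.isOpen_ball)
    fun i => Metric.nonempty_ball.2 (by norm_num)

/-- The group of measurable functions from `ℝ₊` to the unitary group of `k ⊗ k` (with the Borel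
structure of its weak, equivalently strong, operator topology), with pointwise multiplication. -/
def MeasurableUnitaries [TopologicalSpace.SeparableSpace k] :
    Subgroup (ℝ≥0 → TensorSquare k ≃ₗᵢ[ℂ] TensorSquare k) where
  carrier := {F | ∀ v w, Measurable fun r => (inner ℂ v (F r w) : ℂ)}
  one_mem' v w := measurable_const (a := (inner ℂ v w : ℂ))
  inv_mem' {F} hF v w := by
    have h : ∀ r, (inner ℂ v (F⁻¹ r w) : ℂ) = starRingEnd ℂ (inner ℂ w (F r v)) := fun r => by
      rw [inner_conj_symm, ← LinearIsometryEquiv.inner_map_map (F r) v]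
      congr 1
      exact (F r).apply_symm_apply w
    simp only [h]
    exact Complex.continuous_conj.measurable.comp (hF w v)
  mul_mem' {F G} hF hG v w := by
    obtain ⟨e, b, -⟩ := exists_hilbertBasis ℂ (TensorSquare k)
    have hc : Countable e := countable_of_orthonormal b.orthonormal
    have h : ∀ r, HasSum (fun i => starRingEnd ℂ (inner ℂ (b i) (F⁻¹ r v)) * inner ℂ (b i) (G r w))
        (inner ℂ v ((F * G) r w) : ℂ) := fun r => by
      have h1 := b.hasSum_inner_mul_inner (F⁻¹ r v) (G r w)
      have h2 : (inner ℂ (F⁻¹ r v) (G r w) : ℂ) = inner ℂ v ((F * G) r w) := by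
        rw [← LinearIsometryEquiv.inner_map_map (F r)]
        congr 1
        exact (F r).apply_symm_apply v
      simpa only [h2, inner_conj_symm] using h1
    have hFi : ∀ v w, Measurable fun r => (inner ℂ v (F⁻¹ r w) : ℂ) := by
      intro v w
      have h : ∀ r, (inner ℂ v (F⁻¹ r w) : ℂ) = starRingEnd ℂ (inner ℂ w (F r v)) := fun r => by
        rw [inner_conj_symm, ← LinearIsometryEquiv.inner_map_map (F r) v]
        congr 1
        exact (F r).apply_symm_apply w
      simp only [h]
      exact Complex.continuous_conj.measurable.comp (hF w v)
    refine measurable_of_tendsto_metrizable' (Filter.atTop : Filter (Finset e))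
      (f := fun s r => ∑ i ∈ s, starRingEnd ℂ (inner ℂ (b i) (F⁻¹ r v)) * inner ℂ (b i) (G r w))
      (fun s => ?_) (tendsto_pi_nhds.2 fun r => h r)
    exact Finset.measurable_sum _ fun i _ =>
      (Complex.continuous_conj.measurable.comp (hFi (b i) v)).mul (hG (b i) w)

/-- The measurable functions that equal `1` almost everywhere on `ℝ₊`. -/
def AeTrivial [TopologicalSpace.SeparableSpace k] : Subgroup (MeasurableUnitaries k) where
  carrier := {F | ∀ᵐ r : ℝ, 0 ≤ r → F.1 r.toNNReal = 1}
  one_mem' := by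
    change ∀ᵐ r : ℝ, 0 ≤ r → (1 : TensorSquare k ≃ₗᵢ[ℂ] TensorSquare k) = 1
    exact Filter.Eventually.of_forall fun _ _ => rfl
  mul_mem' {F G} hF hG := by
    change ∀ᵐ r : ℝ, 0 ≤ r → F.1 r.toNNReal * G.1 r.toNNReal = 1
    have hF' : ∀ᵐ r : ℝ, 0 ≤ r → F.1 r.toNNReal = 1 := hF
    have hG' : ∀ᵐ r : ℝ, 0 ≤ r → G.1 r.toNNReal = 1 := hG
    filter_upwards [hF', hG'] with r h1 h2 hr
    rw [h1 hr, h2 hr, mul_one]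
  inv_mem' {F} hF := by
    change ∀ᵐ r : ℝ, 0 ≤ r → (F.1 r.toNNReal)⁻¹ = 1
    have hF' : ∀ᵐ r : ℝ, 0 ≤ r → F.1 r.toNNReal = 1 := hF
    filter_upwards [hF'] with r h hr
    rw [h hr, inv_one]

instance [TopologicalSpace.SeparableSpace k] : (AeTrivial k).Normal where
  conj_mem F hF G := by
    change ∀ᵐ r : ℝ, 0 ≤ r → G.1 r.toNNReal * F.1 r.toNNReal * (G.1 r.toNNReal)⁻¹ = 1
    have hF' : ∀ᵐ r : ℝ, 0 ≤ r → F.1 r.toNNReal = 1 := hF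
    filter_upwards [hF'] with r h hr
    rw [h hr, mul_one, mul_inv_cancel]

/-- `M(ℝ₊; U(k ⊗ k))`: measurable unitary-valued functions, modulo equality almost everywhere. -/
abbrev MeasurableUnitaryGroup [TopologicalSpace.SeparableSpace k] : Type _ :=
  MeasurableUnitaries k ⧸ AeTrivial k

variable {k}

/-- The first position `2j` of the `j`-th pair among `2n` positions (counted from zero). -/
def fstIdx {n : ℕ} (j : Fin n) : Fin (2 * n) := ⟨2 * j, by omega⟩

/-- The second position `2j + 1` of the `j`-th pair among `2n` positions (counted from zero). -/
def sndIdx {n : ℕ} (j : Fin n) : Fin (2 * n) := ⟨2 * j + 1, by omega⟩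

/-- `f_{2j}(x_{2j}) ⊗ f_{2j+1}(x_{2j+1}) ∈ k ⊗ k`. -/
def pairTensor {n : ℕ} (f : Fin (2 * n) → ℝ → k) (x : Fin (2 * n) → ℝ) (j : Fin n) :
    TensorSquare k :=
  ((f (fstIdx j) (x (fstIdx j)) ⊗ₜ[ℂ] f (sndIdx j) (x (sndIdx j)) : k ⊗[ℂ] k) : TensorSquare k)

/-- Write `(f₁ ∧ ⋯ ∧ f₂ₙ)(x) = ∑ τ, sign τ • f_{τ 1}(x₁) ⊗ ⋯ ⊗ f_{τ (2n)}(x₂ₙ) ∈ k^{⊗ 2n}` for `x` in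
the simplex `Δ = {x₁ > ⋯ > x₂ₙ}`; up to this normalisation, restriction to `Δ` is the unitary
identification of antisymmetric functions with `L²(Δ, k^{⊗ 2n})`. The number below is
`∫_Δ ⟪(g₁ ∧ ⋯ ∧ g₂ₙ)(x), (F(|x₁ - x₂|) ⊗ F(|x₃ - x₄|) ⊗ ⋯) (f₁ ∧ ⋯ ∧ f₂ₙ)(x)⟫ dx`,
the matrix coefficient of the operator that acts on functions on `Δ` as multiplication by
`F(|x₁ - x₂|) ⊗ F(|x₃ - x₄|) ⊗ ⋯ ⊗ F(|x₂ₙ₋₁ - x₂ₙ|)`. For `n = 1` it is multiplication by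
`F(|x - y|)` of the two-particle functions on `x > y`. -/
def pairCoeff (F : ℝ≥0 → TensorSquare k ≃ₗᵢ[ℂ] TensorSquare k) {n : ℕ}
    (g f : Fin (2 * n) → ℝ → k) : ℂ :=
  ∫ x in {x : Fin (2 * n) → ℝ | StrictAnti x},
    ∑ σ : Equiv.Perm (Fin (2 * n)), ∑ τ : Equiv.Perm (Fin (2 * n)),
      ((Equiv.Perm.sign σ : ℤ) : ℂ) * ((Equiv.Perm.sign τ : ℤ) : ℂ) *
        ∏ j : Fin n, inner ℂ (pairTensor (g ∘ σ) x j)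
          (F (Real.nnabs (x (fstIdx j) - x (sndIdx j))) (pairTensor (f ∘ τ) x j))

end System
end
end CliffordSystem

namespace CliffordSystem
noncomputable section

/-! ### Tensor powers of the Hilbert space `k ⊗ k` -/

section TensorPowers

-- An antisymmetric function is determined by its values on the simplex `x₁ > ⋯ > x₂ₙ`. Hence `H_t`
-- becomes the space of square integrable functions on decreasing configurations of evenly many
-- points of `[0, t]`, with values in `(k ⊗ k)^{⊗ n}` on the configurations of `2n` points
-- (`exists_fiberTwist_eq`). In this picture `U_{s,t}` is concatenation: the points of the second
-- factor, shifted by `s`, lie above those of the first. Both factors have evenly many points, so no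
-- pair `(x₁, x₂), (x₃, x₄), …` straddles `s`. Multiplication by `F(|x₁ - x₂|) ⊗ F(|x₃ - x₄|) ⊗ ⋯`
-- therefore respects products, since it acts pair by pair and sees only the gaps inside the pairs.
--
-- To construct these operators, each `F` is given an isometry `twist F` that sends a wedge product
-- to its `F`-twisted antisymmetrisation. Pointwise unitarity removes `F` from the inner products,
-- and the simplex integral is then a Gram determinant (`setIntegral_inner_antiVec`). The unitary of
-- `F` is `(fiberTwist 1 t)* ∘ fiberTwist F t`. It is multiplicative because its matrix coefficients
-- factorise on products of box vectors `1_{A₁} v₁ ∧ ⋯ ∧ 1_{A₂ₙ} v₂ₙ` with `A₁ > ⋯ > A₂ₙ`. Such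
-- vectors are total, even when only small boxes near almost every configuration are tested
-- (`eq_zero_of_inner_box`). Injectivity is read off from the vacuum, which gives `λ`, and from
-- two-particle box vectors, which give `F` almost everywhere.
--
-- For surjectivity let `θ` be an automorphism. The range of `U_{s,t}` spans the vectors supported
-- on configurations with evenly many points in `(-∞, s]` (`mem_closure_mulBoxes`), and `θ`
-- preserves this space. The parities for rational `s` determine a decreasing configuration, so by
-- the Lusin–Souslin theorem they generate all Borel sets up to null sets. Thus `θ` preserves every
-- support (`preserved_of_measurableSet`), commutes with indicator functions (`aut_restrict`) and
-- preserves inner products pointwise almost everywhere (`aut_inner_ae`).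
--
-- In particular `θ` preserves the particle number. Its eigenvalue on the vacuum is a measurable
-- character of `t`, hence `e^{iλt}`, and can be divided out. Once `θ` fixes the vacua,
-- multiplication by a vacuum on the right or on the left shows that the image of a constant
-- two-particle function is consistent in `t` and invariant under translation, so it depends only on
-- the gap (`exists_gapVal`). The images of a basis under `θ` and `θ⁻¹` assemble into a measurable
-- unitary-valued `F`. A configuration can be cut just below its two highest points, so agreement on
-- the vacuum and on two particles propagates to all particle numbers by induction
-- (`eq_fiberUnitary_succ`).

theorem continuous_of_continuous_inner {X E : Type*} [TopologicalSpace X] [SeminormedAddCommGroup E]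
    [InnerProductSpace ℂ E] {f : X → E}
    (h : Continuous fun p : X × X => (inner ℂ (f p.1) (f p.2) : ℂ)) : Continuous f := by
  rw [continuous_iff_continuousAt]
  intro x
  have h1 : Continuous fun y => ‖f y - f x‖ ^ 2 := by
    have e : ∀ y, ‖f y - f x‖ ^ 2 = RCLike.re (inner ℂ (f y) (f y) : ℂ)
        - 2 * RCLike.re (inner ℂ (f y) (f x) : ℂ) + RCLike.re (inner ℂ (f x) (f x) : ℂ) := fun y => by
      rw [norm_sub_sq (𝕜 := ℂ), inner_self_eq_norm_sq, inner_self_eq_norm_sq]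
    simp only [e]
    have a : Continuous fun y => (inner ℂ (f y) (f y) : ℂ) := h.comp (by fun_prop : Continuous fun y => (y, y))
    have b : Continuous fun y => (inner ℂ (f y) (f x) : ℂ) := h.comp (by fun_prop : Continuous fun y => (y, x))
    exact ((RCLike.continuous_re.comp a).sub (continuous_const.mul (RCLike.continuous_re.comp b))).add
      continuous_const
  have h2 : Continuous fun y => ‖f y - f x‖ := by
    simpa [Real.sqrt_sq (norm_nonneg _)] using h1.sqrt
  rw [ContinuousAt, tendsto_iff_norm_sub_tendsto_zero]
  simpa using h2.tendsto x

variable (k : Type*) [NormedAddCommGroup k] [InnerProductSpace ℂ k]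

/-- The Hilbert space that contains all the tensor powers of `k ⊗ k`. -/
abbrev TensorFock : Type _ := Fock (lp (fun _ : ℕ => TensorSquare k) 2)

variable {k}

scoped instance : NormedAddCommGroup (TensorSquare k) := inferInstance

scoped instance : SeminormedAddCommGroup (TensorSquare k) := inferInstance

scoped instance : AddCommGroup (TensorSquare k) := inferInstance

scoped instance : AddCommMonoid (TensorSquare k) := inferInstance

scoped instance : Module ℂ (TensorSquare k) := inferInstance

scoped instance : InnerProductSpace ℂ (TensorSquare k) := inferInstance

scoped instance : NormedAddCommGroup (TensorFock k) := inferInstance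

scoped instance : SeminormedAddCommGroup (TensorFock k) := inferInstance

scoped instance : AddCommGroup (TensorFock k) := inferInstance

scoped instance : AddCommMonoid (TensorFock k) := inferInstance

scoped instance : Module ℂ (TensorFock k) := inferInstance

scoped instance : InnerProductSpace ℂ (TensorFock k) := inferInstance

/-- The elementary tensor `κ₁ ⊗ ⋯ ⊗ κₙ`, realised as the wedge product of the `κⱼ` placed in
mutually orthogonal copies of `k ⊗ k`. -/
def tprod {n : ℕ} (κ : Fin n → TensorSquare k) : TensorFock k :=
  wedge fun j => lp.single 2 (j : ℕ) (κ j)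

/-- The factors sit in mutually orthogonal copies of `k ⊗ k`, so the Gram matrix is diagonal and its
determinant is a product. -/
theorem inner_tprod {n : ℕ} (κ κ' : Fin n → TensorSquare k) :
    inner ℂ (tprod κ) (tprod κ') = ∏ j, (inner ℂ (κ j) (κ' j) : ℂ) := by
  rw [tprod, tprod, inner_wedge]
  have : (Matrix.of fun i j : Fin n => (inner ℂ (lp.single (E := fun _ : ℕ => TensorSquare k) 2 (i : ℕ) (κ i))
      (lp.single (E := fun _ : ℕ => TensorSquare k) 2 (j : ℕ) (κ' j)) : ℂ))
      = Matrix.diagonal fun j => (inner ℂ (κ j) (κ' j) : ℂ) := by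
    ext i j
    rw [Matrix.of_apply, lp.inner_single_left]
    by_cases h : i = j
    · subst h
      rw [lp.single_apply_self, Matrix.diagonal_apply_eq]
    · rw [Matrix.diagonal_apply_ne _ h, lp.single_apply_ne, inner_zero_right]
      exact fun h' => h (Fin.ext h')
  rw [this, Matrix.det_diagonal]

theorem norm_tprod_sq {n : ℕ} (κ : Fin n → TensorSquare k) : ‖tprod κ‖ ^ 2 = ∏ j, ‖κ j‖ ^ 2 := by
  have h := inner_tprod κ κ
  simp only [inner_self_eq_norm_sq_to_K] at h
  exact_mod_cast h

theorem continuous_tprod {n : ℕ} : Continuous (tprod : (Fin n → TensorSquare k) → TensorFock k) := by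
  refine continuous_of_continuous_inner ?_
  simp only [inner_tprod]
  fun_prop

/-- Turns identities between inner products into identities between vectors. It is applied to the
defect of additivity or homogeneity of `tprod`, which lies in the span of the elementary tensors. -/
theorem eq_zero_of_inner_combination {E : Type*} [NormedAddCommGroup E] [InnerProductSpace ℂ E]
    {S : Set E} {x : E} (hx : x ∈ Submodule.span ℂ S) (h : ∀ y ∈ S, inner ℂ y x = 0) : x = 0 := by
  have h2 : Submodule.span ℂ S ≤ (Submodule.span ℂ {x})ᗮ := by
    rw [Submodule.span_le]
    intro y hy
    rw [SetLike.mem_coe, Submodule.mem_orthogonal_singleton_iff_inner_left]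
    exact h y hy
  have h3 := h2 hx
  rw [Submodule.mem_orthogonal_singleton_iff_inner_left] at h3
  exact inner_self_eq_zero.1 h3

theorem inner_tprod_update {n : ℕ} (κ κ' : Fin n → TensorSquare k) (i : Fin n) (a : TensorSquare k) :
    inner ℂ (tprod κ) (tprod (Function.update κ' i a)) =
      (inner ℂ (κ i) a : ℂ) * ∏ j ∈ Finset.univ.erase i, (inner ℂ (κ j) (κ' j) : ℂ) := by
  rw [inner_tprod, ← Finset.mul_prod_erase _ _ (Finset.mem_univ i), Function.update_self]
  congr 1
  refine Finset.prod_congr rfl fun j hj => ?_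
  rw [Function.update_of_ne (Finset.ne_of_mem_erase hj)]

/-- The elementary tensors as a multilinear map. -/
def tprodMultilinear (n : ℕ) : MultilinearMap ℂ (fun _ : Fin n => TensorSquare k) (TensorFock k) where
  toFun := tprod
  map_update_add' {inst} κ i a b := by
    obtain rfl := Subsingleton.elim inst (instDecidableEqFin n)
    rw [← sub_eq_zero]
    refine eq_zero_of_inner_combination (S := Set.range (tprod (k := k) (n := n))) ?_ ?_
    · exact Submodule.sub_mem _ (Submodule.subset_span ⟨_, rfl⟩)
        (Submodule.add_mem _ (Submodule.subset_span ⟨_, rfl⟩) (Submodule.subset_span ⟨_, rfl⟩))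
    · rintro _ ⟨κ', rfl⟩
      rw [inner_sub_right, inner_add_right]
      simp only [inner_tprod_update, inner_add_right]
      ring
  map_update_smul' {inst} κ i c a := by
    obtain rfl := Subsingleton.elim inst (instDecidableEqFin n)
    rw [← sub_eq_zero]
    refine eq_zero_of_inner_combination (S := Set.range (tprod (k := k) (n := n))) ?_ ?_
    · exact Submodule.sub_mem _ (Submodule.subset_span ⟨_, rfl⟩)
        (Submodule.smul_mem _ _ (Submodule.subset_span ⟨_, rfl⟩))
    · rintro _ ⟨κ', rfl⟩
      rw [inner_sub_right, inner_smul_right]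
      simp only [inner_tprod_update, inner_smul_right]
      ring

/-- The tensor power `(k ⊗ k)^{⊗ n}`. -/
def tprodSpace (k : Type*) [NormedAddCommGroup k] [InnerProductSpace ℂ k] (n : ℕ) :
    Submodule ℂ (TensorFock k) :=
  (Submodule.span ℂ (Set.range (tprod : (Fin n → TensorSquare k) → TensorFock k))).topologicalClosure

theorem tprod_mem {n : ℕ} (κ : Fin n → TensorSquare k) : tprod κ ∈ tprodSpace k n :=
  Submodule.le_topologicalClosure _ (Submodule.subset_span ⟨κ, rfl⟩)

/-- The tensor `v ⊗ w ∈ k ⊗ k`. -/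
def pairTmul (v w : k) : TensorSquare k := ((v ⊗ₜ[ℂ] w : k ⊗[ℂ] k) : TensorSquare k)

theorem continuous_pairTmul : Continuous fun p : k × k => pairTmul p.1 p.2 :=
  (UniformSpace.Completion.continuous_coe _).comp TensorProduct.continuous_tmul

theorem inner_pairTmul (v w v' w' : k) :
    inner ℂ (pairTmul v w) (pairTmul v' w') = (inner ℂ v v' : ℂ) * inner ℂ w w' := by
  rw [pairTmul, pairTmul, UniformSpace.Completion.inner_coe, TensorProduct.inner_tmul]

theorem norm_pairTmul (v w : k) : ‖pairTmul v w‖ = ‖v‖ * ‖w‖ := by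
  rw [pairTmul, UniformSpace.Completion.norm_coe, TensorProduct.norm_tmul]

/-- The elementary tensor `(v₀ ⊗ v₁) ⊗ (v₂ ⊗ v₃) ⊗ ⋯`. -/
def vtensor {n : ℕ} (v : Fin (2 * n) → k) : TensorFock k :=
  tprod fun j => pairTmul (v (fstIdx j)) (v (sndIdx j))

theorem continuous_vtensor {n : ℕ} : Continuous (vtensor : (Fin (2 * n) → k) → TensorFock k) := by
  refine continuous_tprod.comp (continuous_pi fun j => ?_)
  exact continuous_pairTmul.comp
    (by fun_prop : Continuous fun v : Fin (2 * n) → k => (v (fstIdx j), v (sndIdx j)))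

theorem exists_pairs {α : Type*} {n : ℕ} (a b : Fin n → α) :
    ∃ v : Fin (2 * n) → α, (∀ j, v (fstIdx j) = a j) ∧ ∀ j, v (sndIdx j) = b j := by
  refine ⟨fun i => if (i : ℕ) % 2 = 0 then a ⟨i / 2, by omega⟩ else b ⟨i / 2, by omega⟩,
    fun j => ?_, fun j => ?_⟩
  · simp [fstIdx]
  · have : (2 * (j : ℕ) + 1) / 2 = j := by omega
    simp [sndIdx, this, Nat.add_mod]

/-- The tensors `v ⊗ w` are total in `k ⊗ k`, and `tprod` is linear and continuous in each slot, so
the slots can be freed one at a time. -/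
theorem inner_tprod_eq_zero {n : ℕ} {h : TensorFock k}
    (hv : ∀ v : Fin (2 * n) → k, inner ℂ h (vtensor v) = 0) (κ : Fin n → TensorSquare k) :
    inner ℂ h (tprod κ) = 0 := by
  -- The induction is on the set `s` of slots that may hold an arbitrary element of `k ⊗ k`.
  have key : ∀ (s : Finset (Fin n)) (κ : Fin n → TensorSquare k),
      (∀ i, i ∉ s → ∃ v w, κ i = pairTmul v w) → inner ℂ h (tprod κ) = 0 := by
    intro s
    induction s using Finset.induction_on with
    | empty =>
      intro κ hκ
      choose a b hab using fun i => hκ i (Finset.notMem_empty i)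
      obtain ⟨v, h1, h2⟩ := exists_pairs a b
      rw [← hv v, vtensor]
      congr 2
      ext1 j
      rw [h1, h2, hab]
    | insert a s ha ih =>
      intro κ hκ
      have hc : Continuous fun z : TensorSquare k => (inner ℂ h (tprod (Function.update κ a z)) : ℂ) :=
        continuous_const.inner (continuous_tprod.comp (continuous_const.update a continuous_id))
      have hz : ∀ z : TensorSquare k, (inner ℂ h (tprod (Function.update κ a z)) : ℂ) = 0 := by
        intro z
        induction z using UniformSpace.Completion.induction_on with
        | hp => exact isClosed_eq hc continuous_const
        | ih z =>
          induction z using TensorProduct.induction_on with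
          | zero =>
            have := (tprodMultilinear (k := k) n).map_update_zero κ a
            change (inner ℂ h (tprodMultilinear (k := k) n (Function.update κ a _)) : ℂ) = 0
            rw [UniformSpace.Completion.coe_zero, this, inner_zero_right]
          | tmul v w =>
            refine ih _ fun i hi => ?_
            by_cases hia : i = a
            · subst hia
              exact ⟨v, w, by rw [Function.update_self]; rfl⟩
            · rw [Function.update_of_ne hia]
              exact hκ i (by simp [hia, hi])
          | add x y hx hy =>
            have := (tprodMultilinear (k := k) n).map_update_add κ a (x : TensorSquare k) y
            change (inner ℂ h (tprodMultilinear (k := k) n (Function.update κ a _)) : ℂ) = 0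
            rw [UniformSpace.Completion.coe_add, this, inner_add_right]
            change (inner ℂ h (tprod (Function.update κ a _)) : ℂ)
              + inner ℂ h (tprod (Function.update κ a _)) = 0
            rw [hx, hy, add_zero]
      have := hz (κ a)
      rwa [Function.update_eq_self] at this
  exact key Finset.univ κ fun i hi => absurd (Finset.mem_univ i) hi

/-- Only countably many test vectors occur, so the criterion can be applied pointwise after
discarding countably many null sets. -/
theorem eq_zero_of_mem_tprodSpace [TopologicalSpace.SeparableSpace k] {n : ℕ} {h : TensorFock k}
    (hh : h ∈ tprodSpace k n)
    (hv : ∀ d : Fin (2 * n) → ℕ,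
      inner ℂ (vtensor fun i => TopologicalSpace.denseSeq k (d i)) h = 0) : h = 0 := by
  have h1 : ∀ v : Fin (2 * n) → k, inner ℂ h (vtensor v) = 0 := by
    have hd : DenseRange fun (d : Fin (2 * n) → ℕ) (i : Fin (2 * n)) =>
        TopologicalSpace.denseSeq k (d i) :=
      DenseRange.piMap fun _ => TopologicalSpace.denseRange_denseSeq k
    have hc : Continuous fun v : Fin (2 * n) → k => (inner ℂ h (vtensor v) : ℂ) :=
      continuous_const.inner continuous_vtensor
    refine fun v => congrFun (hd.equalizer hc continuous_const ?_) v
    ext1 d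
    simpa [inner_eq_zero_symm] using hv d
  have h2 : tprodSpace k n ≤ (Submodule.span ℂ {h})ᗮ := by
    refine Submodule.topologicalClosure_minimal _ ?_ (Submodule.isClosed_orthogonal _)
    rw [Submodule.span_le]
    rintro _ ⟨κ, rfl⟩
    rw [SetLike.mem_coe, Submodule.mem_orthogonal_singleton_iff_inner_right]
    exact inner_tprod_eq_zero h1 κ
  have h3 := h2 hh
  rw [Submodule.mem_orthogonal_singleton_iff_inner_right] at h3
  exact inner_self_eq_zero.1 h3

theorem update_fin_one {α : Type*} (f : Fin 1 → α) (z : α) :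
    Function.update f 0 z = fun _ => z := by
  ext j
  rw [Fin.fin_one_eq_zero j, Function.update_self]

/-- The embedding of `k ⊗ k` as the first tensor power. -/
def tprodOne (k : Type*) [NormedAddCommGroup k] [InnerProductSpace ℂ k] :
    TensorSquare k →ₗᵢ[ℂ] TensorFock k :=
  LinearMap.isometryOfInner
    { toFun := fun κ => tprod fun _ : Fin 1 => κ
      map_add' := fun a b => by
        have := (tprodMultilinear (k := k) 1).map_update_add (fun _ => 0) 0 a b
        simp only [update_fin_one] at this
        exact this
      map_smul' := fun c a => by
        have := (tprodMultilinear (k := k) 1).map_update_smul (fun _ => 0) 0 c a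
        simp only [update_fin_one] at this
        exact this }
    fun a b => by
      refine (inner_tprod (fun _ : Fin 1 => a) fun _ : Fin 1 => b).trans ?_
      simp

theorem tprodOne_apply (κ : TensorSquare k) : tprodOne k κ = tprod fun _ : Fin 1 => κ := rfl

/-- With a single factor the elementary tensors already form a subspace, closed as the isometric
image of a complete space. -/
theorem range_tprodOne : LinearMap.range (tprodOne k).toLinearMap = tprodSpace k 1 := by
  have h1 : (LinearMap.range (tprodOne k).toLinearMap : Set (TensorFock k)) =
      Set.range (tprod : (Fin 1 → TensorSquare k) → TensorFock k) := by
    ext x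
    constructor
    · rintro ⟨κ, rfl⟩
      exact ⟨_, rfl⟩
    · rintro ⟨κ, rfl⟩
      refine ⟨κ 0, ?_⟩
      change tprod _ = _
      congr 1
      ext1 j
      rw [Fin.fin_one_eq_zero j]
  rw [tprodSpace, ← h1, Submodule.span_eq]
  refine (IsClosed.submodule_topologicalClosure_eq ?_).symm
  exact (tprodOne k).isometry.isClosedEmbedding.isClosed_range

end TensorPowers
end
end CliffordSystem

namespace CliffordSystem
noncomputable section

/-! ### The space of finite configurations -/

section Config

/-- Ordered configurations of an even number of points on the line. -/
abbrev Config : Type := Σ n : ℕ, (Fin (2 * n) → ℝ)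

/-- The inclusion of the configurations of `2n` points. -/
abbrev sector (n : ℕ) : (Fin (2 * n) → ℝ) → Config :=
  @Sigma.mk ℕ (fun n => Fin (2 * n) → ℝ) n

/-- The configurations `x₁ > x₂ > ⋯ > x₂ₙ`. -/
def simplex (n : ℕ) : Set (Fin (2 * n) → ℝ) := {x | StrictAnti x}

/-- Lebesgue measure on the decreasing configurations. -/
def configMeasure : Measure Config :=
  Measure.sum fun n => (volume.restrict (simplex n)).map (sector n)

theorem isOpen_strictAnti (N : ℕ) : IsOpen {x : Fin N → ℝ | StrictAnti x} := by
  have : {x : Fin N → ℝ | StrictAnti x} = ⋂ i : Fin N, ⋂ j : Fin N, {x | i < j → x j < x i} := by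
    ext x
    simp [StrictAnti]
  rw [this]
  refine isOpen_iInter_of_finite fun i => isOpen_iInter_of_finite fun j => ?_
  by_cases h : i < j
  · simpa [h] using isOpen_lt (continuous_apply j) (continuous_apply i)
  · simp [h]

theorem measurableSet_simplex (n : ℕ) : MeasurableSet (simplex n) :=
  (isOpen_strictAnti (2 * n)).measurableSet

theorem measurableSet_config {s : Set Config} :
    MeasurableSet s ↔ ∀ n, MeasurableSet (sector n ⁻¹' s) := by
  change MeasurableSet[⨅ n, _] s ↔ _
  rw [MeasurableSpace.measurableSet_iInf]
  rfl

theorem measurableEmbedding_mk (n : ℕ) :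
    MeasurableEmbedding (sector n) where
  injective := sigma_mk_injective
  measurable := fun _ hs => measurableSet_config.1 hs n
  measurableSet_image' := fun s hs => by
    refine measurableSet_config.2 fun m => ?_
    by_cases h : m = n
    · subst h
      rwa [Set.preimage_image_eq _ sigma_mk_injective]
    · rw [Set.preimage_image_sigmaMk_of_ne h]
      exact MeasurableSet.empty

theorem ae_config_iff {p : Config → Prop} :
    (∀ᵐ ω ∂configMeasure, p ω) ↔ ∀ n, ∀ᵐ x ∂(volume.restrict (simplex n)), p ⟨n, x⟩ := by
  rw [configMeasure, Measure.ae_sum_iff]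
  exact forall_congr' fun n => (measurableEmbedding_mk n).ae_map_iff

/-- A function on the configurations of `2n` points, extended by zero. -/
def onSector {E : Type*} [Zero E] (n : ℕ) (g : (Fin (2 * n) → ℝ) → E) : Config → E :=
  Function.extend (sector n) g 0

theorem onSector_same {E : Type*} [Zero E] (n : ℕ) (g : (Fin (2 * n) → ℝ) → E)
    (x : Fin (2 * n) → ℝ) : onSector n g ⟨n, x⟩ = g x :=
  sigma_mk_injective.extend_apply _ _ _

theorem onSector_ne {E : Type*} [Zero E] {n m : ℕ} (h : n ≠ m) (g : (Fin (2 * n) → ℝ) → E)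
    (x : Fin (2 * m) → ℝ) : onSector n g ⟨m, x⟩ = 0 := by
  rw [onSector, Function.extend_apply']
  · rfl
  · rintro ⟨y, hy⟩
    exact h (congrArg Sigma.fst hy)

theorem restrict_sector (n : ℕ) : configMeasure.restrict (Set.range (sector n)) =
    (volume.restrict (simplex n)).map (sector n) := by
  have hr : MeasurableSet (Set.range (sector n) : Set Config) :=
    (measurableEmbedding_mk n).measurableSet_range
  ext s hs
  rw [Measure.restrict_apply hs, configMeasure, Measure.sum_apply _ (hs.inter hr),
    tsum_eq_single n]
  · rw [(measurableEmbedding_mk n).map_apply, (measurableEmbedding_mk n).map_apply]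
    congr 1
    ext x
    simp
  · intro m hm
    rw [(measurableEmbedding_mk m).map_apply]
    have : (sector m ⁻¹' (s ∩ Set.range (sector n)) : Set (Fin (2 * m) → ℝ)) = ∅ := by
      ext x
      simp only [Set.mem_preimage, Set.mem_inter_iff, Set.mem_range, Set.mem_empty_iff_false,
        iff_false, not_and, not_exists]
      exact fun _ y hy => hm (congrArg Sigma.fst hy).symm
    rw [this, measure_empty]

theorem integral_sector {E : Type*} [NormedAddCommGroup E] [NormedSpace ℝ E] {n : ℕ} {f : Config → E}
    (hf : ∀ m, m ≠ n → ∀ x, f ⟨m, x⟩ = 0) :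
    ∫ ω, f ω ∂configMeasure = ∫ x in simplex n, f ⟨n, x⟩ := by
  rw [← (measurableEmbedding_mk n).integral_map, ← restrict_sector]
  refine (setIntegral_eq_integral_of_forall_compl_eq_zero ?_).symm
  rintro ⟨m, x⟩ h
  refine hf m ?_ x
  rintro rfl
  exact h ⟨x, rfl⟩

theorem memLp_onSector {E : Type*} [NormedAddCommGroup E] {n : ℕ} {g : (Fin (2 * n) → ℝ) → E}
    (hg : MemLp g 2 (volume.restrict (simplex n))) : MemLp (onSector n g) 2 configMeasure := by
  have h : onSector n g = (Set.range (sector n)).indicator (onSector n g) := by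
    refine (Set.indicator_eq_self.2 ?_).symm
    rintro ⟨m, x⟩ hx
    by_cases hm : n = m
    · subst hm
      exact ⟨x, rfl⟩
    · exact absurd (onSector_ne hm g x) hx
  rw [h, memLp_indicator_iff_restrict (measurableEmbedding_mk n).measurableSet_range,
    restrict_sector, (measurableEmbedding_mk n).memLp_map_measure_iff]
  have h2 : onSector n g ∘ sector n = g := funext fun x => onSector_same n g x
  rwa [h2]

-- Generic configurations and the chambers of the symmetric group.

theorem ae_sub_mem {N : ℕ} {i j : Fin N} (hij : i ≠ j) {s : Set ℝ} (hs : MeasurableSet s)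
    (h : ∀ᵐ r : ℝ, r ∈ s) : ∀ᵐ x : Fin N → ℝ, x i - x j ∈ s := by
  let L : (Fin N → ℝ) →ₗ[ℝ] ℝ :=
    LinearMap.proj (R := ℝ) (φ := fun _ : Fin N => ℝ) i - LinearMap.proj (R := ℝ) (φ := fun _ : Fin N => ℝ) j
  have hL : Function.Surjective L := fun r => ⟨Pi.single i r, by simp [L, hij.symm]⟩
  exact (ae_comp_linearMap_mem_iff L volume volume hL hs).2 h

theorem ae_injective (N : ℕ) : ∀ᵐ x : Fin N → ℝ, Function.Injective x := by
  have h : ∀ i j : Fin N, i ≠ j → ∀ᵐ x : Fin N → ℝ, x i ≠ x j := by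
    intro i j hij
    have h0 : ∀ᵐ r : ℝ, r ∈ ({0}ᶜ : Set ℝ) := by simp [ae_iff]
    filter_upwards [ae_sub_mem hij (measurableSet_singleton 0).compl h0] with x hx hx'
    exact hx (by simp [hx'])
  have h' : ∀ᵐ x : Fin N → ℝ, ∀ i j : Fin N, i ≠ j → x i ≠ x j := by
    simp only [ae_all_iff]
    exact h
  filter_upwards [h'] with x hx i j hij
  by_contra hne
  exact hx i j hne hij

theorem exists_perm_strictAnti {N : ℕ} {x : Fin N → ℝ} (hx : Function.Injective x) :
    ∃ π : Equiv.Perm (Fin N), StrictAnti (x ∘ π) := by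
  refine ⟨Tuple.sort (-x), ?_⟩
  have h := (Tuple.monotone_sort (-x)).strictMono_of_injective
    ((neg_injective.comp hx).comp (Equiv.injective _))
  intro i j hij
  have := h hij
  simpa using this

theorem eq_of_strictAnti_comp {N : ℕ} {x : Fin N → ℝ} {π ρ : Equiv.Perm (Fin N)}
    (h1 : StrictAnti (x ∘ π)) (h2 : StrictAnti (x ∘ ρ)) : π = ρ := by
  -- The permutation `π⁻¹ρ` compares two decreasing enumerations, so it preserves the order and must
  -- be the identity.
  have h3 : StrictMono (π⁻¹ * ρ : Equiv.Perm (Fin N)) := by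
    intro i j hij
    rw [← h1.lt_iff_gt]
    have := h2 hij
    simpa using this
  have h4 : (π⁻¹ * ρ : Equiv.Perm (Fin N)) = 1 := by
    ext1 i
    have h5 := StrictMono.range_inj (f := (π⁻¹ * ρ : Equiv.Perm (Fin N))) (g := id) h3 strictMono_id
    have h6 := h5.1 (by rw [(Equiv.surjective _).range_eq, Set.range_id])
    exact congrFun h6 i
  exact (inv_mul_eq_one.1 h4)

theorem piCongrLeft_symm_eq {N : ℕ} (π : Equiv.Perm (Fin N)) :
    ⇑(MeasurableEquiv.piCongrLeft (fun _ : Fin N => ℝ) π.symm) = fun x => x ∘ π := by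
  ext x i
  have := Equiv.piCongrLeft_apply_apply (fun _ : Fin N => ℝ) π.symm x (π i)
  simp only [Equiv.symm_apply_apply] at this
  exact this

theorem measurePreserving_comp_perm {N : ℕ} (π : Equiv.Perm (Fin N)) :
    MeasurePreserving (fun x : Fin N → ℝ => x ∘ π) volume volume := by
  have h := volume_measurePreserving_piCongrLeft (fun _ : Fin N => ℝ) π.symm
  convert h using 1
  exact (piCongrLeft_symm_eq π).symm

/-- Up to the null set of points with coinciding coordinates, the space is the disjoint union of the
`N!` images of the simplex under permutations of coordinates. These preserve the measure and the
integrand. -/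
theorem integral_eq_factorial_mul {N : ℕ} {h : (Fin N → ℝ) → ℂ} (hi : Integrable h)
    (hs : ∀ (π : Equiv.Perm (Fin N)) x, h (x ∘ π) = h x) :
    ∫ x, h x = (N.factorial : ℂ) * ∫ x in {x | StrictAnti x}, h x := by
  let S : Equiv.Perm (Fin N) → Set (Fin N → ℝ) := fun π => {x | StrictAnti (x ∘ π)}
  have hS : ∀ π, S π = (fun x => x ∘ π) ⁻¹' {x | StrictAnti x} := fun π => rfl
  have hm : ∀ π, MeasurableSet (S π) := fun π =>
    (measurePreserving_comp_perm π).measurable (isOpen_strictAnti N).measurableSet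
  have hd : Pairwise (Function.onFun Disjoint S) := fun π ρ hne =>
    Set.disjoint_left.2 fun x h1 h2 => hne (eq_of_strictAnti_comp h1 h2)
  have hu : (⋃ π, S π) =ᵐ[volume] Set.univ := by
    rw [Filter.eventuallyEq_univ]
    filter_upwards [ae_injective N] with x hx
    obtain ⟨π, hπ⟩ := exists_perm_strictAnti hx
    exact Set.mem_iUnion.2 ⟨π, hπ⟩
  have he : ∀ π, ∫ x in S π, h x = ∫ x in {x | StrictAnti x}, h x := by
    intro π
    have hemb : MeasurableEmbedding (fun x : Fin N → ℝ => x ∘ π) := by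
      rw [← piCongrLeft_symm_eq]
      exact MeasurableEquiv.measurableEmbedding _
    rw [hS, ← (measurePreserving_comp_perm π).setIntegral_preimage_emb hemb h {x | StrictAnti x}]
    simp only [hs]
  calc ∫ x, h x = ∫ x in ⋃ π, S π, h x := by
        rw [setIntegral_congr_set hu, setIntegral_univ]
    _ = ∑ π, ∫ x in S π, h x := integral_iUnion_fintype hm hd fun π => hi.integrableOn
    _ = _ := by simp [he, Fintype.card_perm]

end Config
end
end CliffordSystem

namespace CliffordSystem
noncomputable section

/-! ### Antisymmetric functions twisted by a unitary-valued function -/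

section Anti
variable {k : Type*} [NormedAddCommGroup k] [InnerProductSpace ℂ k]

/-- The `2n` positions as `n` pairs. -/
def pairEquiv (n : ℕ) : Fin n × Fin 2 ≃ Fin (2 * n) :=
  finProdFinEquiv.trans (finCongr (mul_comm n 2))

theorem pairEquiv_zero {n : ℕ} (j : Fin n) : pairEquiv n (j, 0) = fstIdx j := by
  ext
  simp [pairEquiv, fstIdx]

theorem pairEquiv_one {n : ℕ} (j : Fin n) : pairEquiv n (j, 1) = sndIdx j := by
  ext
  simp [pairEquiv, sndIdx, add_comm]

theorem prod_pairs {M : Type*} [CommMonoid M] {n : ℕ} (g : Fin (2 * n) → M) :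
    ∏ j : Fin n, g (fstIdx j) * g (sndIdx j) = ∏ i, g i := by
  rw [← (pairEquiv n).prod_comp g, Fintype.prod_prod_type]
  refine Finset.prod_congr rfl fun j _ => ?_
  rw [Fin.prod_univ_two, pairEquiv_zero, pairEquiv_one]

theorem fstIdx_ne_sndIdx {n : ℕ} (j : Fin n) : fstIdx j ≠ sndIdx j := fun h => by
  have := congrArg Fin.val h
  simp [fstIdx, sndIdx] at this

theorem fstIdx_lt_sndIdx {n : ℕ} (j : Fin n) : fstIdx j < sndIdx j := by
  simp [fstIdx, sndIdx, Fin.lt_def]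

/-- `F(|x₁ - x₂|) (f₁(x₁) ⊗ f₂(x₂)) ⊗ F(|x₃ - x₄|) (f₃(x₃) ⊗ f₄(x₄)) ⊗ ⋯`. -/
def pairVec (F : ℝ≥0 → TensorSquare k ≃ₗᵢ[ℂ] TensorSquare k) {n : ℕ} (f : Fin (2 * n) → ℝ → k)
    (x : Fin (2 * n) → ℝ) : TensorFock k :=
  tprod fun j => F (Real.nnabs (x (fstIdx j) - x (sndIdx j))) (pairTensor f x j)

/-- The antisymmetrisation of `pairVec`. -/
def antiVec (F : ℝ≥0 → TensorSquare k ≃ₗᵢ[ℂ] TensorSquare k) {n : ℕ} (f : Fin (2 * n) → ℝ → k)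
    (x : Fin (2 * n) → ℝ) : TensorFock k :=
  ∑ τ : Equiv.Perm (Fin (2 * n)), ((Equiv.Perm.sign τ : ℤ) : ℂ) • pairVec F (f ∘ τ) x

theorem inner_antiVec (F G : ℝ≥0 → TensorSquare k ≃ₗᵢ[ℂ] TensorSquare k) {n : ℕ}
    (g f : Fin (2 * n) → ℝ → k) (x : Fin (2 * n) → ℝ) :
    inner ℂ (antiVec F g x) (antiVec G f x) =
      ∑ σ : Equiv.Perm (Fin (2 * n)), ∑ τ : Equiv.Perm (Fin (2 * n)),
        ((Equiv.Perm.sign σ : ℤ) : ℂ) * ((Equiv.Perm.sign τ : ℤ) : ℂ) *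
        ∏ j : Fin n, (inner ℂ (F (Real.nnabs (x (fstIdx j) - x (sndIdx j))) (pairTensor (g ∘ σ) x j))
          (G (Real.nnabs (x (fstIdx j) - x (sndIdx j))) (pairTensor (f ∘ τ) x j)) : ℂ) := by
  rw [antiVec, antiVec, sum_inner]
  refine Finset.sum_congr rfl fun σ _ => ?_
  rw [inner_sum]
  refine Finset.sum_congr rfl fun τ _ => ?_
  rw [inner_smul_left, inner_smul_right, pairVec, pairVec, inner_tprod, map_intCast, mul_assoc]

/-- `H` acts as a unitary in each tensor slot and commutes with the antisymmetrisation. This is the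
source of the composition law for the operators. -/
theorem inner_antiVec_comp (F G H : ℝ≥0 → TensorSquare k ≃ₗᵢ[ℂ] TensorSquare k) {n : ℕ}
    (g f : Fin (2 * n) → ℝ → k) (x : Fin (2 * n) → ℝ) :
    (inner ℂ (antiVec (H * F) g x) (antiVec (H * G) f x) : ℂ) =
      inner ℂ (antiVec F g x) (antiVec G f x) := by
  rw [inner_antiVec, inner_antiVec]
  refine Finset.sum_congr rfl fun σ _ => Finset.sum_congr rfl fun τ _ => ?_
  congr 1
  refine Finset.prod_congr rfl fun j _ => ?_
  exact LinearIsometryEquiv.inner_map_map (H _) _ _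

theorem pairTensor_eq {n : ℕ} (f : Fin (2 * n) → ℝ → k) (x : Fin (2 * n) → ℝ) (j : Fin n) :
    pairTensor f x j = pairTmul (f (fstIdx j) (x (fstIdx j))) (f (sndIdx j) (x (sndIdx j))) := rfl

theorem inner_antiVec_same (F : ℝ≥0 → TensorSquare k ≃ₗᵢ[ℂ] TensorSquare k) {n : ℕ}
    (g f : Fin (2 * n) → ℝ → k) (x : Fin (2 * n) → ℝ) :
    inner ℂ (antiVec F g x) (antiVec F f x) =
      ∑ σ : Equiv.Perm (Fin (2 * n)), ∑ τ : Equiv.Perm (Fin (2 * n)),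
        ((Equiv.Perm.sign σ : ℤ) : ℂ) * ((Equiv.Perm.sign τ : ℤ) : ℂ) *
        ∏ i, (inner ℂ (g (σ i) (x i)) (f (τ i) (x i)) : ℂ) := by
  rw [inner_antiVec]
  refine Finset.sum_congr rfl fun σ _ => Finset.sum_congr rfl fun τ _ => ?_
  congr 1
  rw [← prod_pairs]
  refine Finset.prod_congr rfl fun j _ => ?_
  rw [LinearIsometryEquiv.inner_map_map, pairTensor_eq, pairTensor_eq, inner_pairTmul]
  rfl

theorem norm_pairVec_sq (F : ℝ≥0 → TensorSquare k ≃ₗᵢ[ℂ] TensorSquare k) {n : ℕ}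
    (f : Fin (2 * n) → ℝ → k) (x : Fin (2 * n) → ℝ) :
    ‖pairVec F f x‖ ^ 2 = ∏ i, ‖f i (x i)‖ ^ 2 := by
  rw [pairVec, norm_tprod_sq, ← prod_pairs]
  refine Finset.prod_congr rfl fun j _ => ?_
  rw [LinearIsometryEquiv.norm_map, pairTensor_eq, norm_pairTmul, mul_pow]

/-- After `F` cancels, the integrand is a symmetric function, so the simplex carries `1/(2n)!` of
its full integral. Fubini and `sum_sign_prod_eq_det` turn the full integral into `(2n)!` times the
determinant. -/
theorem setIntegral_inner_antiVec (F : ℝ≥0 → TensorSquare k ≃ₗᵢ[ℂ] TensorSquare k) {n : ℕ}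
    (g f : Fin (2 * n) → L2Line k) :
    ∫ x in simplex n, (inner ℂ (antiVec F (fun i => g i) x) (antiVec F (fun i => f i) x) : ℂ) =
      Matrix.det (Matrix.of fun i j => inner ℂ (g i) (f j)) := by
  have hi1 : ∀ σ τ : Equiv.Perm (Fin (2 * n)), Integrable fun x : Fin (2 * n) → ℝ =>
      ((Equiv.Perm.sign σ : ℤ) : ℂ) * ((Equiv.Perm.sign τ : ℤ) : ℂ) *
        ∏ i, (inner ℂ (g (σ i) (x i)) (f (τ i) (x i)) : ℂ) := fun σ τ =>
    Integrable.const_mul (Integrable.fintype_prod (f := fun i y => (inner ℂ (g (σ i) y) (f (τ i) y) : ℂ))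
      fun i => L2.integrable_inner (g (σ i)) (f (τ i))) _
  have hfac : ((2 * n).factorial : ℂ) ≠ 0 := by exact_mod_cast (2 * n).factorial_ne_zero
  refine mul_left_cancel₀ hfac ?_
  simp only [inner_antiVec_same]
  have h := integral_eq_factorial_mul (N := 2 * n)
    (h := fun x => ∑ σ : Equiv.Perm (Fin (2 * n)), ∑ τ : Equiv.Perm (Fin (2 * n)),
        ((Equiv.Perm.sign σ : ℤ) : ℂ) * ((Equiv.Perm.sign τ : ℤ) : ℂ) *
        ∏ i, (inner ℂ (g (σ i) (x i)) (f (τ i) (x i)) : ℂ))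
    (integrable_finsetSum _ fun σ _ => integrable_finsetSum _ fun τ _ => hi1 σ τ) ?_
  · refine h.symm.trans ?_
    rw [integral_finsetSum _ fun σ _ => integrable_finsetSum _ fun τ _ => hi1 σ τ,
      ← sum_sign_prod_eq_det]
    refine Finset.sum_congr rfl fun σ _ => ?_
    rw [integral_finsetSum _ fun τ _ => hi1 σ τ]
    refine Finset.sum_congr rfl fun τ _ => ?_
    rw [integral_const_mul,
      integral_fintype_prod_volume_eq_prod (fun i y => (inner ℂ (g (σ i) y) (f (τ i) y) : ℂ))]
    rfl
  · intro π x
    refine Fintype.sum_equiv (Equiv.mulRight π⁻¹) _ _ fun σ => ?_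
    refine Fintype.sum_equiv (Equiv.mulRight π⁻¹) _ _ fun τ => ?_
    have h2 : ∏ i, (inner ℂ (g (σ i) ((x ∘ π) i)) (f (τ i) ((x ∘ π) i)) : ℂ)
        = ∏ i, (inner ℂ (g ((σ * π⁻¹) i) (x i)) (f ((τ * π⁻¹) i) (x i)) : ℂ) := by
      rw [← Equiv.prod_comp π (fun i => (inner ℂ (g ((σ * π⁻¹) i) (x i)) (f ((τ * π⁻¹) i) (x i)) : ℂ))]
      simp
    rw [h2]
    simp only [Equiv.coe_mulRight, Equiv.Perm.sign_mul, Equiv.Perm.sign_inv]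
    -- Permuting the variables by `π` replaces `σ, τ` by `σπ⁻¹, τπ⁻¹`; the two factors `sgn π`
    -- cancel.
    have h3 : ((Equiv.Perm.sign π : ℤ) : ℂ) * ((Equiv.Perm.sign π : ℤ) : ℂ) = 1 := by
      rcases Int.units_eq_one_or (Equiv.Perm.sign π) with h | h <;> simp [h]
    simp only [Units.val_mul, Int.cast_mul]
    linear_combination (-(((Equiv.Perm.sign σ : ℤ) : ℂ) * ((Equiv.Perm.sign τ : ℤ) : ℂ) *
      ∏ i, (inner ℂ (g ((σ * π⁻¹) i) (x i)) (f ((τ * π⁻¹) i) (x i)) : ℂ))) * h3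

-- Measurability and square integrability of the twisted functions.

variable [TopologicalSpace.SeparableSpace k]

/-- Weak measurability implies measurability in the separable case: the basis expansion is a
pointwise limit of measurable finite sums. -/
theorem measurable_of_inner {X E : Type*} [MeasurableSpace X] [NormedAddCommGroup E]
    [InnerProductSpace ℂ E] [CompleteSpace E] [TopologicalSpace.SeparableSpace E]
    [MeasurableSpace E] [BorelSpace E] {f : X → E}
    (h : ∀ v, Measurable fun x => (inner ℂ v (f x) : ℂ)) : Measurable f := by
  obtain ⟨e, b, -⟩ := exists_hilbertBasis ℂ E
  have hc : Countable e := countable_of_orthonormal b.orthonormal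
  have : SecondCountableTopology E := UniformSpace.secondCountable_of_separable E
  refine measurable_of_tendsto_metrizable' (Filter.atTop : Filter (Finset e))
    (f := fun s x => ∑ i ∈ s, (inner ℂ (b i) (f x) : ℂ) • b i)
    (fun s => ?_) (tendsto_pi_nhds.2 fun x => ?_)
  · exact Finset.measurable_sum _ fun i _ => (h (b i)).smul_const _
  · have := b.hasSum_repr (f x)
    simp only [b.repr_apply_apply] at this
    exact this

/-- A function `(v, r) ↦ F(r) v` that is continuous in `v` and measurable in `r` is jointly
measurable. -/
theorem stronglyMeasurable_unitary_apply (F : MeasurableUnitaries k) {X : Type*} [MeasurableSpace X]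
    {r : X → ℝ≥0} (hr : Measurable r) {κ : X → TensorSquare k} (hκ : StronglyMeasurable κ) :
    StronglyMeasurable fun x => F.1 (r x) (κ x) := by
  borelize (TensorSquare k)
  have : SecondCountableTopology (TensorSquare k) :=
    UniformSpace.secondCountable_of_separable (TensorSquare k)
  have h := stronglyMeasurable_uncurry_of_continuous_of_stronglyMeasurable
    (u := fun (v : TensorSquare k) (r : ℝ≥0) => F.1 r v) (fun r => (F.1 r).continuous)
    (fun v => (measurable_of_inner fun w => F.2 w v).stronglyMeasurable)
  exact h.comp_measurable (hκ.measurable.prodMk hr)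

theorem aestronglyMeasurable_unitary_apply (F : MeasurableUnitaries k) {X : Type*}
    [MeasurableSpace X] {μ : Measure X}
    {r : X → ℝ≥0} (hr : Measurable r) {κ : X → TensorSquare k} (hκ : AEStronglyMeasurable κ μ) :
    AEStronglyMeasurable (fun x => F.1 (r x) (κ x)) μ :=
  ⟨_, stronglyMeasurable_unitary_apply F hr hκ.stronglyMeasurable_mk, by
    filter_upwards [hκ.ae_eq_mk] with x hx
    rw [hx]⟩

theorem aestronglyMeasurable_pi_of {ι X E : Type*} [Fintype ι] [MeasurableSpace X] {μ : Measure X}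
    [NormedAddCommGroup E] [TopologicalSpace.SeparableSpace E] {f : X → ι → E}
    (h : ∀ i, AEStronglyMeasurable (fun x => f x i) μ) : AEStronglyMeasurable f μ := by
  borelize E
  have : SecondCountableTopology E := UniformSpace.secondCountable_of_separable E
  exact (aemeasurable_pi_iff.2 fun i => (h i).aemeasurable).aestronglyMeasurable

theorem measurable_nnabs : Measurable Real.nnabs := by
  have : Continuous Real.nnabs := by
    refine continuous_induced_rng.2 ?_
    exact continuous_abs
  exact this.measurable

theorem aestronglyMeasurable_pairVec (F : MeasurableUnitaries k) {n : ℕ}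
    {f : Fin (2 * n) → ℝ → k} (hf : ∀ i, AEStronglyMeasurable (f i) volume) :
    AEStronglyMeasurable (pairVec F.1 f) volume := by
  refine continuous_tprod.comp_aestronglyMeasurable (aestronglyMeasurable_pi_of fun j => ?_)
  refine aestronglyMeasurable_unitary_apply F ?_ ?_
  · exact measurable_nnabs.comp ((measurable_pi_apply _).sub (measurable_pi_apply _))
  · have h : ∀ i, AEStronglyMeasurable (fun x : Fin (2 * n) → ℝ => f i (x i)) volume := fun i =>
      (hf i).comp_quasiMeasurePreserving (Measure.quasiMeasurePreserving_eval _ i)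
    have h2 : AEStronglyMeasurable (fun x : Fin (2 * n) → ℝ => (fun p : k × k => pairTmul p.1 p.2)
        (f (fstIdx j) (x (fstIdx j)), f (sndIdx j) (x (sndIdx j)))) volume :=
      continuous_pairTmul.comp_aestronglyMeasurable ((h (fstIdx j)).prodMk (h (sndIdx j)))
    exact h2

theorem memLp_pairVec (F : MeasurableUnitaries k) {n : ℕ} {f : Fin (2 * n) → ℝ → k}
    (hf : ∀ i, MemLp (f i) 2 volume) : MemLp (pairVec F.1 f) 2 volume := by
  rw [memLp_two_iff_integrable_sq_norm (aestronglyMeasurable_pairVec F fun i => (hf i).1)]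
  simp only [norm_pairVec_sq]
  exact Integrable.fintype_prod (f := fun i y => ‖f i y‖ ^ 2) fun i =>
    (memLp_two_iff_integrable_sq_norm (hf i).1).1 (hf i)

theorem memLp_antiVec (F : MeasurableUnitaries k) {n : ℕ} {f : Fin (2 * n) → ℝ → k}
    (hf : ∀ i, MemLp (f i) 2 volume) : MemLp (antiVec F.1 f) 2 volume := by
  exact memLp_finsetSum _ fun τ _ =>
    (memLp_pairVec F (f := f ∘ τ) fun i => hf (τ i)).const_smul ((Equiv.Perm.sign τ : ℤ) : ℂ)

end Anti
end
end CliffordSystem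

namespace CliffordSystem
noncomputable section

/-! ### The twisted embeddings of the even Fock space -/

section Embedding

/-- Two families with the same Gram matrix give the same seminorm on formal combinations, so one
maps isometrically to the other. Formal combinations `e` have dense range in `S`, and `fL` is
extended along `e`. -/
theorem exists_linearIsometry_of_inner_eq {X E L : Type*} [NormedAddCommGroup E]
    [InnerProductSpace ℂ E] [NormedAddCommGroup L] [InnerProductSpace ℂ L] [CompleteSpace L]
    (u : X → E) (f : X → L) (h : ∀ i j, (inner ℂ (f i) (f j) : ℂ) = inner ℂ (u i) (u j))
    (S : Submodule ℂ E) (hS : S = (Submodule.span ℂ (Set.range u)).topologicalClosure) :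
    ∃ I : S →ₗᵢ[ℂ] L, ∀ i (hi : u i ∈ S), I ⟨u i, hi⟩ = f i := by
  have hmem : ∀ c, Finsupp.linearCombination ℂ u c ∈ S := fun c => by
    rw [hS]
    refine Submodule.le_topologicalClosure _ ?_
    rw [← Finsupp.range_linearCombination]
    exact ⟨c, rfl⟩
  let e : (X →₀ ℂ) →ₗ[ℂ] S := (Finsupp.linearCombination ℂ u).codRestrict S hmem
  let fL : (X →₀ ℂ) →ₗ[ℂ] L := Finsupp.linearCombination ℂ f
  have hd : DenseRange e := by
    intro x
    rw [Topology.IsInducing.subtypeVal.closure_eq_preimage_closure_image]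
    have h1 : (Subtype.val '' Set.range e : Set E) = (Submodule.span ℂ (Set.range u) : Set E) := by
      rw [← Finsupp.range_linearCombination, ← Set.range_comp]
      rfl
    have h2 : (x : E) ∈ closure (Subtype.val '' Set.range e) := by
      rw [h1, ← Submodule.topologicalClosure_coe, ← hS]
      exact x.2
    exact h2
  have hin : ∀ c c', (inner ℂ (fL c) (fL c') : ℂ) = inner ℂ (e c) (e c') := by
    intro c c'
    change (inner ℂ (Finsupp.linearCombination ℂ f c) (Finsupp.linearCombination ℂ f c') : ℂ) =
      inner ℂ (Finsupp.linearCombination ℂ u c) (Finsupp.linearCombination ℂ u c')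
    simp only [Finsupp.linearCombination_apply, Finsupp.sum_inner, Finsupp.inner_sum,
      inner_smul_left, inner_smul_right, h]
  have hn : ∀ c, ‖fL c‖ = ‖e c‖ := fun c => by
    rw [@norm_eq_sqrt_re_inner ℂ, @norm_eq_sqrt_re_inner ℂ, hin]
  have hex : ∃ C, ∀ c, ‖fL c‖ ≤ C * ‖e c‖ := ⟨1, fun c => by rw [hn, one_mul]⟩
  refine ⟨⟨(fL.extendOfNorm e).toLinearMap, fun x => ?_⟩, fun i hi => ?_⟩
  · refine hd.induction_on (p := fun x => ‖fL.extendOfNorm e x‖ = ‖x‖) x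
      (isClosed_eq (by fun_prop) (by fun_prop)) fun c => ?_
    rw [LinearMap.extendOfNorm_eq hd hex, hn]
  · have h1 : e (Finsupp.single i 1) = ⟨u i, hi⟩ := Subtype.ext (by simp [e])
    change fL.extendOfNorm e ⟨u i, hi⟩ = f i
    rw [← h1, LinearMap.extendOfNorm_eq hd hex]
    simp [fL]

variable (k : Type*) [NormedAddCommGroup k] [InnerProductSpace ℂ k]

/-- The square integrable functions on the configurations. -/
abbrev ConfigL2 : Type _ := Lp (TensorFock k) 2 configMeasure

variable {k}

scoped instance : NormedAddCommGroup (ConfigL2 k) := inferInstance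

scoped instance : SeminormedAddCommGroup (ConfigL2 k) := inferInstance

scoped instance : AddCommGroup (ConfigL2 k) := inferInstance

scoped instance : AddCommMonoid (ConfigL2 k) := inferInstance

scoped instance : Module ℂ (ConfigL2 k) := inferInstance

scoped instance : InnerProductSpace ℂ (ConfigL2 k) := inferInstance

scoped instance {t : Time} : NormedAddCommGroup (Fiber k t) := inferInstance

scoped instance {t : Time} : SeminormedAddCommGroup (Fiber k t) := inferInstance

scoped instance {t : Time} : AddCommGroup (Fiber k t) := inferInstance

scoped instance {t : Time} : AddCommMonoid (Fiber k t) := inferInstance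

scoped instance {t : Time} : Module ℂ (Fiber k t) := inferInstance

scoped instance {t : Time} : InnerProductSpace ℂ (Fiber k t) := inferInstance

scoped instance : NormedAddCommGroup (evenFock (L2Line k)) := inferInstance

scoped instance : SeminormedAddCommGroup (evenFock (L2Line k)) := inferInstance

scoped instance : AddCommGroup (evenFock (L2Line k)) := inferInstance

scoped instance : AddCommMonoid (evenFock (L2Line k)) := inferInstance

scoped instance : Module ℂ (evenFock (L2Line k)) := inferInstance

scoped instance : InnerProductSpace ℂ (evenFock (L2Line k)) := inferInstance

variable [TopologicalSpace.SeparableSpace k]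

/-- The twisted antisymmetric function of `ξ₁, …, ξ₂ₙ`, as an element of `L²`. -/
def genVec (F : MeasurableUnitaries k) {n : ℕ} (ξ : Fin (2 * n) → L2Line k) : ConfigL2 k :=
  (memLp_onSector (n := n) (g := antiVec F.1 fun i => ξ i)
    ((memLp_antiVec F fun i => Lp.memLp (ξ i)).restrict _)).toLp

theorem genVec_ae (F : MeasurableUnitaries k) {n : ℕ} (ξ : Fin (2 * n) → L2Line k) :
    ∀ᵐ ω ∂configMeasure, genVec F ξ ω = onSector n (antiVec F.1 fun i => ξ i) ω :=
  MemLp.coeFn_toLp _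

theorem inner_genVec (F G : MeasurableUnitaries k) {n : ℕ} (η ξ : Fin (2 * n) → L2Line k) :
    (inner ℂ (genVec F η) (genVec G ξ) : ℂ) = ∫ x in simplex n,
      (inner ℂ (antiVec F.1 (fun i => η i) x) (antiVec G.1 (fun i => ξ i) x) : ℂ) := by
  rw [L2.inner_def]
  have h : ∀ᵐ ω ∂configMeasure, (inner ℂ (genVec F η ω) (genVec G ξ ω) : ℂ) =
      inner ℂ (onSector n (antiVec F.1 fun i => η i) ω) (onSector n (antiVec G.1 fun i => ξ i) ω) := by
    filter_upwards [genVec_ae F η, genVec_ae G ξ] with ω h1 h2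
    rw [h1, h2]
  rw [integral_congr_ae h, integral_sector (n := n)]
  · simp only [onSector_same]
  · intro m hm x
    rw [onSector_ne hm.symm, inner_zero_left]

theorem inner_genVec_of_ne (F G : MeasurableUnitaries k) {n m : ℕ} (hnm : n ≠ m)
    (η : Fin (2 * n) → L2Line k) (ξ : Fin (2 * m) → L2Line k) :
    (inner ℂ (genVec F η) (genVec G ξ) : ℂ) = 0 := by
  rw [L2.inner_def]
  refine integral_eq_zero_of_ae ?_
  filter_upwards [genVec_ae F η, genVec_ae G ξ] with ω h1 h2
  rw [h1, h2]
  obtain ⟨l, x⟩ := ω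
  by_cases hl : n = l
  · subst hl
    rw [onSector_ne hnm.symm, inner_zero_right, Pi.zero_apply]
  · rw [onSector_ne hl, inner_zero_left, Pi.zero_apply]

theorem evenFock_eq (V : Type*) [NormedAddCommGroup V] [InnerProductSpace ℂ V] :
    evenFock V = (Submodule.span ℂ (Set.range fun a : Σ n : ℕ, Fin (2 * n) → V =>
      (wedge a.2 : Fock V))).topologicalClosure := by
  rw [evenFock]
  congr 2
  ext x
  constructor
  · rintro ⟨n, v, rfl⟩
    exact ⟨⟨n, v⟩, rfl⟩
  · rintro ⟨⟨n, v⟩, rfl⟩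
    exact ⟨n, v, rfl⟩

/-- By `setIntegral_inner_antiVec`, and by disjointness of different particle numbers, the twisted
antisymmetrisations have the same Gram matrix as the wedge products. -/
theorem exists_twist (F : MeasurableUnitaries k) : ∃ I : evenFock (L2Line k) →ₗᵢ[ℂ] ConfigL2 k,
    ∀ (a : Σ n : ℕ, Fin (2 * n) → L2Line k) (ha : wedge a.2 ∈ evenFock (L2Line k)),
      I ⟨wedge a.2, ha⟩ = genVec F a.2 := by
  refine exists_linearIsometry_of_inner_eq (fun a : Σ n : ℕ, Fin (2 * n) → L2Line k => wedge a.2)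
    (fun a => genVec F a.2) ?_ _ (evenFock_eq _)
  rintro ⟨n, v⟩ ⟨m, w⟩
  by_cases h : n = m
  · subst h
    dsimp only
    rw [inner_genVec, setIntegral_inner_antiVec, inner_wedge]
  · dsimp only
    rw [inner_genVec_of_ne _ _ h, inner_wedge_of_ne (by omega)]

/-- The isometric embedding of the even Fock space into the square integrable functions on the
configurations, twisted by `F`. -/
def twist (F : MeasurableUnitaries k) : evenFock (L2Line k) →ₗᵢ[ℂ] ConfigL2 k :=
  (exists_twist F).choose

theorem twist_wedge (F : MeasurableUnitaries k) {n : ℕ} (ξ : Fin (2 * n) → L2Line k)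
    (h : wedge ξ ∈ evenFock (L2Line k)) : twist F ⟨wedge ξ, h⟩ = genVec F ξ :=
  (exists_twist F).choose_spec ⟨n, ξ⟩ h

-- The fibres inside the even Fock space over the line.

theorem inner_secondQuantization {V W : Type*} [NormedAddCommGroup V] [InnerProductSpace ℂ V]
    [NormedAddCommGroup W] [InnerProductSpace ℂ W] (f : V →ₗᵢ[ℂ] W) (x y : Fock V) :
    (inner ℂ (secondQuantization f x) (secondQuantization f y) : ℂ) = inner ℂ x y := by
  induction x using UniformSpace.Completion.induction_on with
  | hp => exact isClosed_eq (by fun_prop) (by fun_prop)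
  | ih x =>
  induction y using UniformSpace.Completion.induction_on with
  | hp => exact isClosed_eq (by fun_prop) (by fun_prop)
  | ih y =>
  induction x using FockPre.induction with
  | h0 => simp only [UniformSpace.Completion.coe_zero, map_zero, inner_zero_left]
  | hadd x₁ x₂ h₁ h₂ => simp only [UniformSpace.Completion.coe_add, map_add, inner_add_left, h₁, h₂]
  | hgen r a =>
  induction y using FockPre.induction with
  | h0 => simp only [UniformSpace.Completion.coe_zero, map_zero, inner_zero_right]
  | hadd x₁ x₂ h₁ h₂ => simp only [UniformSpace.Completion.coe_add, map_add, inner_add_right, h₁, h₂]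
  | hgen s b =>
    obtain ⟨n, v⟩ := a
    obtain ⟨m, w⟩ := b
    simp only [UniformSpace.Completion.coe_smul, map_smul, inner_smul_left, inner_smul_right]
    congr 2
    change (inner ℂ (secondQuantization f (wedge v)) (secondQuantization f (wedge w)) : ℂ) =
      inner ℂ (wedge v) (wedge w)
    rw [secondQuantization_wedge, secondQuantization_wedge]
    by_cases h : n = m
    · subst h
      rw [inner_wedge, inner_wedge]
      simp
    · rw [inner_wedge_of_ne h, inner_wedge_of_ne h]

theorem secondQuantization_mem {V W : Type*} [NormedAddCommGroup V] [InnerProductSpace ℂ V]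
    [NormedAddCommGroup W] [InnerProductSpace ℂ W] (f : V →ₗᵢ[ℂ] W) {x : Fock V}
    (hx : x ∈ evenFock V) : secondQuantization f x ∈ evenFock W := by
  have hle : evenFock V ≤ (evenFock W).comap (secondQuantization f).toLinearMap := by
    refine Submodule.topologicalClosure_minimal _ (Submodule.span_le.2 ?_)
      ((Submodule.isClosed_topologicalClosure _).preimage (secondQuantization f).continuous)
    rintro _ ⟨n, v, rfl⟩
    change secondQuantization f (wedge v) ∈ evenFock W
    rw [secondQuantization_wedge]
    exact wedge_mem_evenFock _ (even_two_mul n)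
  exact hle hx

theorem eq_of_evenFock {V E : Type*} [NormedAddCommGroup V] [InnerProductSpace ℂ V]
    [TopologicalSpace E] [AddCommGroup E] [Module ℂ E] [T2Space E] {f g : evenFock V →L[ℂ] E}
    (h : ∀ (n : ℕ) (v : Fin (2 * n) → V), f ⟨wedge v, wedge_mem_evenFock v (even_two_mul n)⟩ =
      g ⟨wedge v, wedge_mem_evenFock v (even_two_mul n)⟩) : f = g := by
  have hle : evenFock V ≤ (LinearMap.eqLocus f.toLinearMap g.toLinearMap).map (evenFock V).subtype := by
    refine Submodule.topologicalClosure_minimal _ (Submodule.span_le.2 ?_) ?_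
    · rintro _ ⟨n, v, rfl⟩
      exact ⟨⟨wedge v, wedge_mem_evenFock v (even_two_mul n)⟩, h n v, rfl⟩
    · have h1 : IsClosed {x : evenFock V | f x = g x} := isClosed_eq f.continuous g.continuous
      exact (Submodule.isClosed_topologicalClosure _).isClosedEmbedding_subtypeVal.isClosedMap _ h1
  ext1 x
  obtain ⟨y, hy, hyx⟩ := hle x.2
  have : y = x := Subtype.ext hyx
  subst this
  exact hy

/-- The inclusion of the fibre `H_t` into the even Fock space over the line. -/
def fiberIncl (t : Time) : Fiber k t →ₗᵢ[ℂ] evenFock (L2Line k) :=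
  LinearMap.isometryOfInner
    (((secondQuantization (L2Interval k t).subtypeₗᵢ).toLinearMap.comp
      (evenFock (L2Interval k t)).subtype).codRestrict (evenFock (L2Line k))
        fun x => secondQuantization_mem _ x.2)
    fun x y => inner_secondQuantization _ (x : Fock (L2Interval k t)) y

theorem fiberIncl_evenWedge (t : Time) {n : ℕ} (ξ : Fin (2 * n) → L2Interval k t) :
    fiberIncl t (evenWedge t ξ) =
      ⟨wedge fun i => (ξ i : L2Line k), wedge_mem_evenFock _ (even_two_mul n)⟩ :=
  Subtype.ext (secondQuantization_wedge (L2Interval k t).subtypeₗᵢ ξ)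

/-- The isometric embedding of the fibre `H_t` twisted by `F`. -/
def fiberTwist (F : MeasurableUnitaries k) (t : Time) : Fiber k t →ₗᵢ[ℂ] ConfigL2 k :=
  (twist F).comp (fiberIncl t)

theorem fiberTwist_evenWedge (F : MeasurableUnitaries k) (t : Time) {n : ℕ}
    (ξ : Fin (2 * n) → L2Interval k t) :
    fiberTwist F t (evenWedge t ξ) = genVec F fun i => (ξ i : L2Line k) := by
  change twist F (fiberIncl t _) = _
  rw [fiberIncl_evenWedge, twist_wedge]

/-- Expresses, through inner products alone, that multiplication by `H` is unitary on functions of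
configurations. With the inverse of `F` in the place of `H`, it moves a twist from one side of the
inner product to the other. -/
theorem inner_twist_mul (F G H : MeasurableUnitaries k) (x y : evenFock (L2Line k)) :
    (inner ℂ (twist (H * F) x) (twist (H * G) y) : ℂ) = inner ℂ (twist F x) (twist G y) := by
  have hy : ∀ (n : ℕ) (v : Fin (2 * n) → L2Line k),
      (innerSL ℂ (twist (H * F) ⟨wedge v, wedge_mem_evenFock v (even_two_mul n)⟩)).comp
        (twist (H * G)).toContinuousLinearMap =
      (innerSL ℂ (twist F ⟨wedge v, wedge_mem_evenFock v (even_two_mul n)⟩)).comp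
        (twist G).toContinuousLinearMap := by
    intro n v
    refine eq_of_evenFock fun m w => ?_
    change (inner ℂ (twist (H * F) _) (twist (H * G) _) : ℂ) = inner ℂ (twist F _) (twist G _)
    rw [twist_wedge, twist_wedge, twist_wedge, twist_wedge]
    by_cases h : n = m
    · subst h
      rw [inner_genVec, inner_genVec]
      exact integral_congr_ae (Filter.Eventually.of_forall fun x => inner_antiVec_comp F.1 G.1 H.1 _ _ x)
    · rw [inner_genVec_of_ne _ _ h, inner_genVec_of_ne _ _ h]
  have hx : (innerSL ℂ (twist (H * G) y)).comp (twist (H * F)).toContinuousLinearMap =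
      (innerSL ℂ (twist G y)).comp (twist F).toContinuousLinearMap := by
    refine eq_of_evenFock fun n v => ?_
    have h1 : (inner ℂ (twist (H * F) ⟨wedge v, wedge_mem_evenFock v (even_two_mul n)⟩)
        (twist (H * G) y) : ℂ) = inner ℂ (twist F ⟨wedge v, wedge_mem_evenFock v (even_two_mul n)⟩)
        (twist G y) := congrArg (fun f => f y) (hy n v)
    have h2 := congrArg (starRingEnd ℂ) h1
    rw [inner_conj_symm, inner_conj_symm] at h2
    exact h2
  have h1 : (inner ℂ (twist (H * G) y) (twist (H * F) x) : ℂ) = inner ℂ (twist G y) (twist F x) :=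
    congrArg (fun f => f x) hx
  have h2 := congrArg (starRingEnd ℂ) h1
  rw [inner_conj_symm, inner_conj_symm] at h2
  exact h2

theorem inner_fiberTwist_mul (F G H : MeasurableUnitaries k) (t : Time) (x y : Fiber k t) :
    (inner ℂ (fiberTwist (H * F) t x) (fiberTwist (H * G) t y) : ℂ) =
      inner ℂ (fiberTwist F t x) (fiberTwist G t y) :=
  inner_twist_mul F G H _ _

theorem inner_fiberTwist_evenWedge (F : MeasurableUnitaries k) (t : Time) {n : ℕ}
    (η ξ : Fin (2 * n) → L2Interval k t) :
    (inner ℂ (fiberTwist 1 t (evenWedge t η)) (fiberTwist F t (evenWedge t ξ)) : ℂ) =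
      pairCoeff F.1 (fun i => ⇑(η i).1) (fun i => ⇑(ξ i).1) := by
  rw [fiberTwist_evenWedge, fiberTwist_evenWedge, inner_genVec, pairCoeff]
  simp only [inner_antiVec]
  rfl

end Embedding
end
end CliffordSystem

namespace CliffordSystem
noncomputable section

/-! ### Box vectors and their totality -/

section Boxes

/-- A convergent sequence in `L²` has a subsequence that converges almost everywhere. -/
theorem isClosed_ae_mem {X E : Type*} [MeasurableSpace X] {μ : Measure X} [NormedAddCommGroup E]
    {W : X → Set E} (hW : ∀ x, IsClosed (W x)) : IsClosed {f : Lp E 2 μ | ∀ᵐ x ∂μ, f x ∈ W x} := by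
  refine IsSeqClosed.isClosed fun u f hu hf => ?_
  obtain ⟨ns, -, hns⟩ := (tendstoInMeasure_of_tendsto_Lp hf).exists_seq_tendsto_ae
  have h : ∀ᵐ x ∂μ, ∀ n, u n x ∈ W x := ae_all_iff.2 hu
  filter_upwards [hns, h] with x h1 h2
  exact (hW x).mem_of_tendsto h1 (Filter.Eventually.of_forall fun i => h2 (ns i))

variable {k : Type*} [NormedAddCommGroup k] [InnerProductSpace ℂ k]

/-- The functions on the configurations that vanish outside `C`, with values in the tensor power
of the right degree. -/
def supported (k : Type*) [NormedAddCommGroup k] [InnerProductSpace ℂ k] (C : Set Config) :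
    Submodule ℂ (ConfigL2 k) where
  carrier := {f | ∀ᵐ ω ∂configMeasure, f ω ∈ {z | z ∈ tprodSpace k ω.1 ∧ (ω ∉ C → z = 0)}}
  add_mem' {f g} hf hg := by
    filter_upwards [hf, hg, Lp.coeFn_add f g] with ω h1 h2 h3
    rw [h3]
    exact ⟨Submodule.add_mem _ h1.1 h2.1, fun h => by simp [h1.2 h, h2.2 h]⟩
  zero_mem' := by
    filter_upwards [Lp.coeFn_zero (TensorFock k) 2 configMeasure] with ω h
    rw [h]
    exact ⟨Submodule.zero_mem _, fun _ => rfl⟩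
  smul_mem' c f hf := by
    filter_upwards [hf, Lp.coeFn_smul c f] with ω h1 h2
    rw [h2]
    exact ⟨Submodule.smul_mem _ _ h1.1, fun h => by simp [h1.2 h]⟩

theorem mem_supported {C : Set Config} {f : ConfigL2 k} : f ∈ supported k C ↔
    ∀ᵐ ω ∂configMeasure, f ω ∈ tprodSpace k ω.1 ∧ (ω ∉ C → f ω = 0) := Iff.rfl

theorem isClosed_supported (C : Set Config) : IsClosed (supported k C : Set (ConfigL2 k)) := by
  refine isClosed_ae_mem fun ω => ?_
  have h1 : IsClosed {z : TensorFock k | z ∈ tprodSpace k ω.1} :=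
    Submodule.isClosed_topologicalClosure _
  by_cases h : ω ∈ C
  · simpa [h] using h1
  · have h2 : {z : TensorFock k | z ∈ tprodSpace k ω.1 ∧ (ω ∉ C → z = 0)} = {0} := by
      ext z
      simp only [h, not_false_eq_true, true_imp_iff, Set.mem_ofPred_eq, Set.mem_singleton_iff]
      exact ⟨fun hz => hz.2, fun hz => ⟨hz ▸ Submodule.zero_mem _, hz⟩⟩
    rw [h2]
    exact isClosed_singleton

/-- The configurations in `[0, t]`. -/
def window (t : Time) : Set Config := {ω | ∀ i, ω.2 i ∈ Set.Icc (0 : ℝ) t}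

/-- The function `1_{A ∩ [0, t]} v`. -/
def cell (t : Time) {A : Set ℝ} (hA : MeasurableSet A) (v : k) : L2Interval k t :=
  ⟨indicatorConstLp 2 (hA.inter (measurableSet_Icc (a := (0 : ℝ)) (b := t)))
    ((measure_mono Set.inter_subset_right).trans_lt measure_Icc_lt_top).ne v, by
    rw [mem_L2Interval_iff]
    filter_upwards [indicatorConstLp_coeFn (p := 2)
      (hs := hA.inter (measurableSet_Icc (a := (0 : ℝ)) (b := t)))
      (hμs := ((measure_mono Set.inter_subset_right).trans_lt measure_Icc_lt_top).ne) (c := v)]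
      with x hx hx'
    rw [hx, Set.indicator_of_notMem fun h => hx' h.2]⟩

theorem cell_ae (t : Time) {A : Set ℝ} (hA : MeasurableSet A) (v : k) :
    ∀ᵐ x, (cell t hA v : L2Line k) x = (A ∩ Set.Icc (0 : ℝ) t).indicator (fun _ => v) x :=
  indicatorConstLp_coeFn (hs := hA.inter (measurableSet_Icc (a := (0 : ℝ)) (b := t)))
    (hμs := ((measure_mono Set.inter_subset_right).trans_lt measure_Icc_lt_top).ne)

theorem ae_eval {N : ℕ} (i : Fin N) {p : ℝ → Prop} (h : ∀ᵐ y, p y) :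
    ∀ᵐ x : Fin N → ℝ, p (x i) :=
  (Measure.quasiMeasurePreserving_eval (μ := fun _ : Fin N => (volume : Measure ℝ)) i).ae h

/-- The sets `A₁ > A₂ > ⋯` are strictly decreasing and contained in `(0, t)`. -/
def Ordered (t : ℝ) {N : ℕ} (A : Fin N → Set ℝ) : Prop :=
  (∀ i j, i < j → ∀ x ∈ A i, ∀ y ∈ A j, y < x) ∧ ∀ i, A i ⊆ Set.Ioo 0 t

/-- The vector `1_{A₁} v₁ ∧ ⋯ ∧ 1_{A₂ₙ} v₂ₙ`. -/
def boxVec (t : Time) {n : ℕ} {A : Fin (2 * n) → Set ℝ} (hA : ∀ i, MeasurableSet (A i))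
    (v : Fin (2 * n) → k) : Fiber k t :=
  evenWedge t fun i => cell t (hA i) (v i)

/-- `F(|x₁ - x₂|) (v₁ ⊗ v₂) ⊗ F(|x₃ - x₄|) (v₃ ⊗ v₄) ⊗ ⋯`. -/
def twistTensor (F : ℝ≥0 → TensorSquare k ≃ₗᵢ[ℂ] TensorSquare k) {n : ℕ} (v : Fin (2 * n) → k)
    (x : Fin (2 * n) → ℝ) : TensorFock k :=
  tprod fun j => F (Real.nnabs (x (fstIdx j) - x (sndIdx j))) (pairTmul (v (fstIdx j)) (v (sndIdx j)))

theorem twistTensor_one {n : ℕ} (v : Fin (2 * n) → k) (x : Fin (2 * n) → ℝ) :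
    twistTensor 1 v x = vtensor v := rfl

theorem perm_eq_one_of_strictMono {N : ℕ} {π : Equiv.Perm (Fin N)} (h : StrictMono π) : π = 1 := by
  ext1 i
  have h5 := StrictMono.range_inj (f := π) (g := id) h strictMono_id
  have h6 := h5.1 (by rw [(Equiv.surjective _).range_eq, Set.range_id])
  exact congrFun h6 i

open scoped Classical in
-- Both the sets and the coordinates decrease. If every `xᵢ` lies in `A_{τ i}`, then `τ` preserves
-- the order and is the identity, so only one term of the antisymmetrisation survives.
theorem antiVec_of_indicator (F : ℝ≥0 → TensorSquare k ≃ₗᵢ[ℂ] TensorSquare k) {n : ℕ} {t : ℝ}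
    {A : Fin (2 * n) → Set ℝ} (hA : Ordered t A) (v : Fin (2 * n) → k) {f : Fin (2 * n) → ℝ → k}
    {x : Fin (2 * n) → ℝ} (hx : StrictAnti x)
    (hf : ∀ i j, f i (x j) = (A i).indicator (fun _ => v i) (x j)) :
    antiVec F f x = if x ∈ Set.univ.pi A then twistTensor F v x else 0 := by
  have h0 : ∀ τ : Equiv.Perm (Fin (2 * n)), (∃ i, x i ∉ A (τ i)) → pairVec F (f ∘ τ) x = 0 := by
    rintro τ ⟨i, hi⟩
    have : ‖pairVec F (f ∘ τ) x‖ ^ 2 = 0 := by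
      rw [norm_pairVec_sq]
      refine Finset.prod_eq_zero (Finset.mem_univ i) ?_
      rw [Function.comp_apply, hf, Set.indicator_of_notMem hi, norm_zero]
      norm_num
    simpa using this
  rw [antiVec, Finset.sum_eq_single 1]
  · rw [Equiv.Perm.sign_one, Units.val_one, Int.cast_one, one_smul]
    split_ifs with h
    · rw [pairVec, twistTensor]
      congr 1
      ext1 j
      rw [pairTensor_eq]
      simp only [Function.comp_apply, Equiv.Perm.one_apply, hf]
      rw [Set.indicator_of_mem (h _ trivial), Set.indicator_of_mem (h _ trivial)]
    · refine h0 1 ?_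
      by_contra hcon
      push Not at hcon
      exact h fun i _ => hcon i
  · intro τ _ hτ
    rw [h0, smul_zero]
    by_contra hcon
    push Not at hcon
    refine hτ (perm_eq_one_of_strictMono fun i j hij => ?_)
    by_contra hlt
    rcases (not_lt.1 hlt).lt_or_eq with h | h
    · exact lt_asymm (hA.1 _ _ h _ (hcon j) _ (hcon i)) (hx hij)
    · exact hij.ne' (τ.injective h)
  · exact fun h => absurd (Finset.mem_univ _) h

open scoped Classical in
theorem genVec_cell_ae [TopologicalSpace.SeparableSpace k] (F : MeasurableUnitaries k) (t : Time)
    {n : ℕ} {A : Fin (2 * n) → Set ℝ} (hA : ∀ i, MeasurableSet (A i)) (hO : Ordered t A)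
    (v : Fin (2 * n) → k) :
    ∀ᵐ ω ∂configMeasure, fiberTwist F t (boxVec t hA v) ω =
      onSector n (fun x => if x ∈ Set.univ.pi A then twistTensor F.1 v x else 0) ω := by
  rw [boxVec, fiberTwist_evenWedge]
  have h1 := genVec_ae F fun i => (cell t (hA i) (v i) : L2Line k)
  rw [ae_config_iff] at h1 ⊢
  intro m
  by_cases hm : n = m
  · subst hm
    have h2 : ∀ᵐ x ∂(volume : Measure (Fin (2 * n) → ℝ)), ∀ i j, (cell t (hA i) (v i) : L2Line k) (x j) =
        (A i ∩ Set.Icc (0 : ℝ) t).indicator (fun _ => v i) (x j) := by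
      simp only [ae_all_iff]
      exact fun i j => ae_eval j (cell_ae t (hA i) (v i))
    filter_upwards [h1 n, ae_restrict_of_ae h2, ae_restrict_mem (measurableSet_simplex n)] with x h3 h4 h5
    rw [h3, onSector_same, onSector_same, antiVec_of_indicator F.1 hO v h5]
    intro i j
    rw [h4, Set.inter_eq_left.2 ((hO.2 i).trans Set.Ioo_subset_Icc_self)]
  · filter_upwards [h1 m] with x h3
    rw [h3, onSector_ne hm, onSector_ne hm]

/-- The measurable boxes form a π-system that generates the σ-algebra, and the sets with vanishing
integral are closed under complements and disjoint unions. -/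
theorem ae_eq_zero_of_setIntegral_pi {N : ℕ} {μ : Measure (Fin N → ℝ)} {φ : (Fin N → ℝ) → ℂ}
    (hφ : Integrable φ μ) (h : ∀ A : Fin N → Set ℝ, (∀ i, MeasurableSet (A i)) →
      ∫ x in Set.univ.pi A, φ x ∂μ = 0) : φ =ᵐ[μ] 0 := by
  have htot : ∫ x, φ x ∂μ = 0 := by
    have := h (fun _ => Set.univ) fun _ => MeasurableSet.univ
    rwa [Set.pi_univ, setIntegral_univ] at this
  suffices hall : ∀ S, MeasurableSet S → ∫ x in S, φ x ∂μ = 0 from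
    hφ.ae_eq_zero_of_forall_setIntegral_eq_zero fun S hS _ => hall S hS
  intro S hS
  refine MeasurableSpace.induction_on_inter (C := fun S _ => ∫ x in S, φ x ∂μ = 0)
    generateFrom_pi.symm isPiSystem_pi ?_ ?_ ?_ ?_ S hS
  · simp
  · rintro _ ⟨A, hA, rfl⟩
    exact h A fun i => hA i trivial
  · intro S hS ih
    have := integral_add_compl hS hφ
    rw [ih, htot, zero_add] at this
    exact this
  · intro f hd hm ih
    rw [integral_iUnion hm hd hφ.integrableOn]
    simp [ih]

theorem exists_ordered_nhds {N : ℕ} {t : ℝ} {x : Fin N → ℝ} (hx : StrictAnti x)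
    (ht : ∀ i, x i ∈ Set.Ioo 0 t) {U : Fin N → Set ℝ} (hU : ∀ i, IsOpen (U i)) (hxU : ∀ i, x i ∈ U i) :
    ∃ V : Fin N → Set ℝ, (∀ i, IsOpen (V i)) ∧ (∀ i, x i ∈ V i) ∧ (∀ i, V i ⊆ U i) ∧ Ordered t V := by
  -- Any `δ` smaller than half of every gap `xᵢ - xⱼ` keeps the intervals `(xᵢ - δ, xᵢ + δ)` in
  -- decreasing order.
  have hs : ∃ δ > 0, ∀ i j, i < j → x j + δ < x i - δ := by
    have h1 : ∀ p : Fin N × Fin N, ∀ᶠ δ in nhdsWithin (0 : ℝ) (Set.Ioi 0), p.1 < p.2 →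
        x p.2 + δ < x p.1 - δ := by
      intro p
      by_cases hp : p.1 < p.2
      · have h2 : Filter.Tendsto (fun δ : ℝ => x p.1 - δ - (x p.2 + δ)) (nhds 0)
            (nhds (x p.1 - 0 - (x p.2 + 0))) := by
          refine Continuous.tendsto ?_ 0
          fun_prop
        have h3 : 0 < x p.1 - 0 - (x p.2 + 0) := by
          have := hx hp
          linarith
        filter_upwards [nhdsWithin_le_nhds (h2.eventually (lt_mem_nhds h3))] with δ hδ _
        linarith
      · exact Filter.Eventually.of_forall fun δ h => absurd h hp
    have h4 := (Filter.eventually_all.2 h1).and self_mem_nhdsWithin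
    obtain ⟨δ, h5, h6⟩ := h4.exists
    exact ⟨δ, h6, fun i j hij => h5 (i, j) hij⟩
  obtain ⟨δ, hδ, hsep⟩ := hs
  refine ⟨fun i => U i ∩ Set.Ioo 0 t ∩ Set.Ioo (x i - δ) (x i + δ), fun i => ?_, fun i => ?_,
    fun i => ?_, fun i j hij y hy z hz => ?_, fun i => ?_⟩
  · exact ((hU i).inter isOpen_Ioo).inter isOpen_Ioo
  · exact ⟨⟨hxU i, ht i⟩, by linarith, by linarith⟩
  · exact fun y hy => hy.1.1
  · linarith [hsep i j hij, hy.2.1, hz.2.2]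
  · exact fun y hy => hy.1.2

theorem Ordered.mono {t : ℝ} {N : ℕ} {A B : Fin N → Set ℝ} (hB : Ordered t B)
    (h : ∀ i, A i ⊆ B i) : Ordered t A :=
  ⟨fun i j hij x hx y hy => hB.1 i j hij x (h i hx) y (h j hy), fun i => (h i).trans (hB.2 i)⟩

theorem Ordered.pi_subset {t : ℝ} {n : ℕ} {A : Fin (2 * n) → Set ℝ} (hA : Ordered t A) :
    Set.univ.pi A ⊆ simplex n :=
  fun x hx i j hij => hA.1 i j hij (x i) (hx i trivial) (x j) (hx j trivial)

variable [TopologicalSpace.SeparableSpace k]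

theorem inner_box_eq_setIntegral (t : Time) {n : ℕ} {A : Fin (2 * n) → Set ℝ}
    (hA : ∀ i, MeasurableSet (A i)) (hO : Ordered t A) (v : Fin (2 * n) → k) (h : ConfigL2 k) :
    (inner ℂ (fiberTwist 1 t (boxVec t hA v)) h : ℂ) =
      ∫ x in Set.univ.pi A, (inner ℂ (vtensor v) (h ⟨n, x⟩) : ℂ) := by
  classical
  have hm : MeasurableSet (Set.univ.pi A) := MeasurableSet.univ_pi hA
  rw [L2.inner_def]
  have h1 : ∀ᵐ ω ∂configMeasure, (inner ℂ (fiberTwist 1 t (boxVec t hA v) ω) (h ω) : ℂ) =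
      inner ℂ (onSector n (fun x => if x ∈ Set.univ.pi A then twistTensor 1 v x else 0) ω) (h ω) := by
    filter_upwards [genVec_cell_ae 1 t hA hO v] with ω h2
    rw [h2]
    rfl
  rw [integral_congr_ae h1, integral_sector (n := n)]
  · rw [← integral_indicator hm, ← integral_indicator (measurableSet_simplex n)]
    congr 1
    ext1 x
    by_cases hx : x ∈ Set.univ.pi A
    · rw [Set.indicator_of_mem (hO.pi_subset hx), Set.indicator_of_mem hx, onSector_same, if_pos hx,
        twistTensor_one]
    · rw [Set.indicator_of_notMem hx]
      by_cases hx2 : x ∈ simplex n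
      · rw [Set.indicator_of_mem hx2, onSector_same, if_neg hx, inner_zero_left]
      · rw [Set.indicator_of_notMem hx2]
  · intro m hm x
    rw [onSector_ne hm.symm, inner_zero_left]

theorem ae_mem_Ioo (t : Time) : ∀ n, ∀ᵐ x ∂(volume.restrict (simplex n)),
    (⟨n, x⟩ : Config) ∈ window t → ∀ i, x i ∈ Set.Ioo (0 : ℝ) t := by
  intro n
  have h : ∀ᵐ x ∂(volume : Measure (Fin (2 * n) → ℝ)), ∀ i, x i ≠ 0 ∧ x i ≠ (t : ℝ) := by
    rw [ae_all_iff]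
    intro i
    have h0 : ∀ᵐ y : ℝ, y ≠ 0 ∧ y ≠ (t : ℝ) := by
      filter_upwards [Measure.ae_ne volume (0 : ℝ), Measure.ae_ne volume (t : ℝ)] with y h1 h2
      exact ⟨h1, h2⟩
    exact ae_eval i h0
  filter_upwards [ae_restrict_of_ae h] with x hx hw i
  exact ⟨lt_of_le_of_ne (hw i).1 (hx i).1.symm, lt_of_le_of_ne (hw i).2 (hx i).2⟩

/-- Local form of totality. Pairing `h` with a box vector integrates one coefficient of `h` over the
box. If all small boxes near a configuration give zero, that coefficient vanishes almost everywhere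
nearby, and a locally null set is null. Testing only small boxes matters because a box can often be
split as a product only locally. -/
theorem eq_zero_of_inner_box (t : Time) {C : Set Config} (hC : C ⊆ window t) {h : ConfigL2 k}
    (hh : h ∈ supported k C)
    (H : ∀ n, ∀ᵐ x ∂(volume.restrict (simplex n)), (⟨n, x⟩ : Config) ∈ C →
      ∃ U : Fin (2 * n) → Set ℝ, (∀ i, IsOpen (U i)) ∧ (∀ i, x i ∈ U i) ∧
        ∀ (A : Fin (2 * n) → Set ℝ) (hA : ∀ i, MeasurableSet (A i)) (v : Fin (2 * n) → k),
          (∀ i, A i ⊆ U i) → Ordered t A → (inner ℂ (fiberTwist 1 t (boxVec t hA v)) h : ℂ) = 0) :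
    h = 0 := by
  rw [Lp.eq_zero_iff_ae_eq_zero]
  change ∀ᵐ ω ∂configMeasure, h ω = 0
  rw [mem_supported] at hh
  rw [ae_config_iff] at hh ⊢
  intro n
  have key : ∀ d : Fin (2 * n) → ℕ, ∀ᵐ x ∂(volume.restrict (simplex n)), (⟨n, x⟩ : Config) ∈ C →
      (inner ℂ (vtensor fun i => TopologicalSpace.denseSeq k (d i)) (h ⟨n, x⟩) : ℂ) = 0 := by
    intro d
    set v := fun i => TopologicalSpace.denseSeq k (d i) with hv
    have hg : MemLp (fun x => h ⟨n, x⟩) 2 (volume.restrict (simplex n)) := by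
      have h1 := (Lp.memLp h).restrict (Set.range (sector n))
      rw [restrict_sector, (measurableEmbedding_mk n).memLp_map_measure_iff] at h1
      exact h1
    -- `G` is a set of full measure in the simplex on which both almost-everywhere hypotheses hold
    -- at every point.
    obtain ⟨G, hG, hGm, hGp⟩ : ∃ G ⊆ simplex n, volume (simplex n \ G) = 0 ∧ ∀ x ∈ G,
        ((⟨n, x⟩ : Config) ∈ window t → ∀ i, x i ∈ Set.Ioo (0 : ℝ) t) ∧ ((⟨n, x⟩ : Config) ∈ C →
      ∃ U : Fin (2 * n) → Set ℝ, (∀ i, IsOpen (U i)) ∧ (∀ i, x i ∈ U i) ∧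
        ∀ (A : Fin (2 * n) → Set ℝ) (hA : ∀ i, MeasurableSet (A i)) (v : Fin (2 * n) → k),
          (∀ i, A i ⊆ U i) → Ordered t A →
          (inner ℂ (fiberTwist 1 t (boxVec t hA v)) h : ℂ) = 0) := by
      have h2 := (ae_restrict_iff' (measurableSet_simplex n)).1 ((ae_mem_Ioo t n).and (H n))
      refine ⟨{x | x ∈ simplex n ∧ _}, fun x hx => hx.1, ?_, fun x hx => hx.2⟩
      refine measure_mono_null ?_ (ae_iff.1 h2)
      intro x hx hcon
      exact hx.2 ⟨hx.1, hcon hx.1⟩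
    have hnull : volume {x | x ∈ G ∧ (⟨n, x⟩ : Config) ∈ C ∧ (inner ℂ (vtensor v) (h ⟨n, x⟩) : ℂ) ≠ 0} = 0 := by
      refine measure_null_of_locally_null _ fun x hx => ?_
      obtain ⟨U, hU, hxU, hUo⟩ := (hGp x hx.1).2 hx.2.1
      obtain ⟨V, hV, hxV, hVU, hVO⟩ := exists_ordered_nhds (hG hx.1)
        ((hGp x hx.1).1 (hC hx.2.1)) hU hxU
      have hBo : IsOpen (Set.univ.pi V) := isOpen_set_pi Set.finite_univ fun i _ => hV i
      have hBs : Set.univ.pi V ⊆ simplex n := hVO.pi_subset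
      have hBf : volume (Set.univ.pi V) ≠ ⊤ := by
        refine ((measure_mono (Set.pi_mono fun i _ => hVO.2 i)).trans_lt ?_).ne
        rw [volume_pi_pi]
        simp only [Real.volume_Ioo]
        exact ENNReal.prod_lt_top fun i _ => ENNReal.ofReal_lt_top
      have : IsFiniteMeasure (volume.restrict (Set.univ.pi V)) := ⟨by simpa using hBf.lt_top⟩
      have hint : Integrable (fun y => (inner ℂ (vtensor v) (h ⟨n, y⟩) : ℂ))
          (volume.restrict (Set.univ.pi V)) :=
        ((hg.mono_measure (Measure.restrict_mono hBs le_rfl)).const_inner (𝕜 := ℂ) (vtensor v)).integrable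
          (by norm_num)
      -- Intersecting an arbitrary product set with the small ordered box `∏ Vᵢ` gives again an
      -- ordered box, to which the local hypothesis applies.
      have hz := ae_eq_zero_of_setIntegral_pi hint fun A hA => by
        rw [Measure.restrict_restrict (MeasurableSet.univ_pi hA), ← Set.pi_inter_distrib]
        have hm : ∀ i, MeasurableSet (A i ∩ V i) := fun i => (hA i).inter (hV i).measurableSet
        have hO : Ordered t fun i => A i ∩ V i := hVO.mono fun i => Set.inter_subset_right
        rw [← inner_box_eq_setIntegral t hm hO]
        exact hUo _ hm v (fun i => Set.inter_subset_right.trans (hVU i)) hO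
      refine ⟨_, Filter.inter_mem self_mem_nhdsWithin
        (nhdsWithin_le_nhds (hBo.mem_nhds fun i _ => hxV i)), ?_⟩
      rw [Filter.EventuallyEq, ae_restrict_iff' hBo.measurableSet, ae_iff] at hz
      refine measure_mono_null ?_ hz
      rintro y ⟨hy1, hy2⟩ hcon
      exact hy1.2.2 (hcon hy2)
    rw [ae_restrict_iff' (measurableSet_simplex n), ae_iff]
    refine measure_mono_null ?_ (measure_union_null hGm hnull)
    intro x hx
    simp only [Set.mem_ofPred_eq, Classical.not_imp] at hx
    by_cases hxG : x ∈ G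
    · exact Or.inr ⟨hxG, hx.2.1, hx.2.2⟩
    · exact Or.inl ⟨hx.1, hxG⟩
  filter_upwards [hh n, ae_all_iff.2 key] with x h1 h2
  by_cases hx : (⟨n, x⟩ : Config) ∈ C
  · exact eq_zero_of_mem_tprodSpace h1.1 fun d => h2 d hx
  · exact h1.2 hx

end Boxes
end
end CliffordSystem

namespace CliffordSystem
noncomputable section

/-! ### The unitaries associated with unitary-valued functions -/

section Unitaries

theorem evenFock_induction {V : Type*} [NormedAddCommGroup V] [InnerProductSpace ℂ V]
    {W : Submodule ℂ (evenFock V)} (hW : IsClosed (W : Set (evenFock V)))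
    (h : ∀ (n : ℕ) (v : Fin (2 * n) → V), ⟨wedge v, wedge_mem_evenFock v (even_two_mul n)⟩ ∈ W)
    (x : evenFock V) : x ∈ W := by
  have hle : evenFock V ≤ W.map (evenFock V).subtype := by
    refine Submodule.topologicalClosure_minimal _ (Submodule.span_le.2 ?_) ?_
    · rintro _ ⟨n, v, rfl⟩
      exact ⟨⟨wedge v, wedge_mem_evenFock v (even_two_mul n)⟩, h n v, rfl⟩
    · exact (Submodule.isClosed_topologicalClosure _).isClosedEmbedding_subtypeVal.isClosedMap _ hW
  obtain ⟨y, hy, hyx⟩ := hle x.2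
  have : y = x := Subtype.ext hyx
  exact this ▸ hy

scoped instance {V : Type*} [NormedAddCommGroup V] [InnerProductSpace ℂ V] : CompleteSpace (evenFock V) :=
  (Submodule.isClosed_topologicalClosure _).completeSpace_coe

variable {k : Type*} [NormedAddCommGroup k] [InnerProductSpace ℂ k]

theorem pairVec_eq_zero (F : ℝ≥0 → TensorSquare k ≃ₗᵢ[ℂ] TensorSquare k) {n : ℕ}
    {f : Fin (2 * n) → ℝ → k} {x : Fin (2 * n) → ℝ} {i : Fin (2 * n)} (h : f i (x i) = 0) :
    pairVec F f x = 0 := by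
  have : ‖pairVec F f x‖ ^ 2 = 0 := by
    rw [norm_pairVec_sq]
    refine Finset.prod_eq_zero (Finset.mem_univ i) ?_
    rw [h, norm_zero]
    norm_num
  simpa using this

theorem antiVec_mem (F : ℝ≥0 → TensorSquare k ≃ₗᵢ[ℂ] TensorSquare k) {n : ℕ}
    (f : Fin (2 * n) → ℝ → k) (x : Fin (2 * n) → ℝ) : antiVec F f x ∈ tprodSpace k n :=
  Submodule.sum_mem _ fun _ _ => Submodule.smul_mem _ _ (tprod_mem _)

theorem ae_sub {N : ℕ} {i j : Fin N} (hij : i ≠ j) {p : ℝ → Prop} (h : ∀ᵐ r : ℝ, p r) :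
    ∀ᵐ x : Fin N → ℝ, p (x i - x j) := by
  obtain ⟨s, hs, hsm, hs0⟩ := exists_measurable_superset_of_null (ae_iff.1 h)
  have h1 : ∀ᵐ r : ℝ, r ∈ sᶜ := by
    rw [ae_iff]
    simpa using hs0
  filter_upwards [ae_sub_mem hij hsm.compl h1] with x hx
  by_contra hcon
  exact hx (hs hcon)

variable [TopologicalSpace.SeparableSpace k]

theorem fiber_induction {t : Time} {W : Submodule ℂ (Fiber k t)} (hW : IsClosed (W : Set (Fiber k t)))
    (h : ∀ (n : ℕ) (ξ : Fin (2 * n) → L2Interval k t), evenWedge t ξ ∈ W) (x : Fiber k t) : x ∈ W :=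
  evenFock_induction hW h x

theorem fiberTwist_mem (F : MeasurableUnitaries k) (t : Time) (x : Fiber k t) :
    fiberTwist F t x ∈ supported k (window t) := by
  refine fiber_induction (W := (supported k (window t)).comap (fiberTwist F t).toLinearMap)
    ((isClosed_supported _).preimage (fiberTwist F t).continuous) (fun n ξ => ?_) x
  change fiberTwist F t (evenWedge t ξ) ∈ supported k (window t)
  rw [fiberTwist_evenWedge, mem_supported]
  have h1 := genVec_ae F fun i => (ξ i : L2Line k)
  rw [ae_config_iff] at h1 ⊢
  intro m
  by_cases hm : n = m
  · subst hm
    have h2 : ∀ᵐ x : Fin (2 * n) → ℝ, ∀ i j, x j ∉ Set.Icc (0 : ℝ) t → (ξ i : L2Line k) (x j) = 0 := by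
      simp only [ae_all_iff]
      exact fun i j => ae_eval j (p := fun y => y ∉ Set.Icc (0 : ℝ) t → (ξ i : L2Line k) y = 0) (ξ i).2
    filter_upwards [h1 n, ae_restrict_of_ae h2] with x h3 h4
    rw [h3, onSector_same]
    refine ⟨antiVec_mem _ _ _, fun hx => ?_⟩
    simp only [window, Set.mem_ofPred_eq, not_forall] at hx
    obtain ⟨i, hi⟩ := hx
    refine Finset.sum_eq_zero fun τ _ => ?_
    rw [pairVec_eq_zero F.1 (i := i) (h4 _ i hi), smul_zero]
  · filter_upwards [h1 m] with x h3
    rw [h3, onSector_ne hm]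
    exact ⟨Submodule.zero_mem _, fun _ => rfl⟩

/-- The vectors of the fibre `H_t` supported on `C`. -/
def fiberSupported (k : Type*) [NormedAddCommGroup k] [InnerProductSpace ℂ k]
    [TopologicalSpace.SeparableSpace k] (t : Time) (C : Set Config) : Submodule ℂ (Fiber k t) :=
  (supported k C).comap (fiberTwist 1 t).toLinearMap

theorem mem_fiberSupported {t : Time} {C : Set Config} {x : Fiber k t} :
    x ∈ fiberSupported k t C ↔ fiberTwist 1 t x ∈ supported k C := Iff.rfl

theorem mem_fiberSupported_iff {t : Time} {C : Set Config} {x : Fiber k t} :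
    x ∈ fiberSupported k t C ↔ ∀ᵐ ω ∂configMeasure, ω ∉ C → fiberTwist 1 t x ω = 0 := by
  rw [mem_fiberSupported, mem_supported]
  refine ⟨fun h => h.mono fun ω hω => hω.2, fun h => ?_⟩
  filter_upwards [h, mem_supported.1 (fiberTwist_mem 1 t x)] with ω h1 h2
  exact ⟨h2.1, h1⟩

theorem isClosed_fiberSupported (t : Time) (C : Set Config) :
    IsClosed (fiberSupported k t C : Set (Fiber k t)) :=
  (isClosed_supported _).preimage (fiberTwist 1 t).continuous

theorem fiberSupported_inter_window {t : Time} {C : Set Config} {x : Fiber k t}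
    (hx : x ∈ fiberSupported k t C) : x ∈ fiberSupported k t (C ∩ window t) := by
  rw [mem_fiberSupported_iff] at hx ⊢
  filter_upwards [hx, mem_supported.1 (fiberTwist_mem 1 t x)] with ω h1 h2 h3
  by_cases h : ω ∈ C
  · exact h2.2 fun hw => h3 ⟨h, hw⟩
  · exact h1 h

/-- Density criterion: the difference of `y` and its projection to the closed span is supported in
`C` and orthogonal to `X`, so the separation hypothesis annihilates it. -/
theorem mem_closure_span {t : Time} {C : Set Config} {X : Set (Fiber k t)}
    (hX : ∀ x ∈ X, x ∈ fiberSupported k t C)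
    (hD : ∀ h ∈ supported k (C ∩ window t), (∀ x ∈ X, (inner ℂ (fiberTwist 1 t x) h : ℂ) = 0) → h = 0)
    {y : Fiber k t} (hy : y ∈ fiberSupported k t C) :
    y ∈ (Submodule.span ℂ X).topologicalClosure := by
  set M := (Submodule.span ℂ X).topologicalClosure with hM
  have hMc : IsClosed (M : Set (Fiber k t)) := Submodule.isClosed_topologicalClosure _
  have : CompleteSpace M := hMc.completeSpace_coe
  have hle : M ≤ fiberSupported k t C :=
    Submodule.topologicalClosure_minimal _ (Submodule.span_le.2 hX) (isClosed_fiberSupported t C)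
  have hp : (M.starProjection y) ∈ M := Submodule.starProjection_apply_mem _ _
  have h0 : fiberTwist 1 t (y - M.starProjection y) = 0 := by
    refine hD _ (fiberSupported_inter_window (Submodule.sub_mem _ hy (hle hp))) fun x hx => ?_
    rw [LinearIsometry.inner_map_map]
    exact Submodule.inner_right_of_mem_orthogonal
      (Submodule.le_topologicalClosure _ (Submodule.subset_span hx))
      (Submodule.sub_starProjection_mem_orthogonal y)
  have h1 : y - M.starProjection y = 0 := (fiberTwist 1 t).injective (by rw [h0, map_zero])
  rw [sub_eq_zero.1 h1]
  exact hp

/-- The vectors `1_{A₁} v₁ ∧ ⋯ ∧ 1_{A₂ₙ} v₂ₙ` with `A₁ > ⋯ > A₂ₙ` in `(0, t)`. -/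
def boxes (k : Type*) [NormedAddCommGroup k] [InnerProductSpace ℂ k] (t : Time) : Set (Fiber k t) :=
  {x | ∃ (n : ℕ) (A : Fin (2 * n) → Set ℝ) (hA : ∀ i, MeasurableSet (A i)) (v : Fin (2 * n) → k),
    Ordered t A ∧ x = boxVec t hA v}

theorem eq_zero_of_inner_boxes {t : Time} {h : ConfigL2 k} (hh : h ∈ supported k (window t))
    (H : ∀ x ∈ boxes k t, (inner ℂ (fiberTwist 1 t x) h : ℂ) = 0) : h = 0 := by
  refine eq_zero_of_inner_box t le_rfl hh fun n => Filter.Eventually.of_forall fun x _ => ?_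
  exact ⟨fun _ => Set.univ, fun _ => isOpen_univ, fun _ => trivial,
    fun A hA v _ hO => H _ ⟨n, A, hA, v, hO, rfl⟩⟩

theorem mem_closure_boxes (t : Time) (y : Fiber k t) :
    y ∈ (Submodule.span ℂ (boxes k t)).topologicalClosure := by
  refine mem_closure_span (C := window t) (fun x _ => fiberTwist_mem 1 t x) (fun h hh H => ?_)
    (fiberTwist_mem 1 t y)
  rw [Set.inter_self] at hh
  exact eq_zero_of_inner_boxes hh H

theorem boxes_induction {t : Time} {W : Submodule ℂ (Fiber k t)} (hW : IsClosed (W : Set (Fiber k t)))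
    (h : ∀ x ∈ boxes k t, x ∈ W) (x : Fiber k t) : x ∈ W :=
  Submodule.topologicalClosure_minimal _ (Submodule.span_le.2 h) hW (mem_closure_boxes t x)

/-- The range of an isometry on a complete space is closed, and it contains the box vectors, which
are total among the functions supported in the window. -/
theorem exists_fiberTwist_eq (t : Time) {f : ConfigL2 k} (hf : f ∈ supported k (window t)) :
    ∃ x, fiberTwist 1 t x = f := by
  let R : Submodule ℂ (ConfigL2 k) := LinearMap.range (fiberTwist 1 t).toLinearMap
  have hRc : IsClosed (R : Set (ConfigL2 k)) :=
    (fiberTwist (k := k) 1 t).isometry.isClosedEmbedding.isClosed_range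
  have : CompleteSpace R := hRc.completeSpace_coe
  have hp : (R.starProjection f) ∈ R := Submodule.starProjection_apply_mem _ _
  obtain ⟨x, hx⟩ := hp
  have hx' : fiberTwist 1 t x = R.starProjection f := hx
  refine ⟨x, ?_⟩
  have h0 : f - R.starProjection f = 0 := by
    refine eq_zero_of_inner_boxes (t := t) (Submodule.sub_mem _ hf ?_) fun y _ => ?_
    · rw [← hx']
      exact fiberTwist_mem 1 t x
    · exact Submodule.inner_right_of_mem_orthogonal
        (LinearMap.mem_range_self (fiberTwist 1 t).toLinearMap y)
        (Submodule.sub_starProjection_mem_orthogonal f)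
  rw [hx']
  exact (sub_eq_zero.1 h0).symm

/-- The operator on the fibre `H_t` associated with `F`. -/
def fiberOp (F : MeasurableUnitaries k) (t : Time) : Fiber k t →L[ℂ] Fiber k t :=
  (ContinuousLinearMap.adjoint (fiberTwist 1 t).toContinuousLinearMap).comp
    (fiberTwist F t).toContinuousLinearMap

theorem inner_fiberOp (F : MeasurableUnitaries k) (t : Time) (z w : Fiber k t) :
    (inner ℂ z (fiberOp F t w) : ℂ) = inner ℂ (fiberTwist 1 t z) (fiberTwist F t w) := by
  rw [fiberOp, ContinuousLinearMap.comp_apply, ContinuousLinearMap.adjoint_inner_right]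
  rfl

/-- The adjoint of an isometry inverts it only on its range; the range of `fiberTwist F t` is
contained there because `fiberTwist 1 t` reaches every function supported in the window. -/
theorem fiberTwist_fiberOp (F : MeasurableUnitaries k) (t : Time) (x : Fiber k t) :
    fiberTwist 1 t (fiberOp F t x) = fiberTwist F t x := by
  obtain ⟨y, hy⟩ := exists_fiberTwist_eq t (fiberTwist_mem F t x)
  have : fiberOp F t x = y := ext_inner_left ℂ fun z => by
    rw [inner_fiberOp, ← hy, LinearIsometry.inner_map_map]
  rw [this, hy]

/-- Multiplying both arguments by `F⁻¹` turns the outer twist into the trivial one, after which the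
inner operator can be evaluated by `fiberTwist_fiberOp`. -/
theorem fiberOp_mul (F G : MeasurableUnitaries k) (t : Time) (x : Fiber k t) :
    fiberOp F t (fiberOp G t x) = fiberOp (F * G) t x := by
  refine ext_inner_left ℂ fun z => ?_
  rw [inner_fiberOp, inner_fiberOp, ← inner_fiberTwist_mul 1 F F⁻¹, ← inner_fiberTwist_mul 1 (F * G) F⁻¹,
    inv_mul_cancel, inv_mul_cancel_left, fiberTwist_fiberOp]

theorem fiberOp_one (t : Time) (x : Fiber k t) : fiberOp 1 t x = x := by
  refine ext_inner_left ℂ fun z => ?_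
  rw [inner_fiberOp, LinearIsometry.inner_map_map]

/-- The unitary on the fibre `H_t` associated with `F`. -/
def fiberUnitary (F : MeasurableUnitaries k) (t : Time) : Fiber k t ≃ₗᵢ[ℂ] Fiber k t where
  toFun := fiberOp F t
  map_add' := map_add _
  map_smul' := map_smul _
  invFun := fiberOp F⁻¹ t
  left_inv x := by rw [fiberOp_mul, inv_mul_cancel, fiberOp_one]
  right_inv x := by rw [fiberOp_mul, mul_inv_cancel, fiberOp_one]
  norm_map' x := by
    change ‖fiberOp F t x‖ = ‖x‖
    rw [← (fiberTwist 1 t).norm_map, fiberTwist_fiberOp, LinearIsometry.norm_map]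

theorem fiberTwist_fiberUnitary (F : MeasurableUnitaries k) (t : Time) (x : Fiber k t) :
    fiberTwist 1 t (fiberUnitary F t x) = fiberTwist F t x :=
  fiberTwist_fiberOp F t x

theorem fiberUnitary_mul (F G : MeasurableUnitaries k) (t : Time) (x : Fiber k t) :
    fiberUnitary (F * G) t x = fiberUnitary F t (fiberUnitary G t x) :=
  (fiberOp_mul F G t x).symm

theorem fiberUnitary_one (t : Time) (x : Fiber k t) : fiberUnitary 1 t x = x :=
  fiberOp_one t x

theorem inner_fiberUnitary_evenWedge (F : MeasurableUnitaries k) (t : Time) {n : ℕ}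
    (η ξ : Fin (2 * n) → L2Interval k t) :
    (inner ℂ (evenWedge t η) (fiberUnitary F t (evenWedge t ξ)) : ℂ) =
      pairCoeff F.1 (fun i => ⇑(η i).1) (fun i => ⇑(ξ i).1) := by
  rw [← inner_fiberTwist_evenWedge]
  exact inner_fiberOp F t _ _

theorem fiberUnitary_of_aeTrivial {F : MeasurableUnitaries k} (hF : F ∈ AeTrivial k) (t : Time)
    (x : Fiber k t) : fiberUnitary F t x = x := by
  refine fiber_induction (W := LinearMap.eqLocus (fiberUnitary F t).toLinearEquiv.toLinearMap LinearMap.id)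
    (isClosed_eq (fiberUnitary F t).continuous continuous_id) (fun n ξ => ?_) x
  change fiberUnitary F t (evenWedge t ξ) = evenWedge t ξ
  refine (fiberTwist 1 t).injective ?_
  rw [fiberTwist_fiberUnitary, fiberTwist_evenWedge, fiberTwist_evenWedge, genVec, genVec]
  refine MemLp.toLp_congr _ _ ?_
  change ∀ᵐ ω ∂configMeasure, _
  rw [ae_config_iff]
  intro m
  by_cases hm : n = m
  · subst hm
    have hF' : ∀ᵐ r : ℝ, 0 ≤ r → F.1 r.toNNReal = 1 := hF
    have h2 : ∀ᵐ x : Fin (2 * n) → ℝ, ∀ j : Fin n, 0 ≤ x (fstIdx j) - x (sndIdx j) →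
        F.1 (x (fstIdx j) - x (sndIdx j)).toNNReal = 1 := by
      rw [ae_all_iff]
      -- The difference of two distinct coordinates pulls null sets back to null sets, so the
      -- exceptional gaps are met only on a null set of configurations.
      exact fun j => ae_sub (p := fun r => 0 ≤ r → F.1 r.toNNReal = 1) (fstIdx_ne_sndIdx j) hF'
    filter_upwards [ae_restrict_of_ae h2, ae_restrict_mem (measurableSet_simplex n)] with x h3 h4
    rw [onSector_same, onSector_same]
    refine Finset.sum_congr rfl fun τ _ => ?_
    congr 1
    rw [pairVec, pairVec]
    congr 1
    ext1 j
    have h5 : 0 ≤ x (fstIdx j) - x (sndIdx j) := by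
      have := h4 (fstIdx_lt_sndIdx j)
      linarith
    have h6 := h3 j h5
    have h7 : Real.nnabs (x (fstIdx j) - x (sndIdx j)) = (x (fstIdx j) - x (sndIdx j)).toNNReal :=
      NNReal.eq (by rw [Real.coe_nnabs, abs_of_nonneg h5, Real.coe_toNNReal _ h5])
    rw [h7, h6]
    rfl
  · refine Filter.Eventually.of_forall fun x => ?_
    rw [onSector_ne hm, onSector_ne hm]

end Unitaries
end
end CliffordSystem

namespace CliffordSystem
noncomputable section

/-! ### Products of box vectors -/

section Products
variable {k : Type*} [NormedAddCommGroup k] [InnerProductSpace ℂ k]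

/-- Concatenation of two families of even length. -/
def concat {α : Type*} {p m : ℕ} (b : Fin (2 * p) → α) (a : Fin (2 * m) → α) :
    Fin (2 * (p + m)) → α :=
  fun i => Fin.append b a (Fin.cast (by ring) i)

/-- The `i`-th position of the first family. -/
def inlIdx {p : ℕ} (m : ℕ) (i : Fin (2 * p)) : Fin (2 * (p + m)) := ⟨i, by omega⟩

/-- The `i`-th position of the second family. -/
def inrIdx {m : ℕ} (p : ℕ) (i : Fin (2 * m)) : Fin (2 * (p + m)) := ⟨2 * p + i, by omega⟩

theorem inrIdx_lt_iff {m p : ℕ} {i j : Fin (2 * m)} : inrIdx p i < inrIdx p j ↔ i < j := by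
  rw [Fin.lt_def, Fin.lt_def, inrIdx, inrIdx]
  exact Nat.add_lt_add_iff_left

theorem concat_inl {α : Type*} {p m : ℕ} (b : Fin (2 * p) → α) (a : Fin (2 * m) → α)
    (i : Fin (2 * p)) : concat b a (inlIdx m i) = b i := by
  have : Fin.cast (by ring) (inlIdx m i) = Fin.castAdd (2 * m) i := rfl
  rw [concat, this, Fin.append_left]

theorem concat_inr {α : Type*} {p m : ℕ} (b : Fin (2 * p) → α) (a : Fin (2 * m) → α)
    (i : Fin (2 * m)) : concat b a (inrIdx p i) = a i := by
  have : Fin.cast (by ring) (inrIdx p i) = Fin.natAdd (2 * p) i := rfl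
  rw [concat, this, Fin.append_right]

theorem forall_inl_inr {p m : ℕ} {q : Fin (2 * (p + m)) → Prop} (h1 : ∀ i, q (inlIdx m i))
    (h2 : ∀ i, q (inrIdx p i)) (i : Fin (2 * (p + m))) : q i := by
  by_cases hi : (i : ℕ) < 2 * p
  · exact h1 ⟨i, hi⟩
  · have := h2 ⟨i - 2 * p, by omega⟩
    convert this using 1
    ext
    simp only [inrIdx]
    omega

theorem wedge_cast {V : Type*} [NormedAddCommGroup V] [InnerProductSpace ℂ V] {n m : ℕ} (h : m = n)
    (v : Fin n → V) : wedge (fun i => v (Fin.cast h i)) = wedge v := by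
  subst h
  rfl

theorem mul_evenWedge (s t : Time) {m p : ℕ} (ξ : Fin (2 * m) → L2Interval k s)
    (η : Fin (2 * p) → L2Interval k t) : mul s t (evenWedge s ξ) (evenWedge t η) =
      evenWedge (s + t) (concat (fun i => shift s t (η i)) fun i => inclusion s t (ξ i)) := by
  refine Subtype.ext ?_
  change wedgeMul _ _ _ (wedge ξ) (wedge η) = wedge _
  rw [wedgeMul_wedge]
  exact (wedge_cast _ _).symm

theorem cell_congr (t : Time) {A B : Set ℝ} (hA : MeasurableSet A) (hB : MeasurableSet B) {v w : k}
    (h : A = B) (hv : v = w) : cell t hA v = cell t hB w := by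
  subst h hv
  rfl

theorem inclusion_cell (s t : Time) {A : Set ℝ} (hA : MeasurableSet A) (h : A ⊆ Set.Ioo (0 : ℝ) s) (v : k) :
    inclusion s t (cell s hA v) = cell (s + t) hA v := by
  refine Subtype.ext (Lp.ext ?_)
  change ∀ᵐ x, (cell s hA v : L2Line k) x = (cell (s + t) hA v : L2Line k) x
  filter_upwards [cell_ae s hA v, cell_ae (s + t) hA v] with x h1 h2
  rw [h1, h2, Set.inter_eq_left.2 (h.trans Set.Ioo_subset_Icc_self), Set.inter_eq_left.2]
  refine h.trans fun y hy => ⟨hy.1.le, hy.2.le.trans ?_⟩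
  simpa using t.2.le

theorem shift_cell (s t : Time) {A : Set ℝ} (hA : MeasurableSet A) (h : A ⊆ Set.Ioo (0 : ℝ) t) (v : k)
    (hA' : MeasurableSet ((fun x => x - (s : ℝ)) ⁻¹' A)) :
    shift s t (cell t hA v) = cell (s + t) hA' v := by
  refine Subtype.ext (Lp.ext ?_)
  change ∀ᵐ x, shiftLine s (cell t hA v : L2Line k) x = (cell (s + t) hA' v : L2Line k) x
  have h3 := (measurePreserving_sub_right volume (s : ℝ)).quasiMeasurePreserving.ae (cell_ae t hA v)
  filter_upwards [shiftLine_ae s (cell t hA v : L2Line k), h3, cell_ae (s + t) hA' v] with x h1 h2 h4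
  rw [h1, h2, h4, Set.inter_eq_left.2 (h.trans Set.Ioo_subset_Icc_self), Set.inter_eq_left.2]
  · rfl
  · intro y hy
    have := h hy
    have hs : (0 : ℝ) < s := s.2
    rw [Positive.coe_add]
    exact ⟨by linarith [this.1], by linarith [this.2]⟩

theorem measurableSet_shift (s : Time) {A : Set ℝ} (hA : MeasurableSet A) :
    MeasurableSet ((fun x => x - (s : ℝ)) ⁻¹' A) :=
  (measurable_id.sub_const _) hA

/-- The sets `B₁ + s, …, Bₚ + s, A₁, …, Aₘ`. -/
def concatSet (s : Time) {p m : ℕ} (B : Fin (2 * p) → Set ℝ) (A : Fin (2 * m) → Set ℝ) :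
    Fin (2 * (p + m)) → Set ℝ :=
  concat (fun i => (fun x => x - (s : ℝ)) ⁻¹' B i) A

theorem measurableSet_concatSet (s : Time) {p m : ℕ} {B : Fin (2 * p) → Set ℝ}
    {A : Fin (2 * m) → Set ℝ} (hB : ∀ i, MeasurableSet (B i)) (hA : ∀ i, MeasurableSet (A i)) :
    ∀ i, MeasurableSet (concatSet s B A i) := by
  refine forall_inl_inr (fun i => ?_) fun i => ?_
  · rw [concatSet, concat_inl]
    exact measurableSet_shift s (hB i)
  · rw [concatSet, concat_inr]
    exact hA i

theorem ordered_concatSet {s t : Time} {p m : ℕ} {B : Fin (2 * p) → Set ℝ}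
    {A : Fin (2 * m) → Set ℝ} (hB : Ordered t B) (hA : Ordered s A) :
    Ordered ((s + t : Time) : ℝ) (concatSet s B A) := by
  have hs : (0 : ℝ) < s := s.2
  have ht : (0 : ℝ) < t := t.2
  have hB' : ∀ i x, x - (s : ℝ) ∈ B i → (s : ℝ) < x ∧ x < s + t := fun i x hx => by
    have := hB.2 i hx
    exact ⟨by linarith [this.1], by linarith [this.2]⟩
  refine ⟨?_, ?_⟩
  · refine forall_inl_inr (fun i => ?_) fun i => ?_ <;>
      refine forall_inl_inr (fun j => ?_) fun j => ?_
    · intro hij x hx y hy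
      rw [concatSet, concat_inl] at hx hy
      have := hB.1 i j hij _ hx _ hy
      linarith
    · intro hij x hx y hy
      rw [concatSet, concat_inl] at hx
      rw [concatSet, concat_inr] at hy
      linarith [(hB' i x hx).1, (hA.2 j hy).2]
    · intro hij
      simp only [inrIdx, inlIdx, Fin.lt_def] at hij
      omega
    · intro hij x hx y hy
      rw [concatSet, concat_inr] at hx hy
      exact hA.1 i j (inrIdx_lt_iff.1 hij) x hx y hy
  · rw [Positive.coe_add]
    refine forall_inl_inr (fun i => ?_) fun i => ?_
    · intro x hx
      rw [concatSet, concat_inl] at hx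
      exact ⟨by linarith [(hB' i x hx).1], (hB' i x hx).2⟩
    · intro x hx
      rw [concatSet, concat_inr] at hx
      have := hA.2 i hx
      exact ⟨this.1, by linarith [this.2]⟩

/-- `U_{s,t}` puts the shifted vectors of the second factor first, which is the decreasing order of
the supports. Hence no sign appears, and the product is again an ordered box vector. -/
theorem mul_boxVec (s t : Time) {m p : ℕ} {A : Fin (2 * m) → Set ℝ} (hA : ∀ i, MeasurableSet (A i))
    (v : Fin (2 * m) → k) {B : Fin (2 * p) → Set ℝ} (hB : ∀ i, MeasurableSet (B i))
    (w : Fin (2 * p) → k) (hAO : Ordered s A) (hBO : Ordered t B) :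
    mul s t (boxVec s hA v) (boxVec t hB w) =
      boxVec (s + t) (measurableSet_concatSet s hB hA) (concat w v) := by
  rw [boxVec, boxVec, mul_evenWedge, boxVec]
  congr 1
  ext1 i
  revert i
  refine forall_inl_inr (fun i => ?_) fun i => ?_
  · rw [concat_inl, shift_cell s t (hB i) (hBO.2 i) (w i) (measurableSet_shift s (hB i))]
    exact cell_congr _ _ _ (by rw [concatSet, concat_inl]) (by rw [concat_inl])
  · rw [concat_inr, inclusion_cell s t (hA i) (hAO.2 i)]
    exact cell_congr _ _ _ (by rw [concatSet, concat_inr]) (by rw [concat_inr])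

/-- Converse of `mul_boxVec`: a box cut by `s` is factored by taking the sets below `s` as they are
and shifting those above `s` back by `s`. -/
theorem exists_mul_eq_boxVec (s t : Time) {m p : ℕ} {C : Fin (2 * (p + m)) → Set ℝ}
    (hC : ∀ i, MeasurableSet (C i)) (u : Fin (2 * (p + m)) → k) (hO : Ordered ((s + t : Time) : ℝ) C)
    (h1 : ∀ i, C (inlIdx m i) ⊆ Set.Ioi (s : ℝ)) (h2 : ∀ i, C (inrIdx p i) ⊆ Set.Iio (s : ℝ)) :
    ∃ (A : Fin (2 * m) → Set ℝ) (hA : ∀ i, MeasurableSet (A i)) (v : Fin (2 * m) → k)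
      (B : Fin (2 * p) → Set ℝ) (hB : ∀ i, MeasurableSet (B i)) (w : Fin (2 * p) → k),
      Ordered s A ∧ Ordered t B ∧
        mul s t (boxVec s hA v) (boxVec t hB w) = boxVec (s + t) hC u := by
  refine ⟨fun i => C (inrIdx p i), fun i => hC _, fun i => u (inrIdx p i),
    fun i => (fun x => x + (s : ℝ)) ⁻¹' C (inlIdx m i), fun i => (measurable_id.add_const _) (hC _),
    fun i => u (inlIdx m i), ?_, ?_, ?_⟩
  · refine ⟨fun i j hij => hO.1 _ _ (inrIdx_lt_iff.2 hij), fun i x hx => ⟨(hO.2 _ hx).1, h2 i hx⟩⟩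
  · refine ⟨fun i j hij x hx y hy => ?_, fun i x hx => ?_⟩
    · have := hO.1 (inlIdx m i) (inlIdx m j) hij _ hx _ hy
      linarith
    · have h3 := hO.2 _ hx
      have h4 : (s : ℝ) < x + s := h1 i hx
      rw [Positive.coe_add] at h3
      exact ⟨by linarith, by linarith [h3.2]⟩
  · rw [mul_boxVec]
    · rw [boxVec, boxVec]
      congr 1
      ext1 i
      revert i
      refine forall_inl_inr (fun i => ?_) fun i => ?_
      · refine cell_congr _ _ _ ?_ (by rw [concat_inl])
        rw [concatSet, concat_inl]
        ext x
        simp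
      · refine cell_congr _ _ _ ?_ (by rw [concat_inr])
        rw [concatSet, concat_inr]
    · refine ⟨fun i j hij => hO.1 _ _ (inrIdx_lt_iff.2 hij), fun i x hx => ⟨(hO.2 _ hx).1, h2 i hx⟩⟩
    · refine ⟨fun i j hij x hx y hy => ?_, fun i x hx => ?_⟩
      · have := hO.1 (inlIdx m i) (inlIdx m j) hij _ hx _ hy
        linarith
      · have h3 := hO.2 _ hx
        have h4 : (s : ℝ) < x + s := h1 i hx
        rw [Positive.coe_add] at h3
        exact ⟨by linarith, by linarith [h3.2]⟩

/-- The number of points in `(-∞, s]`. -/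
def countLE (s : ℝ) (ω : Config) : ℕ := (Finset.univ.filter fun i => ω.2 i ≤ s).card

theorem countLE_concatSet {s t : Time} {p m : ℕ} {B : Fin (2 * p) → Set ℝ}
    {A : Fin (2 * m) → Set ℝ} (hB : Ordered t B) (hA : Ordered s A) {x : Fin (2 * (p + m)) → ℝ}
    (hx : x ∈ Set.univ.pi (concatSet s B A)) : countLE s ⟨p + m, x⟩ = 2 * m := by
  have h1 : ∀ i, (s : ℝ) < x (inlIdx m i) := fun i => by
    have := hx (inlIdx m i) trivial
    rw [concatSet, concat_inl] at this
    linarith [(hB.2 i this).1]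
  have h2 : ∀ i, x (inrIdx p i) ≤ s := fun i => by
    have := hx (inrIdx p i) trivial
    rw [concatSet, concat_inr] at this
    exact (hA.2 i this).2.le
  have h3 : (Finset.univ.filter fun i => x i ≤ s) =
      Finset.univ.filter fun i : Fin (2 * (p + m)) => ¬ (i : ℕ) < 2 * p := by
    ext i
    simp only [Finset.mem_filter, Finset.mem_univ, true_and]
    revert i
    refine forall_inl_inr (fun i => ?_) fun i => ?_
    · simpa [inlIdx] using h1 i
    · simpa [inrIdx] using h2 i
  have h4 := Finset.card_filter_add_card_filter_not (s := (Finset.univ : Finset (Fin (2 * (p + m)))))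
    (fun i : Fin (2 * (p + m)) => (i : ℕ) < 2 * p)
  rw [Fin.card_filter_val_lt, Finset.card_univ, Fintype.card_fin] at h4
  rw [countLE]
  change (Finset.univ.filter fun i => x i ≤ s).card = 2 * m
  rw [h3]
  omega

variable [TopologicalSpace.SeparableSpace k]

theorem boxVec_ae_sector (F : MeasurableUnitaries k) (t : Time) {n : ℕ} {A : Fin (2 * n) → Set ℝ}
    (hA : ∀ i, MeasurableSet (A i)) (hO : Ordered t A) (v : Fin (2 * n) → k) :
    ∀ᵐ ω ∂configMeasure, ω.1 ≠ n → fiberTwist F t (boxVec t hA v) ω = 0 := by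
  classical
  filter_upwards [genVec_cell_ae F t hA hO v] with ⟨m, x⟩ h hm
  rw [h, onSector_ne (Ne.symm hm)]

/-- The total number of points and the number of points up to `s` together determine `m` and `p`, so
products from different sectors have disjoint supports. -/
theorem mul_boxVec_ae (F : MeasurableUnitaries k) (s t : Time) {m p : ℕ} {A : Fin (2 * m) → Set ℝ}
    (hA : ∀ i, MeasurableSet (A i)) (v : Fin (2 * m) → k) {B : Fin (2 * p) → Set ℝ}
    (hB : ∀ i, MeasurableSet (B i)) (w : Fin (2 * p) → k) (hAO : Ordered s A) (hBO : Ordered t B) :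
    ∀ᵐ ω ∂configMeasure, ¬ (ω.1 = p + m ∧ countLE s ω = 2 * m) →
      fiberTwist F (s + t) (mul s t (boxVec s hA v) (boxVec t hB w)) ω = 0 := by
  classical
  rw [mul_boxVec s t hA v hB w hAO hBO]
  filter_upwards [genVec_cell_ae F (s + t) (measurableSet_concatSet s hB hA)
    (ordered_concatSet hBO hAO) (concat w v)] with ω h hω
  rw [h]
  obtain ⟨n, x⟩ := ω
  by_cases hn : p + m = n
  · subst hn
    rw [onSector_same, if_neg]
    exact fun hx => hω ⟨rfl, countLE_concatSet hBO hAO hx⟩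
  · rw [onSector_ne hn]

/-- The products of box vectors. -/
def mulBoxes (k : Type*) [NormedAddCommGroup k] [InnerProductSpace ℂ k] (s t : Time) :
    Set (Fiber k (s + t)) :=
  {z | ∃ x ∈ boxes k s, ∃ y ∈ boxes k t, z = mul s t x y}

/-- The configurations with an even number of points in `(-∞, s]`. -/
def evenAt (s : ℝ) : Set Config := {ω | Even (countLE s ω)}

theorem mulBoxes_subset (s t : Time) {z : Fiber k (s + t)} (hz : z ∈ mulBoxes k s t) :
    z ∈ fiberSupported k (s + t) (evenAt s) := by
  obtain ⟨_, ⟨m, A, hA, v, hAO, rfl⟩, _, ⟨p, B, hB, w, hBO, rfl⟩, rfl⟩ := hz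
  rw [mem_fiberSupported_iff]
  filter_upwards [mul_boxVec_ae 1 s t hA v hB w hAO hBO] with ω h hω
  refine h fun h' => hω ?_
  rw [evenAt, Set.mem_ofPred_eq, h'.2]
  exact even_two_mul m

/-- Since `x` decreases, its points above `s` form an initial segment. The length is even because
both the total and the number of remaining points are even. -/
theorem exists_split_of_even {n : ℕ} {x : Fin (2 * n) → ℝ} (hx : StrictAnti x) {s : ℝ}
    (he : (⟨n, x⟩ : Config) ∈ evenAt s) :
    ∃ p m, n = p + m ∧ ∀ i : Fin (2 * n), (i : ℕ) < 2 * p ↔ s < x i := by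
  obtain ⟨m, hm⟩ := he
  have hcard : (Finset.univ.filter fun i => x i ≤ s).card = m + m := hm
  have h4 := Finset.card_filter_add_card_filter_not (s := (Finset.univ : Finset (Fin (2 * n))))
    (fun i => x i ≤ s)
  simp only [not_le] at h4
  rw [Finset.card_univ, Fintype.card_fin] at h4
  refine ⟨n - m, m, by omega, fun i => ?_⟩
  rw [← Tuple.lt_card_gt_iff_apply_gt_of_antitone (f := x) hx.antitone]
  omega

end Products
end
end CliffordSystem

namespace CliffordSystem
noncomputable section

/-! ### The unitaries of a measurable function are multiplicative -/

section Multiplicative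
variable {k : Type*} [NormedAddCommGroup k] [InnerProductSpace ℂ k]

theorem inner_mul (s t : Time) (x x' : Fiber k s) (y y' : Fiber k t) :
    (inner ℂ (mul s t x y) (mul s t x' y') : ℂ) = inner ℂ x x' * inner ℂ y y' :=
  inner_wedgeMul _ _ (inner_inclusion_shift s t) (x : Fock (L2Interval k s)) x'
    (y : Fock (L2Interval k t)) y'

theorem norm_mul (s t : Time) (x : Fiber k s) (y : Fiber k t) : ‖mul s t x y‖ = ‖x‖ * ‖y‖ := by
  have h := inner_mul s t x x y y
  rw [inner_self_eq_norm_sq_to_K, inner_self_eq_norm_sq_to_K, inner_self_eq_norm_sq_to_K,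
    ← mul_pow] at h
  exact (sq_eq_sq₀ (norm_nonneg _) (by positivity)).1 (by exact_mod_cast h)

theorem mul_add_left (s t : Time) (x x' : Fiber k s) (y : Fiber k t) :
    mul s t (x + x') y = mul s t x y + mul s t x' y :=
  Subtype.ext <| by
    simp only [mul, Submodule.coe_add, map_add, add_apply]

theorem mul_smul_left (s t : Time) (c : ℂ) (x : Fiber k s) (y : Fiber k t) :
    mul s t (c • x) y = c • mul s t x y :=
  Subtype.ext <| by
    simp only [mul, Submodule.coe_smul, map_smul, smul_apply]

theorem mul_add_right (s t : Time) (x : Fiber k s) (y y' : Fiber k t) :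
    mul s t x (y + y') = mul s t x y + mul s t x y' :=
  Subtype.ext <| by
    simp only [mul, Submodule.coe_add, map_add]

theorem mul_smul_right (s t : Time) (c : ℂ) (x : Fiber k s) (y : Fiber k t) :
    mul s t x (c • y) = c • mul s t x y :=
  Subtype.ext <| by
    simp only [mul, Submodule.coe_smul, map_smul]

/-- The map `x ↦ U_{s,t} (x ⊗ y)`. -/
def mulRight (s t : Time) (y : Fiber k t) : Fiber k s →L[ℂ] Fiber k (s + t) :=
  LinearMap.mkContinuous
    { toFun := fun x => mul s t x y
      map_add' := fun x x' => mul_add_left s t x x' y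
      map_smul' := fun c x => mul_smul_left s t c x y } ‖y‖
    fun x => (norm_mul s t x y).le.trans (mul_comm _ _).le

/-- The map `y ↦ U_{s,t} (x ⊗ y)`. -/
def mulLeft (s t : Time) (x : Fiber k s) : Fiber k t →L[ℂ] Fiber k (s + t) :=
  LinearMap.mkContinuous
    { toFun := fun y => mul s t x y
      map_add' := fun y y' => mul_add_right s t x y y'
      map_smul' := fun c y => mul_smul_right s t c x y } ‖x‖
    fun y => (norm_mul s t x y).le

/-- Concatenation of point configurations. -/
def concatEquiv (p m : ℕ) :
    (Fin (2 * p) → ℝ) × (Fin (2 * m) → ℝ) ≃ᵐ (Fin (2 * (p + m)) → ℝ) :=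
  (MeasurableEquiv.sumPiEquivProdPi fun _ : Fin (2 * p) ⊕ Fin (2 * m) => ℝ).symm.trans
    (MeasurableEquiv.piCongrLeft (fun _ => ℝ) (finSumFinEquiv.trans (finCongr (by ring))))

theorem measurePreserving_concatEquiv (p m : ℕ) : MeasurePreserving (concatEquiv p m) :=
  (volume_measurePreserving_sumPiEquivProdPi_symm fun _ : Fin (2 * p) ⊕ Fin (2 * m) => ℝ).trans
    (volume_measurePreserving_piCongrLeft (fun _ => ℝ) (finSumFinEquiv.trans (finCongr (by ring))))

theorem concatEquiv_inl {p m : ℕ} (q : (Fin (2 * p) → ℝ) × (Fin (2 * m) → ℝ)) (i : Fin (2 * p)) :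
    concatEquiv p m q (inlIdx m i) = q.1 i := by
  have h := Equiv.piCongrLeft_apply_apply (fun _ : Fin (2 * (p + m)) => ℝ)
    (finSumFinEquiv.trans (finCongr (by ring)))
    ((MeasurableEquiv.sumPiEquivProdPi fun _ : Fin (2 * p) ⊕ Fin (2 * m) => ℝ).symm q) (Sum.inl i)
  exact h

theorem concatEquiv_inr {p m : ℕ} (q : (Fin (2 * p) → ℝ) × (Fin (2 * m) → ℝ)) (i : Fin (2 * m)) :
    concatEquiv p m q (inrIdx p i) = q.2 i := by
  have h := Equiv.piCongrLeft_apply_apply (fun _ : Fin (2 * (p + m)) => ℝ)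
    (finSumFinEquiv.trans (finCongr (by ring)))
    ((MeasurableEquiv.sumPiEquivProdPi fun _ : Fin (2 * p) ⊕ Fin (2 * m) => ℝ).symm q) (Sum.inr i)
  exact h

/-- `∏ⱼ ⟪v_{2j} ⊗ v_{2j+1}, F(|x_{2j} - x_{2j+1}|) (w_{2j} ⊗ w_{2j+1})⟫`. -/
def pairDensity (F : ℝ≥0 → TensorSquare k ≃ₗᵢ[ℂ] TensorSquare k) {n : ℕ} (v w : Fin (2 * n) → k)
    (x : Fin (2 * n) → ℝ) : ℂ :=
  ∏ j : Fin n, inner ℂ (pairTmul (v (fstIdx j)) (v (sndIdx j)))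
    (F (Real.nnabs (x (fstIdx j) - x (sndIdx j))) (pairTmul (w (fstIdx j)) (w (sndIdx j))))

theorem inner_vtensor_twistTensor (F : ℝ≥0 → TensorSquare k ≃ₗᵢ[ℂ] TensorSquare k) {n : ℕ}
    (v w : Fin (2 * n) → k) (x : Fin (2 * n) → ℝ) :
    (inner ℂ (vtensor v) (twistTensor F w x) : ℂ) = pairDensity F v w x :=
  inner_tprod _ _

/-- The first family has even length, so each pair lies entirely in one of the two families. -/
theorem pairDensity_concat (F : ℝ≥0 → TensorSquare k ≃ₗᵢ[ℂ] TensorSquare k) {p m : ℕ}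
    (v w : Fin (2 * p) → k) (v' w' : Fin (2 * m) → k)
    (q : (Fin (2 * p) → ℝ) × (Fin (2 * m) → ℝ)) :
    pairDensity F (concat v v') (concat w w') (concatEquiv p m q) =
      pairDensity F v w q.1 * pairDensity F v' w' q.2 := by
  have h1 : ∀ j : Fin p, fstIdx (Fin.castAdd m j) = inlIdx m (fstIdx j) := fun j => rfl
  have h2 : ∀ j : Fin p, sndIdx (Fin.castAdd m j) = inlIdx m (sndIdx j) := fun j => rfl
  have h3 : ∀ j : Fin m, fstIdx (Fin.natAdd p j) = inrIdx p (fstIdx j) := fun j => by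
    ext
    simp [fstIdx, inrIdx]
    ring
  have h4 : ∀ j : Fin m, sndIdx (Fin.natAdd p j) = inrIdx p (sndIdx j) := fun j => by
    ext
    simp [sndIdx, inrIdx]
    ring
  rw [pairDensity, Fin.prod_univ_add]
  simp only [h1, h2, h3, h4, concat_inl, concat_inr, concatEquiv_inl, concatEquiv_inr]
  rfl

theorem pairDensity_sub (F : ℝ≥0 → TensorSquare k ≃ₗᵢ[ℂ] TensorSquare k) {n : ℕ}
    (v w : Fin (2 * n) → k) (x : Fin (2 * n) → ℝ) (s : ℝ) :
    pairDensity F v w (x - fun _ => s) = pairDensity F v w x := by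
  simp only [pairDensity, Pi.sub_apply, sub_sub_sub_cancel_right]

/-- Fubini in the concatenated coordinates. The shift of `B` by `s` does not matter because the
density depends only on differences of coordinates. -/
theorem setIntegral_concatSet (F : ℝ≥0 → TensorSquare k ≃ₗᵢ[ℂ] TensorSquare k) (s : Time) {p m : ℕ}
    {B : Fin (2 * p) → Set ℝ} {A : Fin (2 * m) → Set ℝ} (v w : Fin (2 * p) → k) (v' w' : Fin (2 * m) → k) :
    ∫ x in Set.univ.pi (concatSet s B A), pairDensity F (concat v v') (concat w w') x =
      (∫ x in Set.univ.pi B, pairDensity F v w x) * ∫ x in Set.univ.pi A, pairDensity F v' w' x := by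
  rw [← (measurePreserving_concatEquiv p m).setIntegral_preimage_emb
    (concatEquiv p m).measurableEmbedding]
  have hpre : concatEquiv p m ⁻¹' Set.univ.pi (concatSet s B A) =
      (Set.univ.pi fun i => (fun x => x - (s : ℝ)) ⁻¹' B i) ×ˢ Set.univ.pi A := by
    ext q
    simp only [Set.mem_preimage, Set.mem_univ_pi, Set.mem_prod]
    constructor
    · intro h
      refine ⟨fun i => ?_, fun i => ?_⟩
      · have := h (inlIdx m i)
        rwa [concatEquiv_inl, concatSet, concat_inl] at this
      · have := h (inrIdx p i)
        rwa [concatEquiv_inr, concatSet, concat_inr] at this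
    · rintro ⟨h1, h2⟩
      refine forall_inl_inr (fun i => ?_) fun i => ?_
      · rw [concatEquiv_inl, concatSet, concat_inl]
        exact h1 i
      · rw [concatEquiv_inr, concatSet, concat_inr]
        exact h2 i
  rw [hpre]
  simp only [pairDensity_concat]
  refine (setIntegral_prod_mul (pairDensity F v w) (pairDensity F v' w') _ _).trans ?_
  congr 1
  have h := (measurePreserving_sub_right (volume : Measure (Fin (2 * p) → ℝ))
    fun _ => (s : ℝ)).setIntegral_preimage_emb (MeasurableEquiv.subRight _).measurableEmbedding
      (pairDensity F v w) (Set.univ.pi B)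
  simp only [pairDensity_sub] at h
  exact h

theorem inner_eq_zero_of_ae {f g : ConfigL2 k} (p : Config → Prop)
    (hf : ∀ᵐ ω ∂configMeasure, ¬ p ω → f ω = 0) (hg : ∀ᵐ ω ∂configMeasure, p ω → g ω = 0) :
    (inner ℂ f g : ℂ) = 0 := by
  rw [L2.inner_def]
  refine integral_eq_zero_of_ae ?_
  filter_upwards [hf, hg] with ω h1 h2
  by_cases h : p ω
  · rw [h2 h, inner_zero_right, Pi.zero_apply]
  · rw [h1 h, inner_zero_left, Pi.zero_apply]

variable [TopologicalSpace.SeparableSpace k]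

theorem inner_boxVec (F : MeasurableUnitaries k) (t : Time) {n : ℕ} {A B : Fin (2 * n) → Set ℝ}
    (hA : ∀ i, MeasurableSet (A i)) (hB : ∀ i, MeasurableSet (B i)) (hAO : Ordered t A)
    (hBO : Ordered t B) (v w : Fin (2 * n) → k) :
    (inner ℂ (fiberTwist 1 t (boxVec t hA v)) (fiberTwist F t (boxVec t hB w)) : ℂ) =
      ∫ x in Set.univ.pi fun i => A i ∩ B i, pairDensity F.1 v w x := by
  classical
  rw [inner_box_eq_setIntegral t hA hAO]
  have h := ae_config_iff.1 (genVec_cell_ae F t hB hBO w) n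
  have h1 : ∀ᵐ x ∂(volume.restrict (Set.univ.pi A)),
      (inner ℂ (vtensor v) (fiberTwist F t (boxVec t hB w) ⟨n, x⟩) : ℂ) =
        (Set.univ.pi B).indicator (pairDensity F.1 v w) x := by
    filter_upwards [ae_restrict_of_ae_restrict_of_subset hAO.pi_subset h] with x hx
    rw [hx, onSector_same]
    split_ifs with h2
    · rw [Set.indicator_of_mem h2, inner_vtensor_twistTensor]
    · rw [Set.indicator_of_notMem h2, inner_zero_right]
  rw [integral_congr_ae h1, setIntegral_indicator (MeasurableSet.univ_pi hB), Set.pi_inter_distrib]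

/-- Equal numbers of points reduce this to the factorisation of the integral of the density. In all
other cases both sides vanish by disjointness of supports. -/
theorem inner_fiberTwist_mul_boxes (F : MeasurableUnitaries k) (s t : Time) {x x' : Fiber k s}
    {y y' : Fiber k t} (hx : x ∈ boxes k s) (hx' : x' ∈ boxes k s) (hy : y ∈ boxes k t)
    (hy' : y' ∈ boxes k t) :
    (inner ℂ (fiberTwist 1 (s + t) (mul s t x y)) (fiberTwist F (s + t) (mul s t x' y')) : ℂ) =
      inner ℂ (fiberTwist 1 s x) (fiberTwist F s x') *
        inner ℂ (fiberTwist 1 t y) (fiberTwist F t y') := by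
  obtain ⟨m, A, hA, v, hAO, rfl⟩ := hx
  obtain ⟨p, B, hB, w, hBO, rfl⟩ := hy
  obtain ⟨m', A', hA', v', hAO', rfl⟩ := hx'
  obtain ⟨p', B', hB', w', hBO', rfl⟩ := hy'
  by_cases hm : m = m'
  · by_cases hp : p = p'
    · subst hm hp
      rw [mul_boxVec s t hA v hB w hAO hBO, mul_boxVec s t hA' v' hB' w' hAO' hBO',
        inner_boxVec F (s + t) _ _ (ordered_concatSet hBO hAO) (ordered_concatSet hBO' hAO'),
        inner_boxVec F s hA hA' hAO hAO', inner_boxVec F t hB hB' hBO hBO',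
        mul_comm (∫ x in Set.univ.pi fun i => A i ∩ A' i, pairDensity F.1 v v' x), ← setIntegral_concatSet F.1 s]
      congr 3
      ext1 i
      revert i
      refine forall_inl_inr (fun i => ?_) fun i => ?_
      · simp only [concatSet, concat_inl]
        rfl
      · simp only [concatSet, concat_inr]
    · have h1 : (inner ℂ (fiberTwist 1 t (boxVec t hB w)) (fiberTwist F t (boxVec t hB' w')) : ℂ) = 0 :=
        inner_eq_zero_of_ae (fun ω => ω.1 = p) (boxVec_ae_sector 1 t hB hBO w) <| by
          filter_upwards [boxVec_ae_sector F t hB' hBO' w'] with ω h2 h3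
          exact h2 (h3.trans_ne hp)
      rw [h1, mul_zero]
      refine inner_eq_zero_of_ae _ (mul_boxVec_ae 1 s t hA v hB w hAO hBO) ?_
      filter_upwards [mul_boxVec_ae F s t hA' v' hB' w' hAO' hBO'] with ω h2 h3
      exact h2 (by omega)
  · have h1 : (inner ℂ (fiberTwist 1 s (boxVec s hA v)) (fiberTwist F s (boxVec s hA' v')) : ℂ) = 0 :=
      inner_eq_zero_of_ae (fun ω => ω.1 = m) (boxVec_ae_sector 1 s hA hAO v) <| by
        filter_upwards [boxVec_ae_sector F s hA' hAO' v'] with ω h2 h3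
        exact h2 (h3.trans_ne hm)
    rw [h1, zero_mul]
    refine inner_eq_zero_of_ae _ (mul_boxVec_ae 1 s t hA v hB w hAO hBO) ?_
    filter_upwards [mul_boxVec_ae F s t hA' v' hB' w' hAO' hBO'] with ω h2 h3
    exact h2 (by omega)

/-- Almost every configuration avoids `s`. If it has evenly many points below `s`, it can be cut
there without breaking a pair, and all sufficiently small boxes around it are products of boxes.
Local totality concludes; together with `mul_mem_fiberSupported` this describes the closed span of
the range of `U_{s,t}`. -/
theorem mem_closure_mulBoxes (s t : Time) {y : Fiber k (s + t)}
    (hy : y ∈ fiberSupported k (s + t) (evenAt s)) :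
    y ∈ (Submodule.span ℂ (mulBoxes k s t)).topologicalClosure := by
  refine mem_closure_span (fun x hx => mulBoxes_subset s t hx) (fun h hh H => ?_) hy
  refine eq_zero_of_inner_box (s + t) Set.inter_subset_right hh fun n => ?_
  have hne : ∀ᵐ x : Fin (2 * n) → ℝ, ∀ i, x i ≠ s :=
    ae_all_iff.2 fun i => ae_eval i (Measure.ae_ne volume (s : ℝ))
  filter_upwards [ae_restrict_of_ae hne, ae_restrict_mem (measurableSet_simplex n)] with x h1 h2 h3
  obtain ⟨p, m, rfl, hpm⟩ := exists_split_of_even h2 h3.1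
  refine ⟨fun i => if (i : ℕ) < 2 * p then Set.Ioi (s : ℝ) else Set.Iio (s : ℝ), fun i => ?_,
    fun i => ?_, fun C hC u hCU hO => ?_⟩
  · dsimp only
    split_ifs
    · exact isOpen_Ioi
    · exact isOpen_Iio
  · dsimp only
    split_ifs with hi
    · exact (hpm i).1 hi
    · exact lt_of_le_of_ne (not_lt.1 fun h => hi ((hpm i).2 h)) (h1 i)
  · obtain ⟨A, hA, v, B, hB, w, hAO, hBO, he⟩ := exists_mul_eq_boxVec s t hC u hO
      (fun i => by simpa [inlIdx] using hCU (inlIdx m i))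
      (fun i => by simpa [inrIdx] using hCU (inrIdx p i))
    rw [← he]
    exact H _ ⟨_, ⟨m, A, hA, v, hAO, rfl⟩, _, ⟨p, B, hB, w, hBO, rfl⟩, rfl⟩

theorem mul_mem_fiberSupported (s t : Time) (x : Fiber k s) (y : Fiber k t) :
    mul s t x y ∈ fiberSupported k (s + t) (evenAt s) := by
  have h1 : ∀ x ∈ boxes k s, mul s t x y ∈ fiberSupported k (s + t) (evenAt s) := fun x hx => by
    refine boxes_induction (W := (fiberSupported k (s + t) (evenAt s)).comap (mulLeft s t x).toLinearMap)
      ((isClosed_fiberSupported _ _).preimage (mulLeft s t x).continuous) (fun y hy => ?_) y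
    exact mulBoxes_subset s t ⟨x, hx, y, hy, rfl⟩
  exact boxes_induction (W := (fiberSupported k (s + t) (evenAt s)).comap (mulRight s t y).toLinearMap)
    ((isClosed_fiberSupported _ _).preimage (mulRight s t y).continuous) h1 x

theorem inner_fiberUnitary (F : MeasurableUnitaries k) (t : Time) (z w : Fiber k t) :
    (inner ℂ z (fiberUnitary F t w) : ℂ) = inner ℂ (fiberTwist 1 t z) (fiberTwist F t w) :=
  inner_fiberOp F t z w

/-- The difference of the two sides lies in the closed span of products of boxes, since twisting by
`F` does not move supports. It is orthogonal to every such product because the matrix coefficients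
factorise, so it is zero. -/
theorem fiberUnitary_mul_boxes (F : MeasurableUnitaries k) (s t : Time) {x : Fiber k s}
    {y : Fiber k t} (hx : x ∈ boxes k s) (hy : y ∈ boxes k t) :
    fiberUnitary F (s + t) (mul s t x y) = mul s t (fiberUnitary F s x) (fiberUnitary F t y) := by
  set d := fiberUnitary F (s + t) (mul s t x y) - mul s t (fiberUnitary F s x) (fiberUnitary F t y)
    with hd
  have h1 : fiberUnitary F (s + t) (mul s t x y) ∈ fiberSupported k (s + t) (evenAt s) := by
    obtain ⟨m, A, hA, v, hAO, rfl⟩ := hx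
    obtain ⟨p, B, hB, w, hBO, rfl⟩ := hy
    rw [mem_fiberSupported_iff, fiberTwist_fiberUnitary]
    filter_upwards [mul_boxVec_ae F s t hA v hB w hAO hBO] with ω h hω
    refine h fun h' => hω ?_
    rw [evenAt, Set.mem_ofPred_eq, h'.2]
    exact even_two_mul m
  have h2 : d ∈ (Submodule.span ℂ (mulBoxes k s t)).topologicalClosure :=
    mem_closure_mulBoxes s t (Submodule.sub_mem _ h1 (mul_mem_fiberSupported s t _ _))
  have h3 : (Submodule.span ℂ (mulBoxes k s t)).topologicalClosure ≤
      LinearMap.ker (innerSL ℂ d).toLinearMap := by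
    refine Submodule.topologicalClosure_minimal _ (Submodule.span_le.2 ?_)
      ((innerSL ℂ d).isClosed_ker)
    rintro _ ⟨x', hx', y', hy', rfl⟩
    change (inner ℂ d (mul s t x' y') : ℂ) = 0
    rw [← inner_conj_symm, hd, inner_sub_right, inner_fiberUnitary,
      inner_fiberTwist_mul_boxes F s t hx' hx hy' hy, inner_mul, inner_fiberUnitary,
      inner_fiberUnitary, sub_self, map_zero]
  have h4 : (inner ℂ d d : ℂ) = 0 := h3 h2
  exact sub_eq_zero.1 (inner_self_eq_zero.1 h4)

theorem fiberUnitary_map_mul (F : MeasurableUnitaries k) (s t : Time) (x : Fiber k s)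
    (y : Fiber k t) :
    fiberUnitary F (s + t) (mul s t x y) = mul s t (fiberUnitary F s x) (fiberUnitary F t y) := by
  have h1 : ∀ x ∈ boxes k s,
      fiberUnitary F (s + t) (mul s t x y) = mul s t (fiberUnitary F s x) (fiberUnitary F t y) := by
    intro x hx
    refine boxes_induction (W := LinearMap.eqLocus
      ((fiberUnitary F (s + t)).toLinearEquiv.toLinearMap ∘ₗ (mulLeft s t x).toLinearMap)
      ((mulLeft s t (fiberUnitary F s x)).toLinearMap ∘ₗ (fiberUnitary F t).toLinearEquiv.toLinearMap))
      (isClosed_eq ((fiberUnitary F (s + t)).continuous.comp (mulLeft s t x).continuous)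
        ((mulLeft s t (fiberUnitary F s x)).continuous.comp (fiberUnitary F t).continuous))
      (fun y hy => ?_) y
    exact fiberUnitary_mul_boxes F s t hx hy
  exact boxes_induction (W := LinearMap.eqLocus
      ((fiberUnitary F (s + t)).toLinearEquiv.toLinearMap ∘ₗ (mulRight s t y).toLinearMap)
      ((mulRight s t (fiberUnitary F t y)).toLinearMap ∘ₗ (fiberUnitary F s).toLinearEquiv.toLinearMap))
      (isClosed_eq ((fiberUnitary F (s + t)).continuous.comp (mulRight s t y).continuous)
        ((mulRight s t (fiberUnitary F t y)).continuous.comp (fiberUnitary F s).continuous)) h1 x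

end Multiplicative
end
end CliffordSystem

namespace CliffordSystem
noncomputable section

/-! ### The homomorphism into the automorphism group -/

section Hom
variable {k : Type*} [NormedAddCommGroup k] [InnerProductSpace ℂ k]

theorem measurable_total_iff {X : Type*} [MeasurableSpace X] {f : X → TotalSpace k} :
    Measurable f ↔ (Measurable fun x => (f x).1) ∧
      Measurable[_, borel (Fock (L2Line k))] fun x =>
        ((fiberIncl (f x).1 (f x).2 : evenFock (L2Line k)) : Fock (L2Line k)) := by
  rw [measurable_iff_comap_le, measurable_iff_comap_le, measurable_iff_comap_le]
  change MeasurableSpace.comap f (_ ⊔ _) ≤ _ ↔ _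
  rw [MeasurableSpace.comap_sup, sup_le_iff, MeasurableSpace.comap_comp, MeasurableSpace.comap_comp]
  rfl

/-- Inside the Fock space over the line, `θ` is one bounded operator `V` multiplied by a measurable
scalar depending on `t`; hence the total map is measurable. -/
theorem measurable_totalMap {θ : ∀ t : Time, Fiber k t ≃ₗᵢ[ℂ] Fiber k t}
    (V : evenFock (L2Line k) →L[ℂ] evenFock (L2Line k)) {c : Time → ℂ} (hc : Measurable c)
    (h : ∀ t x, fiberIncl t (θ t x) = c t • V (fiberIncl t x)) : Measurable (totalMap θ) := by
  borelize (Fock (L2Line k))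
  have h0 := measurable_total_iff.1 (measurable_id (α := TotalSpace k))
  refine measurable_total_iff.2 ⟨h0.1, ?_⟩
  have h1 : Measurable fun p : TotalSpace k => fiberIncl p.1 p.2 := h0.2.subtype_mk
  have h2 : Measurable fun p : TotalSpace k =>
      ((V (fiberIncl p.1 p.2) : evenFock (L2Line k)) : Fock (L2Line k)) :=
    (V.continuous.measurable.comp h1).subtype_val
  have h3 : Measurable (Function.uncurry fun (a : ℂ) (p : TotalSpace k) =>
      a • ((V (fiberIncl p.1 p.2) : evenFock (L2Line k)) : Fock (L2Line k))) :=
    measurable_uncurry_of_continuous_of_measurable (fun p => by fun_prop) fun a => h2.const_smul a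
  have h4 := h3.comp ((hc.comp h0.1).prodMk measurable_id)
  have h5 : (fun p : TotalSpace k =>
      ((fiberIncl p.1 (θ p.1 p.2) : evenFock (L2Line k)) : Fock (L2Line k))) =
      fun p => c p.1 • ((V (fiberIncl p.1 p.2) : evenFock (L2Line k)) : Fock (L2Line k)) :=
    funext fun p => by rw [h, Submodule.coe_smul]
  change Measurable fun p : TotalSpace k =>
      ((fiberIncl p.1 (θ p.1 p.2) : evenFock (L2Line k)) : Fock (L2Line k))
  rw [h5]
  exact h4

/-- The scalar automorphisms `e^{iλt}`. -/
def expAut (k : Type*) [NormedAddCommGroup k] [InnerProductSpace ℂ k] : Multiplicative ℝ →* Aut k where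
  toFun l := ⟨fun t =>
    { toFun := fun x => Complex.exp (Complex.I * l.toAdd * (t : ℝ)) • x
      map_add' := smul_add _
      map_smul' := fun c x => smul_comm _ c x
      invFun := fun x => Complex.exp (-(Complex.I * l.toAdd * (t : ℝ))) • x
      left_inv := fun x => by
        dsimp only
        rw [smul_smul, ← Complex.exp_add, neg_add_cancel, Complex.exp_zero, one_smul]
      right_inv := fun x => by
        dsimp only
        rw [smul_smul, ← Complex.exp_add, add_neg_cancel, Complex.exp_zero, one_smul]
      norm_map' := fun x => by
        change ‖Complex.exp (Complex.I * l.toAdd * (t : ℝ)) • x‖ = ‖x‖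
        rw [norm_smul, mul_assoc, mul_comm, ← Complex.ofReal_mul, mul_comm Complex.I,
          Complex.norm_exp_ofReal_mul_I, mul_one] }, by
    refine ⟨fun s t x y => ?_, ?_, ?_⟩
    · change Complex.exp _ • mul s t x y = mul s t (Complex.exp _ • x) (Complex.exp _ • y)
      rw [mul_smul_left, mul_smul_right, smul_smul, ← Complex.exp_add, Positive.coe_add]
      congr 2
      push_cast
      ring
    · exact measurable_totalMap (ContinuousLinearMap.id ℂ _)
        (c := fun t => Complex.exp (Complex.I * l.toAdd * (t : ℝ)))
        (by fun_prop) fun t x => map_smul (fiberIncl t) _ x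
    · exact measurable_totalMap (ContinuousLinearMap.id ℂ _)
        (c := fun t => Complex.exp (-(Complex.I * l.toAdd * (t : ℝ))))
        (by fun_prop) fun t x => map_smul (fiberIncl t) _ x⟩
  map_one' := by
    refine Subtype.ext (funext fun t => LinearIsometryEquiv.ext fun x => ?_)
    change Complex.exp (Complex.I * ((0 : ℝ) : ℂ) * (t : ℝ)) • x = x
    simp
  map_mul' l l' := by
    refine Subtype.ext (funext fun t => LinearIsometryEquiv.ext fun x => ?_)
    change Complex.exp (Complex.I * ((l.toAdd + l'.toAdd : ℝ) : ℂ) * (t : ℝ)) • x =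
      Complex.exp _ • Complex.exp _ • x
    rw [smul_smul, ← Complex.exp_add]
    congr 2
    push_cast
    ring

theorem expAut_apply (l : ℝ) (t : Time) (x : Fiber k t) :
    (expAut k (Multiplicative.ofAdd l)).1 t x = Complex.exp (Complex.I * l * (t : ℝ)) • x := rfl

variable [TopologicalSpace.SeparableSpace k]

/-- All the unitaries `fiberUnitary F t` are restrictions of a single operator independent of `t`,
as `measurable_totalMap` requires. -/
theorem fiberIncl_fiberUnitary (F : MeasurableUnitaries k) (t : Time) (x : Fiber k t) :
    fiberIncl t (fiberUnitary F t x) =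
      ((ContinuousLinearMap.adjoint (twist 1).toContinuousLinearMap).comp
        (twist F).toContinuousLinearMap) (fiberIncl t x) := by
  refine ext_inner_left ℂ fun z => ?_
  rw [ContinuousLinearMap.comp_apply, ContinuousLinearMap.adjoint_inner_right]
  change _ = (inner ℂ (twist 1 z) (fiberTwist F t x) : ℂ)
  rw [← fiberTwist_fiberUnitary]
  exact ((twist 1).inner_map_map _ _).symm

theorem measurable_fiberUnitary (F : MeasurableUnitaries k) : Measurable (totalMap (fiberUnitary F)) :=
  measurable_totalMap _ (c := fun _ => 1) measurable_const fun t x => by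
    rw [one_smul]
    exact fiberIncl_fiberUnitary F t x

/-- The automorphisms associated with measurable families of unitaries. -/
def unitaryAut (k : Type*) [NormedAddCommGroup k] [InnerProductSpace ℂ k]
    [TopologicalSpace.SeparableSpace k] : MeasurableUnitaries k →* Aut k where
  toFun F := ⟨fiberUnitary F, fun s t x y => fiberUnitary_map_mul F s t x y,
    measurable_fiberUnitary F, measurable_fiberUnitary F⁻¹⟩
  map_one' := Subtype.ext (funext fun t => LinearIsometryEquiv.ext fun x => fiberUnitary_one t x)
  map_mul' F G :=
    Subtype.ext (funext fun t => LinearIsometryEquiv.ext fun x => fiberUnitary_mul F G t x)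

theorem unitaryAut_of_aeTrivial {F : MeasurableUnitaries k} (hF : F ∈ AeTrivial k) :
    unitaryAut k F = 1 :=
  Subtype.ext <| funext fun t => LinearIsometryEquiv.ext fun x => fiberUnitary_of_aeTrivial hF t x

theorem commute_expAut (l : Multiplicative ℝ) (F : MeasurableUnitaries k) :
    Commute (expAut k l) (unitaryAut k F) := by
  refine Subtype.ext (funext fun t => LinearIsometryEquiv.ext fun x => ?_)
  exact (map_smul (fiberUnitary F t) (Complex.exp (Complex.I * l.toAdd * (t : ℝ))) x).symm

/-- The homomorphism `(λ, F) ↦ U_{(λ, F)}`. -/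
def autHom (k : Type*) [NormedAddCommGroup k] [InnerProductSpace ℂ k]
    [TopologicalSpace.SeparableSpace k] : Multiplicative ℝ × MeasurableUnitaryGroup k →* Aut k :=
  (expAut k).noncommCoprod
    (QuotientGroup.lift (AeTrivial k) (unitaryAut k) fun _ hF => unitaryAut_of_aeTrivial hF)
    fun l F => QuotientGroup.induction_on F fun F => commute_expAut l F

theorem autHom_apply (l : ℝ) (F : MeasurableUnitaries k) (t : Time) (x : Fiber k t) :
    (autHom k (Multiplicative.ofAdd l, QuotientGroup.mk F)).1 t x =
      Complex.exp (Complex.I * l * (t : ℝ)) • fiberUnitary F t x := rfl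

theorem inner_autHom (l : ℝ) (F : MeasurableUnitaries k) (t : Time) {n : ℕ}
    (η ξ : Fin (2 * n) → L2Interval k t) :
    (inner ℂ (evenWedge t η) ((autHom k (Multiplicative.ofAdd l, QuotientGroup.mk F)).1 t
      (evenWedge t ξ)) : ℂ) = Complex.exp (Complex.I * l * (t : ℝ)) *
        pairCoeff F.1 (fun i => ⇑(η i).1) (fun i => ⇑(ξ i).1) := by
  rw [autHom_apply, inner_smul_right, inner_fiberUnitary_evenWedge]

end Hom
end
end CliffordSystem

namespace CliffordSystem
noncomputable section

/-! ### Two-point configurations, and injectivity -/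

section Pairs

/-- The shear `(r, y) ↦ (r + y, y)`. -/
def gapShear : ℝ × ℝ ≃ᵐ ℝ × ℝ where
  toFun z := (z.1 + z.2, z.2)
  invFun z := (z.1 - z.2, z.2)
  left_inv z := by simp
  right_inv z := by simp
  measurable_toFun := by
    change Measurable fun z : ℝ × ℝ => (z.1 + z.2, z.2)
    fun_prop
  measurable_invFun := by
    change Measurable fun z : ℝ × ℝ => (z.1 - z.2, z.2)
    fun_prop

/-- The two points `r + y` and `y`. -/
def gapEquiv : ℝ × ℝ ≃ᵐ (Fin (2 * 1) → ℝ) :=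
  gapShear.trans (MeasurableEquiv.finTwoArrow (α := ℝ)).symm

theorem measurePreserving_gapEquiv : MeasurePreserving gapEquiv :=
  (volume_preserving_finTwoArrow ℝ).symm.comp
    (measurePreserving_add_prod (volume : Measure ℝ) (volume : Measure ℝ))

theorem gapEquiv_zero (z : ℝ × ℝ) : gapEquiv z 0 = z.1 + z.2 := rfl

theorem gapEquiv_one (z : ℝ × ℝ) : gapEquiv z 1 = z.2 := rfl

theorem forall_fin_two_mul_one {p : Fin (2 * 1) → Prop} (h0 : p 0) (h1 : p 1) (i : Fin (2 * 1)) :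
    p i := by
  fin_cases i
  · exact h0
  · exact h1

theorem gapEquiv_mem_simplex {z : ℝ × ℝ} : gapEquiv z ∈ simplex 1 ↔ 0 < z.1 := by
  constructor
  · intro h
    have : gapEquiv z 1 < gapEquiv z 0 := h (by decide)
    rw [gapEquiv_zero, gapEquiv_one] at this
    linarith
  · intro h
    refine forall_fin_two_mul_one (fun i => ?_) fun i => ?_ <;> revert i <;>
      refine forall_fin_two_mul_one (fun hi => ?_) fun hi => ?_
    · exact absurd hi (lt_irrefl _)
    · rw [gapEquiv_zero, gapEquiv_one]
      linarith
    · exact absurd hi (by decide)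
    · exact absurd hi (lt_irrefl _)

/-- The configuration of the two points `r + y` and `y`. -/
def gapConfig (z : ℝ × ℝ) : Config := ⟨1, gapEquiv z⟩

theorem measurable_gapConfig : Measurable gapConfig :=
  (measurableEmbedding_mk 1).measurable.comp gapEquiv.measurable

theorem gapConfig_mem_window {t : Time} {z : ℝ × ℝ} (hz : 0 < z.1) :
    gapConfig z ∈ window t ↔ 0 ≤ z.2 ∧ z.1 + z.2 ≤ t := by
  constructor
  · intro h
    exact ⟨(h (1 : Fin (2 * 1))).1, (h (0 : Fin (2 * 1))).2⟩
  · rintro ⟨h1, h2⟩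
    refine forall_fin_two_mul_one ⟨?_, h2⟩ ⟨h1, ?_⟩
    · change 0 ≤ z.1 + z.2
      linarith
    · change z.2 ≤ t
      linarith

theorem ae_sector_one {p : (Fin (2 * 1) → ℝ) → Prop} : (∀ᵐ x ∂(volume.restrict (simplex 1)), p x) ↔
    ∀ᵐ z : ℝ × ℝ, 0 < z.1 → p (gapEquiv z) := by
  rw [ae_restrict_iff' (measurableSet_simplex 1), ← measurePreserving_gapEquiv.map_eq,
    gapEquiv.measurableEmbedding.ae_map_iff]
  simp only [gapEquiv_mem_simplex]

theorem ae_gap {p : Config → Prop} (h : ∀ᵐ ω ∂configMeasure, p ω) :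
    ∀ᵐ z : ℝ × ℝ, 0 < z.1 → p (gapConfig z) :=
  ae_sector_one.1 (ae_config_iff.1 h 1)

theorem ae_config_of_gap {p : Config → Prop} (h : ∀ᵐ z : ℝ × ℝ, 0 < z.1 → p (gapConfig z)) :
    ∀ᵐ ω ∂configMeasure, ω.1 = 1 → p ω := by
  rw [ae_config_iff]
  intro n
  by_cases hn : n = 1
  · subst hn
    filter_upwards [ae_sector_one (p := fun x => p ⟨1, x⟩).2 h] with x hx _
    exact hx
  · exact Filter.Eventually.of_forall fun x h => absurd h hn

/-- By Fubini, for almost every `r` the statement holds for almost every `y`. A nonempty open slice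
has positive measure, so some admissible `y` remains, and `p r` does not depend on it. -/
theorem ae_of_ae_prod_open {S : Set (ℝ × ℝ)} (hS : IsOpen S) {p : ℝ → Prop}
    (h : ∀ᵐ z : ℝ × ℝ, z ∈ S → p z.1) : ∀ᵐ r, (∃ y, (r, y) ∈ S) → p r := by
  filter_upwards [Measure.ae_ae_of_ae_prod h] with r hr
  rintro ⟨y, hy⟩
  by_contra hcon
  have h0 : volume {y | (r, y) ∈ S} = 0 := by
    refine measure_mono_null (fun y hy => ?_) (ae_iff.1 hr)
    exact fun hcon' => hcon (hcon' hy)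
  have ho : IsOpen {y | (r, y) ∈ S} := hS.preimage (by fun_prop)
  exact (ho.measure_pos volume ⟨y, hy⟩).ne' h0

variable {k : Type*} [NormedAddCommGroup k] [InnerProductSpace ℂ k]

/-- The vacuum vector `Ω_t`. -/
def vacuum (k : Type*) [NormedAddCommGroup k] [InnerProductSpace ℂ k] (t : Time) : Fiber k t :=
  evenWedge t fun i : Fin (2 * 0) => i.elim0

theorem evenWedge_zero (t : Time) (ξ : Fin (2 * 0) → L2Interval k t) : evenWedge t ξ = vacuum k t := by
  rw [vacuum]
  congr 1
  ext1 i
  exact i.elim0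

theorem norm_vacuum (t : Time) : ‖vacuum k t‖ = 1 := by
  have h : (inner ℂ (vacuum k t) (vacuum k t) : ℂ) = 1 := by
    refine (inner_wedge _ _).trans ?_
    exact Matrix.det_isEmpty (n := Fin 0)
  rw [inner_self_eq_norm_sq_to_K] at h
  have h2 : ‖vacuum k t‖ ^ 2 = 1 := Complex.ofReal_injective (by simpa using h)
  nlinarith [norm_nonneg (vacuum k t)]

theorem mul_vacuum (s t : Time) : mul s t (vacuum k s) (vacuum k t) = vacuum k (s + t) := by
  rw [vacuum, vacuum]
  exact (mul_evenWedge s t _ _).trans (evenWedge_zero _ _)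

theorem pairVec_zero (F G : ℝ≥0 → TensorSquare k ≃ₗᵢ[ℂ] TensorSquare k) (f g : Fin (2 * 0) → ℝ → k) :
    (pairVec F f : (Fin (2 * 0) → ℝ) → TensorFock k) = pairVec G g := by
  ext1 x
  rw [pairVec, pairVec]
  congr 1
  ext1 j
  exact j.elim0

variable [TopologicalSpace.SeparableSpace k]

theorem fiberUnitary_vacuum (F : MeasurableUnitaries k) (t : Time) :
    fiberUnitary F t (vacuum k t) = vacuum k t := by
  refine (fiberTwist 1 t).injective ?_
  rw [fiberTwist_fiberUnitary, vacuum, fiberTwist_evenWedge, fiberTwist_evenWedge]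
  refine MemLp.toLp_congr _ _ (Filter.Eventually.of_forall fun ω => ?_)
  congr 1
  ext1 x
  simp only [antiVec]
  refine Finset.sum_congr rfl fun τ _ => ?_
  rw [pairVec_zero F.1]

theorem fiberTwist_box_gap (F : MeasurableUnitaries k) (t : Time) {A : Fin (2 * 1) → Set ℝ}
    (hA : ∀ i, MeasurableSet (A i)) (hO : Ordered t A) (v : Fin (2 * 1) → k) :
    ∀ᵐ z : ℝ × ℝ, 0 < z.1 → (z.1 + z.2 ∈ A 0 → z.2 ∈ A 1 →
      fiberTwist F t (boxVec t hA v) (gapConfig z) =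
        tprodOne k (F.1 z.1.toNNReal (pairTmul (v 0) (v 1)))) ∧
      (¬ (z.1 + z.2 ∈ A 0 ∧ z.2 ∈ A 1) → fiberTwist F t (boxVec t hA v) (gapConfig z) = 0) := by
  classical
  filter_upwards [ae_gap (genVec_cell_ae F t hA hO v)] with z h hz
  rw [h hz, gapConfig, onSector_same]
  constructor
  · intro h0 h1
    have h2 : gapEquiv z ∈ Set.univ.pi A := fun i _ =>
      forall_fin_two_mul_one (p := fun i => gapEquiv z i ∈ A i) h0 h1 i
    rw [if_pos h2, tprodOne_apply, twistTensor]
    congr 1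
    ext1 j
    obtain rfl : j = 0 := Subsingleton.elim _ _
    have h3 : Real.nnabs (gapEquiv z (fstIdx 0) - gapEquiv z (sndIdx 0)) = z.1.toNNReal := by
      change Real.nnabs (z.1 + z.2 - z.2) = _
      rw [add_sub_cancel_right]
      exact NNReal.eq (by rw [Real.coe_nnabs, abs_of_pos hz, Real.coe_toNNReal _ hz.le])
    rw [h3]
    rfl
  · intro h1
    rw [if_neg]
    exact fun h2 => h1 ⟨h2 0 trivial, h2 1 trivial⟩

/-- The countable family of test vectors allows equality of operators to be checked almost
everywhere. -/
theorem eq_of_pairTmul {E : Type*} [NormedAddCommGroup E] [InnerProductSpace ℂ E]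
    {f g : TensorSquare k →L[ℂ] E}
    (h : ∀ i j, f (pairTmul (TopologicalSpace.denseSeq k i) (TopologicalSpace.denseSeq k j)) =
      g (pairTmul (TopologicalSpace.denseSeq k i) (TopologicalSpace.denseSeq k j))) : f = g := by
  have hd : DenseRange fun p : ℕ × ℕ =>
      (TopologicalSpace.denseSeq k p.1, TopologicalSpace.denseSeq k p.2) :=
    (TopologicalSpace.denseRange_denseSeq k).prodMap (TopologicalSpace.denseRange_denseSeq k)
  have h1 : ∀ p : k × k, f (pairTmul p.1 p.2) = g (pairTmul p.1 p.2) :=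
    congrFun (hd.equalizer (f.continuous.comp continuous_pairTmul)
      (g.continuous.comp continuous_pairTmul) (funext fun p => h p.1 p.2))
  ext κ
  induction κ using UniformSpace.Completion.induction_on with
  | hp => exact isClosed_eq f.continuous g.continuous
  | ih κ =>
    induction κ using TensorProduct.induction_on with
    | zero => rw [UniformSpace.Completion.coe_zero, map_zero, map_zero]
    | tmul v w => exact h1 (v, w)
    | add x y hx hy => rw [UniformSpace.Completion.coe_add, map_add, map_add, hx, hy]

-- Injectivity of the homomorphism.

theorem measurableSet_halves (t : ℝ) :
    ∀ i : Fin (2 * 1), MeasurableSet (![Set.Ioo (t / 2) t, Set.Ioo 0 (t / 2)] i) :=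
  forall_fin_two_mul_one measurableSet_Ioo measurableSet_Ioo

theorem ordered_halves {t : ℝ} (ht : 0 < t) :
    Ordered (N := 2 * 1) t ![Set.Ioo (t / 2) t, Set.Ioo 0 (t / 2)] := by
  refine ⟨forall_fin_two_mul_one (forall_fin_two_mul_one ?_ ?_) (forall_fin_two_mul_one ?_ ?_),
    forall_fin_two_mul_one ?_ ?_⟩
  · exact fun h => absurd h (lt_irrefl _)
  · intro _ x hx y hy
    exact hy.2.trans hx.1
  · exact fun h => absurd h (by decide)
  · exact fun h => absurd h (lt_irrefl _)
  · exact fun x hx => ⟨by linarith [hx.1], hx.2⟩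
  · exact fun x hx => ⟨hx.1, by linarith [hx.2]⟩

/-- A two-particle box vector with one particle in each half of `[0, n]` displays the value `F(r)(v
⊗ w)` at gap `r`; every gap smaller than `n` occurs there. -/
theorem aeTrivial_of_fiberUnitary {F : MeasurableUnitaries k}
    (h : ∀ t (x : Fiber k t), fiberUnitary F t x = x) : F ∈ AeTrivial k := by
  have h1 : ∀ (n : ℕ), ∀ᵐ r : ℝ, 0 < r → r < n → F.1 r.toNNReal = 1 := by
    intro n
    rcases n.eq_zero_or_pos with rfl | hn
    · exact Filter.Eventually.of_forall fun r h1 h2 => absurd (h1.trans h2) (by simp)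
    have hn' : (0 : ℝ) < n := by exact_mod_cast hn
    let t : Time := ⟨n, hn'⟩
    have h2 : ∀ᵐ z : ℝ × ℝ, ∀ i j : ℕ, z ∈ {z : ℝ × ℝ | z.1 + z.2 ∈ Set.Ioo ((n : ℝ) / 2) n ∧
        z.2 ∈ Set.Ioo 0 ((n : ℝ) / 2)} →
        F.1 z.1.toNNReal (pairTmul (TopologicalSpace.denseSeq k i) (TopologicalSpace.denseSeq k j)) =
          pairTmul (TopologicalSpace.denseSeq k i) (TopologicalSpace.denseSeq k j) := by
      simp only [ae_all_iff]
      intro i j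
      have hx := fiberTwist_fiberUnitary F t (boxVec t (measurableSet_halves n)
        ![TopologicalSpace.denseSeq k i, TopologicalSpace.denseSeq k j])
      rw [h] at hx
      filter_upwards [fiberTwist_box_gap F t (measurableSet_halves n) (ordered_halves hn')
        ![TopologicalSpace.denseSeq k i, TopologicalSpace.denseSeq k j],
        fiberTwist_box_gap 1 t (measurableSet_halves n) (ordered_halves hn')
        ![TopologicalSpace.denseSeq k i, TopologicalSpace.denseSeq k j]] with z h3 h4 hz
      have hz1 : 0 < z.1 := by linarith [hz.1.1, hz.2.2]
      have h5 := (h3 hz1).1 hz.1 hz.2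
      rw [← hx, (h4 hz1).1 hz.1 hz.2] at h5
      exact ((tprodOne k).injective h5).symm
    have h3 : ∀ᵐ z : ℝ × ℝ, z ∈ {z : ℝ × ℝ | z.1 + z.2 ∈ Set.Ioo ((n : ℝ) / 2) n ∧
        z.2 ∈ Set.Ioo 0 ((n : ℝ) / 2)} → F.1 z.1.toNNReal = 1 := by
      filter_upwards [h2] with z hz hzS
      have h4 : (F.1 z.1.toNNReal).toContinuousLinearEquiv.toContinuousLinearMap =
          ContinuousLinearMap.id ℂ (TensorSquare k) := eq_of_pairTmul fun i j => hz i j hzS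
      exact LinearIsometryEquiv.ext fun x => DFunLike.congr_fun h4 x
    have ho : IsOpen {z : ℝ × ℝ | z.1 + z.2 ∈ Set.Ioo ((n : ℝ) / 2) n ∧
        z.2 ∈ Set.Ioo 0 ((n : ℝ) / 2)} :=
      (isOpen_Ioo.preimage (continuous_fst.add continuous_snd)).inter
        (isOpen_Ioo.preimage continuous_snd)
    filter_upwards [ae_of_ae_prod_open ho (p := fun r => F.1 r.toNNReal = 1) h3] with r hr h5 h6
    refine hr ?_
    -- In both cases the witness is `y = (n - r)/2`, which places the pair symmetrically about the
    -- midpoint `n/2`.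
    rcases le_total r (n / 2) with h7 | h7
    · exact ⟨n / 2 - r / 2, ⟨by linarith, by linarith⟩,
        by linarith, by linarith⟩
    · exact ⟨(n - r) / 2, ⟨by linarith, by linarith⟩,
        by linarith, by linarith⟩
  change ∀ᵐ r : ℝ, 0 ≤ r → F.1 r.toNNReal = 1
  filter_upwards [ae_all_iff.2 h1, Measure.ae_ne volume (0 : ℝ)] with r hr hr0 hr1
  obtain ⟨n, hn⟩ := exists_nat_gt r
  exact hr n (lt_of_le_of_ne hr1 hr0.symm) hn

theorem injective_autHom : Function.Injective (autHom k) := by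
  refine (injective_iff_map_eq_one _).2 ?_
  rintro ⟨l, F⟩ h
  obtain ⟨F, rfl⟩ := QuotientGroup.mk_surjective F
  have h1 : ∀ (t : Time) (x : Fiber k t),
      Complex.exp (Complex.I * l.toAdd * (t : ℝ)) • fiberUnitary F t x = x := fun t x => by
    have := DFunLike.congr_fun (congrFun (congrArg Subtype.val h) t) x
    exact this
  have h2 : ∀ t : Time, Complex.exp (Complex.I * l.toAdd * (t : ℝ)) = 1 := fun t => by
    have h3 := h1 t (vacuum k t)
    rw [fiberUnitary_vacuum] at h3
    have h4 : vacuum k t ≠ 0 := norm_ne_zero_iff.1 (by rw [norm_vacuum]; exact one_ne_zero)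
    exact smul_left_injective ℂ h4 (h3.trans (one_smul ℂ _).symm)
  have hl : l.toAdd = 0 := by
    by_contra hl
    -- At `t = π/|λ|` the scalar is `e^{±iπ} = -1`.
    have h3 := h2 ⟨Real.pi / |l.toAdd|, div_pos Real.pi_pos (abs_pos.2 hl)⟩
    have hpi : (Real.pi : ℂ) ≠ 0 := by exact_mod_cast Real.pi_ne_zero
    rcases abs_cases l.toAdd with ⟨h4, -⟩ | ⟨h4, -⟩
    · have h5 : Complex.I * (l.toAdd : ℂ) * ((Real.pi / |l.toAdd| : ℝ) : ℂ) = Real.pi * Complex.I := by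
        rw [h4]
        have : (l.toAdd : ℂ) ≠ 0 := by exact_mod_cast hl
        push_cast
        field_simp
      rw [h5, Complex.exp_pi_mul_I] at h3
      norm_num at h3
    · have h5 : Complex.I * (l.toAdd : ℂ) * ((Real.pi / |l.toAdd| : ℝ) : ℂ) =
          -(Real.pi * Complex.I) := by
        rw [h4]
        have : (l.toAdd : ℂ) ≠ 0 := by exact_mod_cast hl
        push_cast
        field_simp
      rw [h5, Complex.exp_neg, Complex.exp_pi_mul_I] at h3
      norm_num at h3
  refine Prod.ext hl ?_
  refine (QuotientGroup.eq_one_iff F).2 (aeTrivial_of_fiberUnitary fun t x => ?_)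
  have h3 := h1 t x
  rwa [h2, one_smul] at h3

end Pairs
end
end CliffordSystem

namespace CliffordSystem
noncomputable section

/-! ### Automorphisms preserve the supports -/

section Supports

theorem map_mem_of_mem_closure_span {E E' : Type*} [NormedAddCommGroup E] [InnerProductSpace ℂ E]
    [NormedAddCommGroup E'] [InnerProductSpace ℂ E'] {X : Set E} {W : Submodule ℂ E'}
    (hW : IsClosed (W : Set E')) (f : E ≃ₗᵢ[ℂ] E') (h : ∀ x ∈ X, f x ∈ W) {y : E}
    (hy : y ∈ (Submodule.span ℂ X).topologicalClosure) : f y ∈ W :=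
  Submodule.topologicalClosure_minimal (t := W.comap f.toLinearEquiv.toLinearMap) _
    (Submodule.span_le.2 h) (hW.preimage f.continuous) hy

variable {k : Type*} [NormedAddCommGroup k] [InnerProductSpace ℂ k]

theorem aut_apply_inv (θ : Aut k) (t : Time) (x : Fiber k t) : θ.1 t ((θ⁻¹).1 t x) = x :=
  (θ.1 t).apply_symm_apply x

theorem aut_inv_apply (θ : Aut k) (t : Time) (x : Fiber k t) : (θ⁻¹).1 t (θ.1 t x) = x :=
  (θ.1 t).symm_apply_apply x

theorem aut_mul (θ : Aut k) (s t : Time) (x : Fiber k s) (y : Fiber k t) :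
    θ.1 (s + t) (mul s t x y) = mul s t (θ.1 s x) (θ.1 t y) :=
  θ.2.1 s t x y

theorem measurable_countLE (s : ℝ) (n : ℕ) : Measurable fun x : Fin (2 * n) → ℝ => countLE s ⟨n, x⟩ := by
  have h : (fun x : Fin (2 * n) → ℝ => countLE s ⟨n, x⟩) =
      fun x => ∑ i, if x i ≤ s then 1 else 0 := by
    ext x
    rw [Finset.sum_boole]
    rfl
  rw [h]
  refine Finset.measurable_sum _ fun i _ => Measurable.ite ?_ measurable_const measurable_const
  exact measurableSet_le (measurable_pi_apply i) measurable_const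

theorem measurableSet_evenAt (s : ℝ) : MeasurableSet (evenAt s) :=
  measurableSet_config.2 fun n => measurable_countLE s n (MeasurableSet.of_discrete (s := {m | Even m}))

/-- The parities of the number of points in `(-∞, q]` for rational `q`. -/
def parity (ω : Config) : ℚ → Bool := fun q => decide (Even (countLE q ω))

theorem exists_gap {N : ℕ} (x : Fin N → ℝ) (r : ℝ) :
    ∃ ε > 0, ∀ i, x i ≠ r → ε < |x i - r| := by
  have h1 : ∀ i, ∀ᶠ ε in nhdsWithin (0 : ℝ) (Set.Ioi 0), x i ≠ r → ε < |x i - r| := by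
    intro i
    by_cases hi : x i = r
    · exact Filter.Eventually.of_forall fun ε h => absurd hi h
    · have : 0 < |x i - r| := abs_pos.2 (sub_ne_zero.2 hi)
      filter_upwards [nhdsWithin_le_nhds (Iio_mem_nhds this)] with ε hε _
      exact hε
  obtain ⟨ε, h2, h3⟩ := ((Filter.eventually_all.2 h1).and self_mem_nhdsWithin).exists
  exact ⟨ε, h3, h2⟩

/-- Crossing a point changes the count by exactly one, so the parity flips there; near any other
position the count is constant. -/
theorem mem_range_iff_parity {n : ℕ} {x : Fin (2 * n) → ℝ} (hx : Function.Injective x) (r : ℝ) :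
    r ∈ Set.range x ↔ ∀ ε > 0, ∃ p q : ℚ, (p : ℝ) ∈ Set.Ioo (r - ε) r ∧ (q : ℝ) ∈ Set.Ioo r (r + ε) ∧
      parity ⟨n, x⟩ p ≠ parity ⟨n, x⟩ q := by
  obtain ⟨δ, hδ, hsep⟩ := exists_gap x r
  constructor
  · rintro ⟨i, rfl⟩ ε hε
    obtain ⟨p, hp1, hp2⟩ := exists_rat_btwn (show x i - min ε δ < x i by linarith [lt_min hε hδ])
    obtain ⟨q, hq1, hq2⟩ := exists_rat_btwn (show x i < x i + min ε δ by linarith [lt_min hε hδ])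
    have hl := min_le_left ε δ
    have hr := min_le_right ε δ
    refine ⟨p, q, ⟨by linarith, hp2⟩, ⟨hq1, by linarith⟩, ?_⟩
    have h1 : (Finset.univ.filter fun j => x j ≤ q) =
        insert i (Finset.univ.filter fun j => x j ≤ p) := by
      ext j
      simp only [Finset.mem_filter, Finset.mem_univ, true_and, Finset.mem_insert]
      by_cases hj : j = i
      · subst hj
        simp [hq1.le]
      · have h2 := hsep j fun h => hj (hx h)
        simp only [hj, false_or]
        constructor <;> intro h3
        · by_contra h4
          rw [not_le] at h4
          rcases abs_cases (x j - x i) with h5 | h5 <;> linarith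
        · linarith
    have h2 : countLE q ⟨n, x⟩ = countLE p ⟨n, x⟩ + 1 := by
      change (Finset.univ.filter fun j => x j ≤ q).card = (Finset.univ.filter fun j => x j ≤ p).card + 1
      rw [h1, Finset.card_insert_of_notMem]
      simp [hp2]
    simp only [parity, h2, ne_eq, decide_eq_decide, Nat.even_add_one]
    tauto
  · intro h
    obtain ⟨p, q, hp, hq, hpq⟩ := h δ hδ
    by_contra hr
    refine hpq ?_
    have h2 : countLE p ⟨n, x⟩ = countLE q ⟨n, x⟩ := by
      change (Finset.univ.filter fun j => x j ≤ p).card = (Finset.univ.filter fun j => x j ≤ q).card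
      congr 1
      ext j
      simp only [Finset.mem_filter, Finset.mem_univ, true_and]
      have h3 := hsep j fun h => hr ⟨j, h⟩
      constructor <;> intro h4
      · linarith [hp.2, hq.1]
      · by_contra h5
        rw [not_le] at h5
        rcases abs_cases (x j - r) with h6 | h6 <;> linarith [hp.1, hq.2]
    simp only [parity, h2]

/-- The parities recover the set of points, and a decreasing enumeration is determined by its range.
-/
theorem parity_injective {n m : ℕ} {x : Fin (2 * n) → ℝ} {y : Fin (2 * m) → ℝ} (hx : StrictAnti x)
    (hy : StrictAnti y) (h : parity ⟨n, x⟩ = parity ⟨m, y⟩) : (⟨n, x⟩ : Config) = ⟨m, y⟩ := by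
  have hr : Set.range x = Set.range y := by
    ext r
    rw [mem_range_iff_parity hx.injective, mem_range_iff_parity hy.injective, h]
  have hnm : n = m := by
    have h1 : (Set.range x).ncard = (Set.range y).ncard := by rw [hr]
    rw [Set.ncard_range_of_injective hx.injective, Set.ncard_range_of_injective hy.injective,
      Nat.card_eq_fintype_card, Nat.card_eq_fintype_card, Fintype.card_fin, Fintype.card_fin] at h1
    omega
  subst hnm
  have h2 : (fun i => -x i) = fun i => -y i := by
    refine (StrictMono.range_inj (f := fun i => -x i) (g := fun i => -y i)
      (fun i j hij => neg_lt_neg (hx hij)) fun i j hij => neg_lt_neg (hy hij)).1 ?_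
    have h3 := congrArg (fun s : Set ℝ => Neg.neg '' s) hr
    simp only [← Set.range_comp] at h3
    exact h3
  congr 1
  ext1 i
  exact neg_injective (congrFun h2 i)

theorem supported_indicator {C D : Set Config} {f g : ConfigL2 k} (hf : f ∈ supported k D)
    (hg : ∀ᵐ ω ∂configMeasure, g ω = C.indicator f ω) : g ∈ supported k (C ∩ D) := by
  rw [mem_supported] at hf ⊢
  filter_upwards [hf, hg] with ω h1 h2
  rw [h2]
  by_cases h : ω ∈ C
  · rw [Set.indicator_of_mem h]
    exact ⟨h1.1, fun h3 => h1.2 fun h4 => h3 ⟨h, h4⟩⟩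
  · rw [Set.indicator_of_notMem h]
    exact ⟨Submodule.zero_mem _, fun _ => rfl⟩

variable [TopologicalSpace.SeparableSpace k]

theorem fiberSupported_congr {C D : Set Config} (h : ∀ᵐ ω ∂configMeasure, ω ∈ C ↔ ω ∈ D) {t : Time}
    {x : Fiber k t} : x ∈ fiberSupported k t C ↔ x ∈ fiberSupported k t D := by
  rw [mem_fiberSupported_iff, mem_fiberSupported_iff]
  refine Filter.eventually_congr ?_
  filter_upwards [h] with ω hω
  rw [hω]

/-- Multiplication by `1_C` keeps functions supported in the window, and every such function comes
from a vector of the fibre. -/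
theorem exists_restrict {C : Set Config} (hC : MeasurableSet C) {t : Time} (x : Fiber k t) :
    ∃ y ∈ fiberSupported k t C, x - y ∈ fiberSupported k t Cᶜ ∧
      ∀ᵐ ω ∂configMeasure, fiberTwist 1 t y ω = C.indicator (fiberTwist 1 t x) ω := by
  have hm : MemLp (C.indicator (fiberTwist 1 t x)) 2 configMeasure := (Lp.memLp _).indicator hC
  have hg := hm.coeFn_toLp
  have h1 := supported_indicator (fiberTwist_mem 1 t x) hg
  obtain ⟨y, hy⟩ := exists_fiberTwist_eq t (f := hm.toLp _) (by
    rw [mem_supported] at h1 ⊢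
    exact h1.mono fun ω h => ⟨h.1, fun h2 => h.2 fun h3 => h2 h3.2⟩)
  have h2 : ∀ᵐ ω ∂configMeasure, fiberTwist 1 t y ω = C.indicator (fiberTwist 1 t x) ω := by
    rw [hy]
    exact hg
  refine ⟨y, ?_, ?_, h2⟩
  · rw [mem_fiberSupported_iff]
    filter_upwards [h2] with ω h3 h4
    rw [h3, Set.indicator_of_notMem h4]
  · rw [mem_fiberSupported_iff, map_sub]
    filter_upwards [h2, Lp.coeFn_sub (fiberTwist 1 t x) (fiberTwist 1 t y)] with ω h3 h4 h5
    rw [h4, Pi.sub_apply, h3, Set.indicator_of_mem (Set.notMem_compl_iff.1 h5), sub_self]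

theorem inner_eq_zero_of_supported {C : Set Config} {t : Time} {x y : Fiber k t}
    (hx : x ∈ fiberSupported k t C) (hy : y ∈ fiberSupported k t Cᶜ) : (inner ℂ x y : ℂ) = 0 := by
  rw [← LinearIsometry.inner_map_map (fiberTwist 1 t)]
  refine inner_eq_zero_of_ae (fun ω => ω ∈ C) ((mem_fiberSupported_iff).1 hx) ?_
  filter_upwards [(mem_fiberSupported_iff).1 hy] with ω h1 h2
  exact h1 fun h3 => h3 h2

theorem mem_fiberSupported_compl {C : Set Config} (hC : MeasurableSet C) {t : Time} {x : Fiber k t}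
    (h : ∀ y ∈ fiberSupported k t C, (inner ℂ y x : ℂ) = 0) : x ∈ fiberSupported k t Cᶜ := by
  obtain ⟨y, hy, hxy, -⟩ := exists_restrict hC x
  have h1 : (inner ℂ y y : ℂ) = 0 := by
    have h2 := inner_eq_zero_of_supported hy hxy
    rwa [inner_sub_right, h y hy, zero_sub, neg_eq_zero] at h2
  rw [inner_self_eq_zero.1 h1, sub_zero] at hxy
  exact hxy

/-- Every automorphism maps the vectors supported in `C` to vectors supported in `C`. -/
def Preserved (k : Type*) [NormedAddCommGroup k] [InnerProductSpace ℂ k]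
    [TopologicalSpace.SeparableSpace k] (C : Set Config) : Prop :=
  ∀ (θ : Aut k) (t : Time), ∀ x ∈ fiberSupported k t C, θ.1 t x ∈ fiberSupported k t C

/-- A unitary under which a subspace is invariant together with its inverse also preserves the
orthogonal complement. The quantification over all automorphisms provides the inverse. -/
theorem Preserved.compl {C : Set Config} (hC : MeasurableSet C) (h : Preserved k C) :
    Preserved k Cᶜ := by
  intro θ t x hx
  refine mem_fiberSupported_compl hC fun y hy => ?_
  rw [← aut_apply_inv θ t y, LinearIsometryEquiv.inner_map_map]
  exact inner_eq_zero_of_supported (h θ⁻¹ t y hy) hx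

theorem Preserved.iInter {C : ℕ → Set Config} (h : ∀ n, Preserved k (C n)) :
    Preserved k (⋂ n, C n) := by
  have h1 : ∀ t (x : Fiber k t), x ∈ fiberSupported k t (⋂ n, C n) ↔
      ∀ n, x ∈ fiberSupported k t (C n) := by
    intro t x
    simp only [mem_fiberSupported_iff]
    rw [← ae_all_iff]
    refine Filter.eventually_congr (Filter.Eventually.of_forall fun ω => ?_)
    simp only [Set.mem_iInter, not_forall]
    exact ⟨fun h2 n hn => h2 ⟨n, hn⟩, fun h2 ⟨n, hn⟩ => h2 n hn⟩
  intro θ t x hx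
  rw [h1] at hx ⊢
  exact fun n => h n θ t x (hx n)

/-- For `0 < s < t` this space is the closed span of products `U_{s,t-s}(y ⊗ z)`, and `θ` maps
products to products. For other `s` the parity condition holds almost everywhere in the window. -/
theorem preserved_evenAt (s : ℝ) : Preserved k (evenAt s) := by
  intro θ t x hx
  have hpos : ∀ᵐ ω ∂configMeasure, ω ∈ window t → ∀ i, ω.2 i ∈ Set.Ioo (0 : ℝ) t :=
    ae_config_iff.2 (ae_mem_Ioo t)
  rcases le_or_gt s 0 with h0 | h0
  · rw [mem_fiberSupported_iff]
    filter_upwards [hpos, mem_supported.1 (fiberTwist_mem 1 t (θ.1 t x))] with ω h1 h2 h3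
    refine h2.2 fun h4 => h3 ?_
    have h5 : countLE s ω = 0 := by
      rw [countLE, Finset.card_eq_zero, Finset.filter_eq_empty_iff]
      exact fun i _ => not_le.2 (h0.trans_lt (h1 h4 i).1)
    rw [evenAt, Set.mem_ofPred_eq, h5]
    exact Even.zero
  rcases le_or_gt (t : ℝ) s with h1 | h1
  · rw [mem_fiberSupported_iff]
    filter_upwards [mem_supported.1 (fiberTwist_mem 1 t (θ.1 t x))] with ω h2 h3
    refine h2.2 fun h4 => h3 ?_
    have h5 : countLE s ω = 2 * ω.1 := by
      rw [countLE, Finset.filter_true_of_mem fun i _ => (h4 i).2.trans h1, Finset.card_univ,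
        Fintype.card_fin]
    rw [evenAt, Set.mem_ofPred_eq, h5]
    exact even_two_mul _
  obtain ⟨s', t', hs, rfl⟩ : ∃ s' t' : Time, (s' : ℝ) = s ∧ t = s' + t' :=
    ⟨⟨s, h0⟩, ⟨t - s, by linarith⟩, rfl, Subtype.ext (by rw [Positive.coe_add]; simp)⟩
  subst hs
  have h2 : ∀ w ∈ mulBoxes k s' t', θ.1 (s' + t') w ∈ fiberSupported k (s' + t') (evenAt s') := by
    rintro _ ⟨y, -, z, -, rfl⟩
    rw [aut_mul]
    exact mul_mem_fiberSupported s' t' _ _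
  exact map_mem_of_mem_closure_span (isClosed_fiberSupported _ _) (θ.1 (s' + t')) h2
    (mem_closure_mulBoxes s' t' hx)

/-- The `σ`-algebra of preserved sets. -/
@[reducible]
def preservedSpace (k : Type*) [NormedAddCommGroup k] [InnerProductSpace ℂ k]
    [TopologicalSpace.SeparableSpace k] : MeasurableSpace Config where
  MeasurableSet' C := MeasurableSet C ∧ Preserved k C
  measurableSet_empty := ⟨MeasurableSet.empty, fun θ t x hx => by
    rw [mem_fiberSupported_iff] at hx
    have h0 : x = 0 := (fiberTwist 1 t).injective <| by
      rw [map_zero, Lp.eq_zero_iff_ae_eq_zero]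
      exact hx.mono fun ω h => h (Set.notMem_empty ω)
    rw [h0, map_zero]
    exact Submodule.zero_mem _⟩
  measurableSet_compl C hC := ⟨hC.1.compl, hC.2.compl hC.1⟩
  measurableSet_iUnion C hC := ⟨MeasurableSet.iUnion fun n => (hC n).1, by
    have h1 : Preserved k (⋂ n, (C n)ᶜ) := Preserved.iInter fun n => (hC n).2.compl (hC n).1
    have h2 := h1.compl (MeasurableSet.iInter fun n => (hC n).1.compl)
    rwa [Set.compl_iInter, funext fun n => compl_compl (C n)] at h2⟩

/-- `parity` is measurable for the σ-algebra of preserved sets and injective on decreasing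
configurations. The Lusin–Souslin theorem makes the image `B` of `C` Borel, and `C` coincides almost
everywhere with its preserved preimage. -/
theorem preserved_of_measurableSet {C : Set Config} (hC : MeasurableSet C) : Preserved k C := by
  have hp : Measurable[preservedSpace k] parity := by
    refine @measurable_pi_lambda _ _ _ (preservedSpace k) _ _ fun q => ?_
    refine @measurable_to_bool _ (preservedSpace k) _ ?_
    have h1 : (fun ω => parity ω q) ⁻¹' {true} = evenAt q := by
      ext ω
      simp [parity, evenAt]
    rw [h1]
    exact ⟨measurableSet_evenAt q, preserved_evenAt q⟩
  have hle : preservedSpace k ≤ (inferInstance : MeasurableSpace Config) := fun s hs => hs.1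
  have hp' : Measurable parity := hp.mono hle le_rfl
  let B : Set (ℚ → Bool) := ⋃ n, (fun x => parity ⟨n, x⟩) '' (sector n ⁻¹' C ∩ simplex n)
  have hB : MeasurableSet B := by
    refine MeasurableSet.iUnion fun n => ?_
    refine MeasurableSet.image_of_measurable_injOn
      ((measurableSet_config.1 hC n).inter (measurableSet_simplex n))
      (hp'.comp (measurableEmbedding_mk n).measurable) ?_
    intro x hx y hy hxy
    exact sigma_mk_injective (parity_injective hx.2 hy.2 hxy)
  have h1 : ∀ᵐ ω ∂configMeasure, ω ∈ parity ⁻¹' B ↔ ω ∈ C := by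
    rw [ae_config_iff]
    intro n
    filter_upwards [ae_restrict_mem (measurableSet_simplex n)] with x hx
    constructor
    · intro h
      obtain ⟨m, y, hy, hxy⟩ := Set.mem_iUnion.1 h
      have h2 := parity_injective hy.2 hx hxy
      rw [← h2]
      exact hy.1
    · exact fun h => Set.mem_iUnion.2 ⟨n, x, ⟨h, hx⟩, rfl⟩
  intro θ t x hx
  rw [← fiberSupported_congr h1] at hx ⊢
  exact (hp hB).2 θ t x hx

/-- Automorphisms commute with multiplication by `1_C`: the parts of `x` inside and outside `C` keep
their supports. -/
theorem aut_restrict (θ : Aut k) {C : Set Config} (hC : MeasurableSet C) {t : Time} {x y : Fiber k t}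
    (h : ∀ᵐ ω ∂configMeasure, fiberTwist 1 t y ω = C.indicator (fiberTwist 1 t x) ω) :
    ∀ᵐ ω ∂configMeasure, fiberTwist 1 t (θ.1 t y) ω = C.indicator (fiberTwist 1 t (θ.1 t x)) ω := by
  have h1 : y ∈ fiberSupported k t C := by
    rw [mem_fiberSupported_iff]
    filter_upwards [h] with ω h1 h2
    rw [h1, Set.indicator_of_notMem h2]
  have h2 : x - y ∈ fiberSupported k t Cᶜ := by
    rw [mem_fiberSupported_iff, map_sub]
    filter_upwards [h, Lp.coeFn_sub (fiberTwist 1 t x) (fiberTwist 1 t y)] with ω h3 h4 h5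
    rw [h4, Pi.sub_apply, h3, Set.indicator_of_mem (Set.notMem_compl_iff.1 h5), sub_self]
  have h3 := (mem_fiberSupported_iff).1 (preserved_of_measurableSet hC θ t y h1)
  have h4 := (mem_fiberSupported_iff).1 (preserved_of_measurableSet hC.compl θ t _ h2)
  rw [map_sub, map_sub] at h4
  filter_upwards [h3, h4, Lp.coeFn_sub (fiberTwist 1 t (θ.1 t x)) (fiberTwist 1 t (θ.1 t y))]
    with ω h5 h6 h7
  by_cases h8 : ω ∈ C
  · have h9 := h6 fun h => h h8
    rw [h7, Pi.sub_apply, sub_eq_zero] at h9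
    rw [Set.indicator_of_mem h8, h9]
  · rw [h5 h8, Set.indicator_of_notMem h8]

/-- The integral over any `C` of the pointwise inner product is an inner product with a restricted
vector, and restriction commutes with the unitary `θ`. Equality of all these integrals gives
equality almost everywhere. -/
theorem aut_inner_ae (θ : Aut k) (t : Time) (x y : Fiber k t) : ∀ᵐ ω ∂configMeasure,
    (inner ℂ (fiberTwist 1 t (θ.1 t x) ω) (fiberTwist 1 t (θ.1 t y) ω) : ℂ) =
      inner ℂ (fiberTwist 1 t x ω) (fiberTwist 1 t y ω) := by
  have hint : ∀ a b : Fiber k t, Integrable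
      (fun ω => (inner ℂ (fiberTwist 1 t a ω) (fiberTwist 1 t b ω) : ℂ)) configMeasure :=
    fun a b => L2.integrable_inner _ _
  have hset : ∀ {C : Set Config}, MeasurableSet C → ∀ a a' b : Fiber k t,
      (∀ᵐ ω ∂configMeasure, fiberTwist 1 t a' ω = C.indicator (fiberTwist 1 t a) ω) →
      ∫ ω in C, (inner ℂ (fiberTwist 1 t a ω) (fiberTwist 1 t b ω) : ℂ) ∂configMeasure =
        inner ℂ a' b := by
    intro C hC a a' b h
    rw [← LinearIsometry.inner_map_map (fiberTwist 1 t), L2.inner_def, ← integral_indicator hC]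
    refine integral_congr_ae ?_
    filter_upwards [h] with ω h1
    rw [h1]
    by_cases h2 : ω ∈ C
    · rw [Set.indicator_of_mem h2, Set.indicator_of_mem h2]
    · rw [Set.indicator_of_notMem h2, Set.indicator_of_notMem h2, inner_zero_left]
  refine Integrable.ae_eq_of_forall_setIntegral_eq _ _ (hint _ _) (hint _ _) fun C hC _ => ?_
  obtain ⟨z, -, -, hz⟩ := exists_restrict hC x
  rw [hset hC _ _ _ hz, hset hC _ _ _ (aut_restrict θ hC hz), LinearIsometryEquiv.inner_map_map]

end Supports
end
end CliffordSystem

namespace CliffordSystem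
noncomputable section

/-! ### Measurable characters and translation invariant functions -/

section Analysis

/-- With `G` the primitive of `d`, multiplicativity gives `d(t) G(a) = G(t + a) - G(t)`. Hence `d`
is continuous, then differentiable, with `d' = βd`. The constant `d(t) e^{-βt}` is idempotent and
nonzero, and `|d| = 1` makes `β` imaginary. -/
theorem exists_exp_of_measurable {d : ℝ → ℂ} (hd : Measurable d) (hb : ∀ t, ‖d t‖ ≤ 1)
    (h1 : ∀ t, 0 < t → ‖d t‖ = 1) (hm : ∀ s t, 0 < s → 0 < t → d (s + t) = d s * d t) :
    ∃ l : ℝ, ∀ t, 0 < t → d t = Complex.exp (Complex.I * l * t) := by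
  have hint : ∀ a b : ℝ, IntervalIntegrable d volume a b := fun a b =>
    (intervalIntegrable_const (c := (1 : ℝ))).mono_fun hd.aestronglyMeasurable
      (Filter.Eventually.of_forall fun t => by simpa using hb t)
  have hloc : LocallyIntegrable d volume := by
    refine LocallyIntegrable.mono (g := d) (f := fun _ => (1 : ℝ)) (locallyIntegrable_const 1)
      hd.aestronglyMeasurable (Filter.Eventually.of_forall fun t => by simpa using hb t)
  -- If the primitive vanished on `(0, ∞)`, Lebesgue differentiation would give `d = 0` almost
  -- everywhere there, against `|d| = 1`.
  obtain ⟨a, ha, hGa⟩ : ∃ a, 0 < a ∧ ∫ x in (0 : ℝ)..a, d x ≠ 0 := by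
    by_contra! hcon
    have h2 : ∀ᵐ x : ℝ, x ∉ Set.Ioi (0 : ℝ) := by
      filter_upwards [LocallyIntegrable.ae_hasDerivAt_integral hloc] with x hx hx0
      have h3 := hx 0
      have h4 : HasDerivAt (fun u => ∫ y in (0 : ℝ)..u, d y) 0 x := by
        refine (hasDerivAt_const x (0 : ℂ)).congr_of_eventuallyEq ?_
        filter_upwards [Ioi_mem_nhds hx0] with u hu
        exact hcon u hu
      have h5 := h1 x hx0
      rw [h3.unique h4, norm_zero] at h5
      exact zero_ne_one h5
    have h3 : volume (Set.Ioi (0 : ℝ)) = 0 := measure_eq_zero_iff_ae_notMem.2 h2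
    simp at h3
  set G : ℝ → ℂ := fun u => ∫ x in (0 : ℝ)..u, d x with hG
  have hGc : Continuous G := intervalIntegral.continuous_primitive hint 0
  have key : ∀ t, 0 < t → d t = (G (t + a) - G t) / G a := by
    intro t ht
    rw [eq_div_iff hGa]
    have h2 : G (t + a) - G t = ∫ x in t..(t + a), d x :=
      intervalIntegral.integral_interval_sub_left (hint _ _) (hint _ _)
    have h3 : ∫ x in t..(t + a), d x = ∫ x in (0 : ℝ)..a, d (x + t) := by
      rw [intervalIntegral.integral_comp_add_right, zero_add, add_comm]
    have h4 : ∫ x in (0 : ℝ)..a, d (x + t) = ∫ x in (0 : ℝ)..a, d t * d x := by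
      refine intervalIntegral.integral_congr_ae (Filter.Eventually.of_forall fun x hx => ?_)
      rw [Set.uIoc_of_le ha.le] at hx
      rw [hm x t hx.1 ht, mul_comm]
    rw [h2, h3, h4, intervalIntegral.integral_const_mul]
  have hcont : ∀ t, 0 < t → ContinuousAt d t := by
    intro t ht
    have h2 : ContinuousAt (fun t => (G (t + a) - G t) / G a) t := by
      have : Continuous fun t => (G (t + a) - G t) / G a := by fun_prop
      exact this.continuousAt
    refine h2.congr ?_
    filter_upwards [Ioi_mem_nhds ht] with u hu
    exact (key u hu).symm
  have hGd : ∀ t, 0 < t → HasDerivAt G (d t) t := fun t ht =>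
    intervalIntegral.integral_hasDerivAt_right (hint 0 t)
      hd.stronglyMeasurable.stronglyMeasurableAtFilter (hcont t ht)
  set β : ℂ := (d a - 1) / G a with hβ
  have hdd : ∀ t, 0 < t → HasDerivAt d (β * d t) t := by
    intro t ht
    have h2 : HasDerivAt (fun u => (G (u + a) - G u) / G a) ((d (t + a) - d t) / G a) t :=
      (((hGd (t + a) (by linarith)).comp_add_const t a).sub (hGd t ht)).div_const _
    have h3 : (d (t + a) - d t) / G a = β * d t := by
      rw [hm t a ht ha, hβ]
      ring
    rw [h3] at h2
    refine h2.congr_of_eventuallyEq ?_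
    filter_upwards [Ioi_mem_nhds ht] with u hu
    exact key u hu
  have hexp : ∀ t : ℝ, HasDerivAt (fun u : ℝ => Complex.exp (-β * u)) (Complex.exp (-β * t) * (-β)) t := by
    intro t
    have h2 : HasDerivAt (fun u : ℝ => -β * (u : ℂ)) (-β) t := by
      simpa using (Complex.ofRealCLM.hasDerivAt (x := t)).const_mul (-β)
    exact h2.cexp
  have hprod : ∀ t, 0 < t → HasDerivAt (fun u : ℝ => d u * Complex.exp (-β * u)) 0 t := by
    intro t ht
    have h2 := (hdd t ht).mul (hexp t)
    have h3 : β * d t * Complex.exp (-β * t) + d t * (Complex.exp (-β * t) * -β) = 0 := by ring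
    rwa [h3] at h2
  have hC : ∀ t, 0 < t → d t * Complex.exp (-β * t) = d 1 * Complex.exp (-β * (1 : ℝ)) := by
    intro t ht
    refine IsOpen.is_const_of_deriv_eq_zero (f := fun u : ℝ => d u * Complex.exp (-β * u))
      isOpen_Ioi isPreconnected_Ioi
      (fun u hu => (hprod u hu).differentiableAt.differentiableWithinAt)
      (fun u hu => (hprod u hu).deriv) ht (Set.mem_Ioi.2 one_pos)
  set C := d 1 * Complex.exp (-β * (1 : ℝ)) with hCdef
  have hC0 : C ≠ 0 := mul_ne_zero (norm_ne_zero_iff.1 (by rw [h1 1 one_pos]; exact one_ne_zero))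
    (Complex.exp_ne_zero _)
  have hCC : C * C = C := by
    have h2 := hC (1 + 1) (by norm_num)
    rw [hm 1 1 one_pos one_pos] at h2
    have h3 : Complex.exp (-β * ((1 + 1 : ℝ) : ℂ)) =
        Complex.exp (-β * (1 : ℝ)) * Complex.exp (-β * (1 : ℝ)) := by
      rw [← Complex.exp_add]
      congr 1
      push_cast
      ring
    rw [h3, mul_mul_mul_comm] at h2
    exact h2
  have hC1 : C = 1 := mul_left_cancel₀ hC0 (by rw [hCC, mul_one])
  have hfin : ∀ t, 0 < t → d t = Complex.exp (β * t) := by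
    intro t ht
    have h2 := hC t ht
    rw [hC1, neg_mul, Complex.exp_neg] at h2
    exact eq_of_mul_inv_eq_one (by simpa using h2)
  have hre : β.re = 0 := by
    have h2 := h1 1 one_pos
    rw [hfin 1 one_pos, Complex.norm_exp, Complex.ofReal_one, mul_one] at h2
    exact Real.exp_eq_one_iff _ |>.1 h2
  refine ⟨β.im, fun t ht => ?_⟩
  rw [hfin t ht]
  congr 2
  refine Complex.ext ?_ ?_ <;> simp [hre]

/-- The null set in the hypothesis depends on `s`. Two uses of Fubini produce one height `y` with
`ψ(r, y) = ψ(r, y')` for almost every `(r, y')` with `0 < y' < y`, and `γ = ψ(·, y)`. -/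
theorem exists_gap_function {E : Type*} [TopologicalSpace E] [T2Space E] [SecondCountableTopology E]
    [MeasurableSpace E] [OpensMeasurableSpace E] {ψ : ℝ × ℝ → E} (hψ : Measurable ψ)
    (h : ∀ s, 0 < s → ∀ᵐ z : ℝ × ℝ, 0 < z.1 → 0 < z.2 → ψ (z.1, z.2 + s) = ψ z) :
    ∃ γ : ℝ → E, Measurable γ ∧ ∀ᵐ z : ℝ × ℝ, 0 < z.1 → 0 < z.2 → ψ z = γ z.1 := by
  have himp : ∀ {X : Type} [MeasurableSpace X] {p q : X → Prop}, MeasurableSet {x | p x} →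
      MeasurableSet {x | q x} → MeasurableSet {x | p x → q x} := by
    intro X _ p q hp hq
    have : {x | p x → q x} = {x | p x}ᶜ ∪ {x | q x} := by
      ext x
      simp [imp_iff_not_or]
    rw [this]
    exact hp.compl.union hq
  have h1 : ∀ᵐ s : ℝ, ∀ᵐ z : ℝ × ℝ, 0 < s → 0 < z.1 → 0 < z.2 → ψ (z.1, z.2 + s) = ψ z := by
    refine Filter.Eventually.of_forall fun s => ?_
    by_cases hs : 0 < s
    · filter_upwards [h s hs] with z hz _
      exact hz
    · exact Filter.Eventually.of_forall fun z hs' => absurd hs' hs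
  rw [Measure.ae_ae_comm] at h1
  swap
  · refine himp (measurableSet_lt (by fun_prop) (by fun_prop)) <|
      himp (measurableSet_lt (by fun_prop) (by fun_prop)) <|
      himp (measurableSet_lt (by fun_prop) (by fun_prop)) <| measurableSet_eq_fun ?_ ?_
    · exact hψ.comp (by fun_prop : Measurable fun q : ℝ × (ℝ × ℝ) => (q.2.1, q.2.2 + q.1))
    · exact hψ.comp measurable_snd
  -- Substitute `y = z.2 + s`.
  have h2 : ∀ᵐ z : ℝ × ℝ, ∀ᵐ y : ℝ, z.2 < y → 0 < z.1 → 0 < z.2 → ψ (z.1, y) = ψ z := by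
    filter_upwards [h1] with z hz
    filter_upwards [(measurePreserving_sub_right volume z.2).quasiMeasurePreserving.ae hz]
      with y hy h3 h4 h5
    simpa using hy (by linarith) h4 h5
  rw [Measure.ae_ae_comm] at h2
  swap
  · refine himp (measurableSet_lt (by fun_prop) (by fun_prop)) <|
      himp (measurableSet_lt (by fun_prop) (by fun_prop)) <|
      himp (measurableSet_lt (by fun_prop) (by fun_prop)) <| measurableSet_eq_fun ?_ ?_
    · exact hψ.comp (by fun_prop : Measurable fun q : (ℝ × ℝ) × ℝ => (q.1.1, q.2))
    · exact hψ.comp measurable_fst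
  obtain ⟨y, hy, hy1⟩ : ∃ y, (∀ᵐ z : ℝ × ℝ, z.2 < y → 0 < z.1 → 0 < z.2 → ψ (z.1, y) = ψ z) ∧
      1 < y := by
    by_contra! hcon
    have h3 : volume (Set.Ioi (1 : ℝ)) = 0 := by
      refine measure_mono_null (fun y hy => ?_) (ae_iff.1 h2)
      exact fun h4 => absurd hy (not_lt.2 (hcon y h4))
    simp at h3
  refine ⟨fun r => ψ (r, y), hψ.comp (by fun_prop), ?_⟩
  -- Heights in `(m, m + 1]` are translated down by the integer `m` into `(0, 1]`, which lies below
  -- `y` because `y > 1`. Only countably many translations are needed.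
  have h3 : ∀ m : ℕ, ∀ᵐ z : ℝ × ℝ, 0 < z.1 → 0 < z.2 - m → z.2 - m ≤ 1 → ψ z = ψ (z.1, y) := by
    intro m
    have hmp := (measurePreserving_sub_right (volume : Measure (ℝ × ℝ))
      ((0 : ℝ), (m : ℝ))).quasiMeasurePreserving
    have h4 : ∀ᵐ z : ℝ × ℝ, 0 < z.1 → 0 < z.2 → ψ (z.1, z.2 + m) = ψ z := by
      rcases m.eq_zero_or_pos with rfl | hm
      · exact Filter.Eventually.of_forall fun z _ _ => by simp
      · exact h m (by exact_mod_cast hm)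
    filter_upwards [hmp.ae hy, hmp.ae h4] with z h5 h6 h7 h8 h9
    simp only [Prod.fst_sub, Prod.snd_sub, sub_zero, sub_add_cancel] at h5 h6
    exact (h6 h7 h8).trans (h5 (by linarith) h7 h8).symm
  filter_upwards [ae_all_iff.2 h3] with z hz h4 h5
  obtain ⟨m, hm1, hm2⟩ : ∃ m : ℕ, (m : ℝ) < z.2 ∧ z.2 ≤ m + 1 := by
    have hpos : 0 < ⌈z.2⌉₊ := Nat.ceil_pos.2 h5
    obtain ⟨m, hm⟩ := Nat.exists_eq_succ_of_ne_zero hpos.ne'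
    refine ⟨m, Nat.lt_ceil.1 (by omega), ?_⟩
    have := Nat.le_ceil z.2
    rw [hm] at this
    exact_mod_cast this
  exact hz m h4 (by linarith) (by linarith)

end Analysis
end
end CliffordSystem

namespace CliffordSystem
noncomputable section

/-! ### Automorphisms on the vacuum and on two-particle vectors -/

section TwoParticle
variable {k : Type*} [NormedAddCommGroup k] [InnerProductSpace ℂ k]

/-- Translation of configurations. -/
def shiftConfig (s : ℝ) (ω : Config) : Config := ⟨ω.1, fun i => ω.2 i - s⟩

theorem measurable_shiftConfig (s : ℝ) : Measurable (shiftConfig s) := by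
  intro A hA
  rw [measurableSet_config] at hA ⊢
  intro n
  exact (measurable_id.sub_const (fun _ : Fin (2 * n) => s)) (hA n)

theorem measurePreserving_shiftConfig (s : ℝ) :
    MeasurePreserving (shiftConfig s) configMeasure configMeasure := by
  refine ⟨measurable_shiftConfig s, ?_⟩
  rw [configMeasure, Measure.map_sum (measurable_shiftConfig s).aemeasurable]
  congr 1
  ext1 n
  have h1 : MeasurePreserving (fun x : Fin (2 * n) → ℝ => x - fun _ => s)
      (volume.restrict (simplex n)) (volume.restrict (simplex n)) := by
    have h2 := (measurePreserving_sub_right (volume : Measure (Fin (2 * n) → ℝ))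
      fun _ => s).restrict_preimage (measurableSet_simplex n)
    have h3 : (fun x : Fin (2 * n) → ℝ => x - fun _ => s) ⁻¹' simplex n = simplex n := by
      ext x
      simp [simplex, StrictAnti]
    rwa [h3] at h2
  rw [Measure.map_map (measurable_shiftConfig s) (measurableEmbedding_mk n).measurable]
  have h4 : shiftConfig s ∘ sector n = sector n ∘ fun x => x - fun _ => s := rfl
  rw [h4, ← Measure.map_map (measurableEmbedding_mk n).measurable h1.measurable, h1.map_eq]

/-- Translation of functions of configurations. -/
def shiftL2 (k : Type*) [NormedAddCommGroup k] [InnerProductSpace ℂ k] (s : ℝ) :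
    ConfigL2 k →ₗᵢ[ℂ] ConfigL2 k :=
  Lp.compMeasurePreservingₗᵢ ℂ (shiftConfig s) (measurePreserving_shiftConfig s)

theorem shiftL2_ae (s : ℝ) (f : ConfigL2 k) :
    ∀ᵐ ω ∂configMeasure, shiftL2 k s f ω = f (shiftConfig s ω) :=
  Lp.coeFn_compMeasurePreserving f (measurePreserving_shiftConfig s)

variable [TopologicalSpace.SeparableSpace k]

theorem fiberIncl_mul_vacuum (s t : Time) (y : Fiber k s) :
    fiberIncl (s + t) (mul s t y (vacuum k t)) = fiberIncl s y := by
  refine fiber_induction (W := LinearMap.eqLocus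
    ((fiberIncl (s + t)).toLinearMap ∘ₗ (mulRight s t (vacuum k t)).toLinearMap)
    (fiberIncl s).toLinearMap) (isClosed_eq
      ((fiberIncl (s + t)).continuous.comp (mulRight s t (vacuum k t)).continuous)
      (fiberIncl s).continuous) (fun n ξ => ?_) y
  change fiberIncl (s + t) (mul s t (evenWedge s ξ) (vacuum k t)) = fiberIncl s (evenWedge s ξ)
  rw [vacuum, mul_evenWedge, fiberIncl_evenWedge, fiberIncl_evenWedge]
  refine Subtype.ext ?_
  have h : 2 * (0 + n) = 2 * n := by omega
  refine Eq.trans ?_ (wedge_cast h fun i => (ξ i : L2Line k))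
  change wedge _ = wedge _
  congr 1
  ext1 i
  revert i
  refine forall_inl_inr (fun i => i.elim0) fun i => ?_
  rw [concat_inr]
  have h2 : Fin.cast h (inrIdx 0 i) = i := by
    ext
    simp [inrIdx]
  rw [h2]
  rfl

theorem fiberIncl_vacuum_mul (s t : Time) {n : ℕ} (ξ : Fin (2 * n) → L2Interval k t) :
    fiberIncl (s + t) (mul s t (vacuum k s) (evenWedge t ξ)) =
      ⟨wedge fun i => shiftLine s (ξ i : L2Line k), wedge_mem_evenFock _ (even_two_mul n)⟩ := by
  rw [vacuum, mul_evenWedge, fiberIncl_evenWedge]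
  refine Subtype.ext ?_
  change wedge _ = wedge _
  congr 1
  ext1 i
  revert i
  refine forall_inl_inr (m := 0) (fun i => ?_) fun i => i.elim0
  rw [concat_inl]
  rfl

theorem fiberTwist_mul_vacuum (s t : Time) (y : Fiber k s) :
    fiberTwist 1 (s + t) (mul s t y (vacuum k t)) = fiberTwist 1 s y := by
  change twist 1 (fiberIncl (s + t) (mul s t y (vacuum k t))) = twist 1 (fiberIncl s y)
  rw [fiberIncl_mul_vacuum]

/-- A vacuum on the left acts as translation by `s`, whereas by `fiberTwist_mul_vacuum` a vacuum on
the right acts as inclusion. These supply the invariances of the two-particle action. -/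
theorem fiberTwist_vacuum_mul (s t : Time) (y : Fiber k t) :
    fiberTwist 1 (s + t) (mul s t (vacuum k s) y) = shiftL2 k s (fiberTwist 1 t y) := by
  refine fiber_induction (W := LinearMap.eqLocus
    ((fiberTwist 1 (s + t)).toLinearMap ∘ₗ (mulLeft s t (vacuum k s)).toLinearMap)
    ((shiftL2 k s).toLinearMap ∘ₗ (fiberTwist 1 t).toLinearMap)) (isClosed_eq
      ((fiberTwist 1 (s + t)).continuous.comp (mulLeft s t (vacuum k s)).continuous)
      ((shiftL2 k s).continuous.comp (fiberTwist 1 t).continuous)) (fun n ξ => ?_) y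
  change twist 1 (fiberIncl (s + t) (mul s t (vacuum k s) (evenWedge t ξ))) =
    shiftL2 k s (fiberTwist 1 t (evenWedge t ξ))
  rw [fiberIncl_vacuum_mul, twist_wedge, fiberTwist_evenWedge]
  refine Lp.ext ?_
  have h1 := (measurePreserving_shiftConfig s).quasiMeasurePreserving.ae
    (genVec_ae 1 fun i => (ξ i : L2Line k))
  have h2 : ∀ᵐ ω ∂configMeasure, ∀ (i : Fin (2 * n)) j,
      shiftLine s (ξ i : L2Line k) (ω.2 j) = (ξ i : L2Line k) (ω.2 j - s) := by
    rw [ae_config_iff]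
    intro m
    simp only [ae_all_iff]
    exact fun i j => ae_restrict_of_ae (ae_eval j (shiftLine_ae s (ξ i : L2Line k)))
  filter_upwards [genVec_ae 1 fun i => shiftLine s (ξ i : L2Line k), h1, h2,
    shiftL2_ae s (genVec 1 fun i => (ξ i : L2Line k))] with ω h3 h4 h5 h6
  rw [h3, h6, h4]
  obtain ⟨m, x⟩ := ω
  by_cases hm : n = m
  · subst hm
    rw [shiftConfig, onSector_same, onSector_same]
    simp only [antiVec, pairVec]
    refine Finset.sum_congr rfl fun τ _ => ?_
    congr 2
    ext1 j
    rw [sub_sub_sub_cancel_right, pairTensor_eq, pairTensor_eq]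
    simp only [Function.comp_apply]
    rw [h5, h5]
  · rw [shiftConfig, onSector_ne hm, onSector_ne hm]

theorem vacuum_mem (t : Time) : vacuum k t ∈ fiberSupported k t {ω | ω.1 = 0} := by
  rw [mem_fiberSupported_iff, vacuum, fiberTwist_evenWedge]
  filter_upwards [genVec_ae 1 fun i : Fin (2 * 0) =>
    ((i.elim0 : L2Interval k t) : L2Line k)] with ω h1 h2
  rw [h1]
  obtain ⟨m, x⟩ := ω
  exact onSector_ne (Ne.symm h2) _ _

theorem measurableSet_number (n : ℕ) : MeasurableSet {ω : Config | ω.1 = n} := by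
  rw [measurableSet_config]
  intro m
  by_cases h : m = n
  · have : sector m ⁻¹' {ω : Config | ω.1 = n} = Set.univ := Set.eq_univ_of_forall fun x => h
    rw [this]
    exact MeasurableSet.univ
  · have : sector m ⁻¹' {ω : Config | ω.1 = n} = ∅ := Set.eq_empty_of_forall_notMem fun x => h
    rw [this]
    exact MeasurableSet.empty

theorem boxVec_mem (t : Time) {n : ℕ} {A : Fin (2 * n) → Set ℝ} (hA : ∀ i, MeasurableSet (A i))
    (hO : Ordered t A) (v : Fin (2 * n) → k) :
    boxVec t hA v ∈ fiberSupported k t {ω | ω.1 = n} :=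
  mem_fiberSupported_iff.2 (boxVec_ae_sector 1 t hA hO v)

/-- The zero-particle space is one-dimensional: after subtracting the vacuum component, `x` is
orthogonal to the vacuum and to all boxes with particles, hence to a total set. -/
theorem eq_smul_vacuum {t : Time} {x : Fiber k t} (hx : x ∈ fiberSupported k t {ω | ω.1 = 0}) :
    x = (inner ℂ (vacuum k t) x : ℂ) • vacuum k t := by
  set d := x - (inner ℂ (vacuum k t) x : ℂ) • vacuum k t with hd
  have hdm : d ∈ fiberSupported k t {ω | ω.1 = 0} :=
    Submodule.sub_mem _ hx (Submodule.smul_mem _ _ (vacuum_mem t))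
  have h1 : ∀ y ∈ boxes k t, (inner ℂ d y : ℂ) = 0 := by
    rintro _ ⟨n, A, hA, v, hO, rfl⟩
    rcases Nat.eq_zero_or_pos n with rfl | hn
    · rw [boxVec, evenWedge_zero, ← inner_conj_symm, hd, inner_sub_right, inner_smul_right,
        inner_self_eq_norm_sq_to_K, norm_vacuum]
      simp
    · refine inner_eq_zero_of_supported hdm ?_
      rw [mem_fiberSupported_iff]
      filter_upwards [boxVec_ae_sector 1 t hA hO v] with ω h2 h3
      refine h2 fun h4 => h3 fun h5 => ?_
      have h6 : ω.1 = 0 := h5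
      omega
  have h2 : (inner ℂ d d : ℂ) = 0 := boxes_induction (W := LinearMap.ker (innerSL ℂ d).toLinearMap)
    (innerSL ℂ d).isClosed_ker h1 d
  exact sub_eq_zero.1 (inner_self_eq_zero.1 h2)

theorem fiberIncl_vacuum (t : Time) : ((fiberIncl t (vacuum k t) : evenFock (L2Line k)) :
    Fock (L2Line k)) = wedge (n := 2 * 0) fun i => i.elim0 := by
  rw [vacuum, fiberIncl_evenWedge]
  change wedge _ = wedge _
  congr 1
  ext1 i
  exact i.elim0

/-- The Borel condition on automorphisms enters here. The vacuum is a constant section in the Fock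
space over the line, so its image under `θ` is a measurable section. -/
theorem measurable_vacuum_coeff (θ : Aut k) :
    Measurable fun t : Time => (inner ℂ (vacuum k t) (θ.1 t (vacuum k t)) : ℂ) := by
  borelize (Fock (L2Line k))
  let f : Time → TotalSpace k := fun t => ⟨t, vacuum k t⟩
  have h1 : Measurable f := by
    refine measurable_total_iff.2 ⟨measurable_id, ?_⟩
    change Measurable fun t : Time =>
      ((fiberIncl t (vacuum k t) : evenFock (L2Line k)) : Fock (L2Line k))
    simp only [fiberIncl_vacuum]
    exact measurable_const
  have h2 : Measurable fun t : Time =>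
      ((fiberIncl t (θ.1 t (vacuum k t)) : evenFock (L2Line k)) : Fock (L2Line k)) :=
    (measurable_total_iff.1 (θ.2.2.1.comp h1)).2
  have h3 : Measurable fun t : Time => innerSL ℂ (wedge (n := 2 * 0) fun i => i.elim0)
      ((fiberIncl t (θ.1 t (vacuum k t)) : evenFock (L2Line k)) : Fock (L2Line k)) :=
    (innerSL ℂ _).continuous.measurable.comp h2
  have h4 : (fun t : Time => (inner ℂ (vacuum k t) (θ.1 t (vacuum k t)) : ℂ)) =
      fun t : Time => innerSL ℂ (wedge (n := 2 * 0) fun i => i.elim0)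
      ((fiberIncl t (θ.1 t (vacuum k t)) : evenFock (L2Line k)) : Fock (L2Line k)) := by
    ext1 t
    rw [← LinearIsometry.inner_map_map (fiberIncl t), innerSL_apply_apply, ← fiberIncl_vacuum t]
    rfl
  rw [h4]
  exact h3

theorem exists_aut_vacuum (θ : Aut k) : ∃ l : ℝ, ∀ t : Time,
    θ.1 t (vacuum k t) = Complex.exp (Complex.I * l * (t : ℝ)) • vacuum k t := by
  set c : Time → ℂ := fun t => inner ℂ (vacuum k t) (θ.1 t (vacuum k t)) with hc
  have h1 : ∀ t, θ.1 t (vacuum k t) = c t • vacuum k t := fun t =>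
    -- The particle number is a measurable function of the configuration, so `θ` preserves the
    -- zero-particle space.
    eq_smul_vacuum (preserved_of_measurableSet (measurableSet_number 0) θ t _ (vacuum_mem t))
  have hne : ∀ t, vacuum k t ≠ 0 := fun t =>
    norm_ne_zero_iff.1 (by rw [norm_vacuum]; exact one_ne_zero)
  have hn : ∀ t, ‖c t‖ = 1 := fun t => by
    have h2 := (θ.1 t).norm_map (vacuum k t)
    rwa [h1, norm_smul, norm_vacuum, mul_one] at h2
  have hm : ∀ s t, c (s + t) = c s * c t := fun s t => by
    have h2 := aut_mul θ s t (vacuum k s) (vacuum k t)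
    rw [mul_vacuum, h1, h1, h1, mul_smul_left, mul_smul_right, mul_vacuum, smul_smul] at h2
    exact smul_left_injective ℂ (hne _) h2
  let d : ℝ → ℂ := Function.extend Subtype.val c 0
  have hd : ∀ t : Time, d t = c t := fun t => Subtype.val_injective.extend_apply c (0 : ℝ → ℂ) t
  have hd0 : ∀ t : ℝ, ¬ 0 < t → d t = 0 := fun t ht => by
    refine Function.extend_apply' c (0 : ℝ → ℂ) t ?_
    rintro ⟨a, rfl⟩
    exact ht a.2
  have hdm : Measurable d := (MeasurableEmbedding.subtype_coe measurableSet_Ioi).measurable_extend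
    (measurable_vacuum_coeff θ) measurable_const
  have hb : ∀ t, 0 < t → ‖d t‖ = 1 := fun t ht => (congrArg norm (hd ⟨t, ht⟩)).trans (hn _)
  have hb' : ∀ t, ‖d t‖ ≤ 1 := fun t => by
    by_cases ht : 0 < t
    · exact (hb t ht).le
    · rw [hd0 t ht, norm_zero]
      exact zero_le_one
  obtain ⟨l, hl⟩ := exists_exp_of_measurable hdm hb' hb fun s t hs ht => by
    have h2 := hm ⟨s, hs⟩ ⟨t, ht⟩
    rw [← hd, ← hd, ← hd] at h2
    exact h2
  refine ⟨l, fun t => ?_⟩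
  rw [h1, ← hd, hl t t.2]

end TwoParticle
end
end CliffordSystem

namespace CliffordSystem
noncomputable section

/-! ### The function of the gap determined by an automorphism -/

section Gap
variable {k : Type*} [NormedAddCommGroup k] [InnerProductSpace ℂ k]

theorem measurableSet_window (t : Time) : MeasurableSet (window t) := by
  rw [measurableSet_config]
  intro n
  have : sector n ⁻¹' window t = Set.univ.pi fun _ => Set.Icc (0 : ℝ) t :=
    Set.ext fun x => ⟨fun h i _ => h i, fun h i => h i trivial⟩
  rw [this]
  exact MeasurableSet.univ_pi fun _ => measurableSet_Icc

/-- The two-point configurations in `[0, t]`. -/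
def pairWindow (t : Time) : Set Config := {ω | ω.1 = 1} ∩ window t

theorem measurableSet_pairWindow (t : Time) : MeasurableSet (pairWindow t) :=
  (measurableSet_number 1).inter (measurableSet_window t)

theorem configMeasure_pairWindow (t : Time) : configMeasure (pairWindow t) ≠ ⊤ := by
  have h1 : pairWindow t = sector 1 '' (Set.univ.pi fun _ => Set.Icc (0 : ℝ) t) := by
    ext ω
    constructor
    · rintro ⟨h2, h3⟩
      obtain ⟨n, x⟩ := ω
      obtain rfl : n = 1 := h2
      exact ⟨x, fun i _ => h3 i, rfl⟩
    · rintro ⟨x, hx, rfl⟩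
      exact ⟨rfl, fun i => hx i trivial⟩
  have h2 : configMeasure (pairWindow t) =
      (configMeasure.restrict (Set.range (sector 1))) (pairWindow t) := by
    rw [Measure.restrict_apply (measurableSet_pairWindow t), Set.inter_eq_left.2]
    rw [h1]
    exact Set.image_subset_range _ _
  rw [h2, restrict_sector, (measurableEmbedding_mk 1).map_apply, h1,
    Set.preimage_image_eq _ sigma_mk_injective]
  refine ((Measure.restrict_apply_le _ _).trans_lt ?_).ne
  rw [volume_pi_pi]
  simp only [Real.volume_Icc]
  exact ENNReal.prod_lt_top fun i _ => ENNReal.ofReal_lt_top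

theorem tprodOne_mem (κ : TensorSquare k) : tprodOne k κ ∈ tprodSpace k 1 :=
  tprod_mem _

/-- The constant function `κ` on the two-point configurations in `[0, t]`. -/
def constFn (t : Time) (κ : TensorSquare k) : ConfigL2 k :=
  indicatorConstLp 2 (measurableSet_pairWindow t) (configMeasure_pairWindow t) (tprodOne k κ)

theorem constFn_ae (t : Time) (κ : TensorSquare k) : ∀ᵐ ω ∂configMeasure,
    constFn t κ ω = (pairWindow t).indicator (fun _ => tprodOne k κ) ω :=
  indicatorConstLp_coeFn

theorem constFn_mem (t : Time) (κ : TensorSquare k) : constFn t κ ∈ supported k (window t) := by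
  rw [mem_supported]
  filter_upwards [constFn_ae t κ] with ω h
  rw [h]
  by_cases h1 : ω ∈ pairWindow t
  · rw [Set.indicator_of_mem h1]
    obtain ⟨n, x⟩ := ω
    obtain rfl : n = 1 := h1.1
    exact ⟨tprodOne_mem κ, fun h2 => absurd h1.2 h2⟩
  · rw [Set.indicator_of_notMem h1]
    exact ⟨Submodule.zero_mem _, fun _ => rfl⟩

theorem window_subset (s t : Time) : window s ⊆ window (s + t) := fun ω h i =>
  ⟨(h i).1, (h i).2.trans (by simpa using t.2.le)⟩

theorem shiftConfig_gapConfig (s : ℝ) (z : ℝ × ℝ) :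
    shiftConfig s (gapConfig (z.1, z.2 + s)) = gapConfig z := by
  rw [shiftConfig, gapConfig, gapConfig]
  congr 1
  ext1 i
  revert i
  refine forall_fin_two_mul_one ?_ ?_
  · change z.1 + (z.2 + s) - s = z.1 + z.2
    ring
  · change z.2 + s - s = z.2
    ring

theorem ae_translate {p : ℝ × ℝ → Prop} (h : ∀ᵐ z, p z) (s : ℝ) : ∀ᵐ z : ℝ × ℝ, p (z.1, z.2 + s) := by
  have := (measurePreserving_add_right (volume : Measure (ℝ × ℝ))
    ((0 : ℝ), s)).quasiMeasurePreserving.ae h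
  filter_upwards [this] with z hz
  convert hz using 1
  exact Prod.ext (by simp) rfl

theorem measurable_ceil_glue {E : Type*} [MeasurableSpace E] {f : ℕ → ℝ × ℝ → E}
    (hf : ∀ N, Measurable (f N)) : Measurable fun z : ℝ × ℝ => f ⌈z.1 + z.2⌉₊ z := by
  have h1 : Measurable fun q : (ℝ × ℝ) × ℕ => f q.2 q.1 := measurable_from_prod_countable_left hf
  have h2 : Measurable fun z : ℝ × ℝ => ⌈z.1 + z.2⌉₊ :=
    Nat.measurable_ceil.comp (measurable_fst.add measurable_snd)
  exact h1.comp (measurable_id.prodMk h2)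

variable [TopologicalSpace.SeparableSpace k]

/-- The vector of the fibre `H_t` that is the constant `κ` on the two-point configurations. -/
def constVec (t : Time) (κ : TensorSquare k) : Fiber k t :=
  (exists_fiberTwist_eq t (constFn_mem t κ)).choose

theorem constVec_ae (t : Time) (κ : TensorSquare k) : ∀ᵐ ω ∂configMeasure,
    fiberTwist 1 t (constVec t κ) ω = (pairWindow t).indicator (fun _ => tprodOne k κ) ω := by
  rw [constVec, (exists_fiberTwist_eq t (constFn_mem t κ)).choose_spec]
  exact constFn_ae t κ

/-- The value of `θ_t κ` at the points `r + y` and `y`. -/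
def pairVal (θ : Aut k) (κ : TensorSquare k) (t : Time) (z : ℝ × ℝ) : TensorSquare k :=
  ContinuousLinearMap.adjoint (tprodOne k).toContinuousLinearMap
    (fiberTwist 1 t (θ.1 t (constVec t κ)) (gapConfig z))

theorem measurable_pairVal [MeasurableSpace (TensorSquare k)] [BorelSpace (TensorSquare k)]
    (θ : Aut k) (κ : TensorSquare k) (t : Time) : Measurable (pairVal θ κ t) := by
  borelize (TensorFock k)
  refine (ContinuousLinearMap.continuous _).measurable.comp ?_
  exact (Lp.stronglyMeasurable _).measurable.comp measurable_gapConfig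

/-- Values at two-point configurations lie in the range of `tprodOne`, where the adjoint used in
`pairVal` is the inverse. -/
theorem pairVal_ae (θ : Aut k) (κ : TensorSquare k) (t : Time) : ∀ᵐ z : ℝ × ℝ, 0 < z.1 →
    fiberTwist 1 t (θ.1 t (constVec t κ)) (gapConfig z) = tprodOne k (pairVal θ κ t z) := by
  filter_upwards [ae_gap (mem_supported.1 (fiberTwist_mem 1 t (θ.1 t (constVec t κ))))] with z hz h0
  have h1 : fiberTwist 1 t (θ.1 t (constVec t κ)) (gapConfig z) ∈
      LinearMap.range (tprodOne k).toLinearMap := by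
    rw [range_tprodOne]
    exact (hz h0).1
  obtain ⟨a, ha⟩ := h1
  have ha' : tprodOne k a = fiberTwist 1 t (θ.1 t (constVec t κ)) (gapConfig z) := ha
  rw [pairVal, ← ha']
  congr 1
  refine ext_inner_left ℂ fun b => ?_
  rw [ContinuousLinearMap.adjoint_inner_right]
  exact ((tprodOne k).inner_map_map b a).symm

/-- The constant function on `[0, s]` is the restriction of the one on `[0, s + t]`, and it is also
its own product with a vacuum on the right. `θ` respects both descriptions. -/
theorem pairVal_add_right {θ : Aut k} (hθ : ∀ t, θ.1 t (vacuum k t) = vacuum k t)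
    (κ : TensorSquare k) (s t : Time) : ∀ᵐ z : ℝ × ℝ, 0 < z.1 → 0 < z.2 → z.1 + z.2 < s →
      pairVal θ κ (s + t) z = pairVal θ κ s z := by
  have h1 : ∀ᵐ ω ∂configMeasure, fiberTwist 1 (s + t) (mul s t (constVec s κ) (vacuum k t)) ω =
      (window s).indicator (fiberTwist 1 (s + t) (constVec (s + t) κ)) ω := by
    rw [fiberTwist_mul_vacuum]
    filter_upwards [constVec_ae s κ, constVec_ae (s + t) κ] with ω h2 h3
    rw [h2]
    by_cases h4 : ω ∈ window s
    · rw [Set.indicator_of_mem h4, h3]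
      by_cases h5 : ω.1 = 1
      · rw [Set.indicator_of_mem (show ω ∈ pairWindow s from ⟨h5, h4⟩),
          Set.indicator_of_mem (show ω ∈ pairWindow (s + t) from ⟨h5, window_subset s t h4⟩)]
      · rw [Set.indicator_of_notMem fun h => h5 h.1, Set.indicator_of_notMem fun h => h5 h.1]
    · rw [Set.indicator_of_notMem h4, Set.indicator_of_notMem fun h => h4 h.2]
  have h2 := aut_restrict θ (measurableSet_window s) h1
  rw [aut_mul, hθ, fiberTwist_mul_vacuum] at h2
  filter_upwards [ae_gap h2] with z h3 h4 h5 h6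
  rw [pairVal, pairVal, h3 h4, Set.indicator_of_mem]
  exact (gapConfig_mem_window h4).2 ⟨h5.le, h6.le⟩

/-- As for `pairVal_add_right`, with the vacuum on the left, so that the constant function on `[0,
t]` is translated by `s`. -/
theorem pairVal_add_left {θ : Aut k} (hθ : ∀ t, θ.1 t (vacuum k t) = vacuum k t)
    (κ : TensorSquare k) (s t : Time) : ∀ᵐ z : ℝ × ℝ, 0 < z.1 → 0 < z.2 → z.1 + z.2 < t →
      pairVal θ κ (s + t) (z.1, z.2 + s) = pairVal θ κ t z := by
  have hC : MeasurableSet (shiftConfig s ⁻¹' window t) :=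
    measurable_shiftConfig s (measurableSet_window t)
  have hsub : shiftConfig s ⁻¹' window t ⊆ window (s + t) := fun ω h i => by
    have h1 : 0 ≤ ω.2 i - s := (h i).1
    have h2 : ω.2 i - s ≤ t := (h i).2
    have h3 : (0 : ℝ) < s := s.2
    rw [Positive.coe_add]
    exact ⟨by linarith, by linarith⟩
  have h1 : ∀ᵐ ω ∂configMeasure, fiberTwist 1 (s + t) (mul s t (vacuum k s) (constVec t κ)) ω =
      (shiftConfig s ⁻¹' window t).indicator (fiberTwist 1 (s + t) (constVec (s + t) κ)) ω := by
    rw [fiberTwist_vacuum_mul]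
    filter_upwards [shiftL2_ae s (fiberTwist 1 t (constVec t κ)),
      (measurePreserving_shiftConfig s).quasiMeasurePreserving.ae (constVec_ae t κ),
      constVec_ae (s + t) κ] with ω h0 h2 h3
    rw [h0, h2]
    by_cases h4 : shiftConfig s ω ∈ window t
    · rw [Set.indicator_of_mem (s := shiftConfig s ⁻¹' window t) h4, h3]
      by_cases h5 : ω.1 = 1
      · rw [Set.indicator_of_mem (show shiftConfig s ω ∈ pairWindow t from ⟨h5, h4⟩),
          Set.indicator_of_mem (show ω ∈ pairWindow (s + t) from ⟨h5, hsub h4⟩)]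
      · rw [Set.indicator_of_notMem fun h => h5 h.1, Set.indicator_of_notMem fun h => h5 h.1]
    · rw [Set.indicator_of_notMem (s := shiftConfig s ⁻¹' window t) h4,
        Set.indicator_of_notMem fun h => h4 h.2]
  have h2 := aut_restrict θ hC h1
  rw [aut_mul, hθ, fiberTwist_vacuum_mul] at h2
  have h3 := ae_translate (ae_gap (h2.and (shiftL2_ae s (fiberTwist 1 t (θ.1 t (constVec t κ)))))) s
  filter_upwards [h3] with z h3 h4 h5 h6
  obtain ⟨h7, h8⟩ := h3 h4
  rw [h8, shiftConfig_gapConfig, Set.indicator_of_mem] at h7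
  · rw [pairVal, pairVal, h7]
  · rw [Set.mem_preimage, shiftConfig_gapConfig]
    exact (gapConfig_mem_window h4).2 ⟨h5.le, h6.le⟩

theorem pairVal_congr {θ : Aut k} (hθ : ∀ t, θ.1 t (vacuum k t) = vacuum k t)
    (κ : TensorSquare k) (s t : Time) : ∀ᵐ z : ℝ × ℝ, 0 < z.1 → 0 < z.2 → z.1 + z.2 < s →
      z.1 + z.2 < t → pairVal θ κ s z = pairVal θ κ t z := by
  have key : ∀ s t : Time, s < t → ∀ᵐ z : ℝ × ℝ, 0 < z.1 → 0 < z.2 → z.1 + z.2 < s →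
      pairVal θ κ t z = pairVal θ κ s z := by
    intro s t hst
    obtain ⟨t', rfl⟩ : ∃ t', t = s + t' :=
      ⟨⟨t - s, sub_pos.2 hst⟩, Subtype.ext (by rw [Positive.coe_add]; simp)⟩
    exact pairVal_add_right hθ κ s t'
  rcases lt_trichotomy s t with h | rfl | h
  · filter_upwards [key s t h] with z h1 h2 h3 h4 _
    exact (h1 h2 h3 h4).symm
  · exact Filter.Eventually.of_forall fun z _ _ _ _ => rfl
  · filter_upwards [key t s h] with z h1 h2 h3 _ h4
    exact h1 h2 h3 h4

theorem exists_gapVal {θ : Aut k} (hθ : ∀ t, θ.1 t (vacuum k t) = vacuum k t) (κ : TensorSquare k)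
    [MeasurableSpace (TensorSquare k)] [BorelSpace (TensorSquare k)] :
    ∃ γ : ℝ → TensorSquare k, Measurable γ ∧ ∀ t : Time, ∀ᵐ z : ℝ × ℝ, 0 < z.1 → 0 < z.2 →
      z.1 + z.2 < t → fiberTwist 1 t (θ.1 t (constVec t κ)) (gapConfig z) = tprodOne k (γ z.1) := by
  have : SecondCountableTopology (TensorSquare k) :=
    UniformSpace.secondCountable_of_separable (TensorSquare k)
  obtain ⟨T, hTN⟩ : ∃ T : ℕ → Time, ∀ N, (T N : ℝ) = N + 1 :=
    ⟨fun N => ⟨N + 1, by positivity⟩, fun N => rfl⟩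
  -- The local values are glued by reading the point `(r, y)` in the window of length `⌈r + y⌉₊ +
  -- 1`, which always contains the pair; countably many windows occur.
  let ψ : ℝ × ℝ → TensorSquare k := fun z => pairVal θ κ (T ⌈z.1 + z.2⌉₊) z
  have hψm : Measurable ψ := by
    exact measurable_ceil_glue (f := fun N => pairVal θ κ (T N)) fun N => measurable_pairVal θ κ (T N)
  have hT : ∀ x : ℝ, x < T ⌈x⌉₊ := fun x => by
    have := Nat.le_ceil x
    rw [hTN]
    linarith
  have hψ : ∀ t : Time, ∀ᵐ z : ℝ × ℝ, 0 < z.1 → 0 < z.2 → z.1 + z.2 < t →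
      pairVal θ κ t z = ψ z := by
    intro t
    filter_upwards [ae_all_iff.2 fun N => pairVal_congr hθ κ t (T N)] with z h1 h2 h3 h4
    exact h1 _ h2 h3 h4 (hT _)
  obtain ⟨γ, hγm, hγ⟩ := exists_gap_function hψm fun s hs => by
    have h1 : ∀ᵐ z : ℝ × ℝ, ∀ N : ℕ, 0 < z.1 → 0 < z.2 → z.1 + z.2 < T N →
        ψ (z.1, z.2 + s) = ψ z := by
      rw [ae_all_iff]
      intro N
      filter_upwards [pairVal_add_left hθ κ ⟨s, hs⟩ (T N), hψ (T N),
        ae_translate (hψ (⟨s, hs⟩ + T N)) s] with z h2 h3 h4 h5 h6 h7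
      rw [← h3 h5 h6 h7, ← h2 h5 h6 h7]
      refine (h4 h5 (by linarith) ?_).symm
      rw [Positive.coe_add]
      change z.1 + (z.2 + s) < s + (T N : ℝ)
      linarith
    filter_upwards [h1] with z h2 h3 h4
    exact h2 _ h3 h4 (hT _)
  refine ⟨γ, hγm, fun t => ?_⟩
  filter_upwards [pairVal_ae θ κ t, hψ t, hγ] with z h1 h2 h3 h4 h5 h6
  rw [h1 h4, h2 h4 h5 h6, h3 h4 h5]

end Gap
end
end CliffordSystem

namespace CliffordSystem
noncomputable section

/-! ### Surjectivity -/

section Surjective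

theorem HilbertBasis.ext_inner_left {ι E : Type*} [NormedAddCommGroup E] [InnerProductSpace ℂ E]
    (b : HilbertBasis ι ℂ E) {x y : E} (h : ∀ i, (inner ℂ (b i) x : ℂ) = inner ℂ (b i) y) : x = y := by
  refine b.repr.injective (lp.ext (funext fun i => ?_))
  rw [b.repr_apply_apply, b.repr_apply_apply, h]

/-- An orthonormal family only yields an isometry `V`. The adjointness condition identifies `V*`
with the isometry `V'` given by `g'`; since `V*` is itself isometric, `V V' = 1` and `V` is onto. -/
theorem exists_unitary_of_basis {ι E : Type*} [NormedAddCommGroup E] [InnerProductSpace ℂ E]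
    [CompleteSpace E] (b : HilbertBasis ι ℂ E) {g g' : ι → E}
    (hg : ∀ i j, (inner ℂ (g i) (g j) : ℂ) = inner ℂ (b i) (b j))
    (hg' : ∀ i j, (inner ℂ (g' i) (g' j) : ℂ) = inner ℂ (b i) (b j))
    (hadj : ∀ i j, (inner ℂ (g' i) (b j) : ℂ) = inner ℂ (b i) (g j)) :
    ∃ U : E ≃ₗᵢ[ℂ] E, ∀ i, U (b i) = g i := by
  classical
  have key : ∀ g : ι → E, (∀ i j, (inner ℂ (g i) (g j) : ℂ) = inner ℂ (b i) (b j)) →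
      ∃ V : E →ₗᵢ[ℂ] E, ∀ i, V (b i) = g i := by
    intro g hg
    have ho : Orthonormal ℂ g := by
      rw [orthonormal_iff_ite]
      intro i j
      rw [hg, orthonormal_iff_ite.1 b.orthonormal]
    refine ⟨ho.orthogonalFamily.linearIsometry.comp b.repr.toLinearIsometry, fun i => ?_⟩
    change ho.orthogonalFamily.linearIsometry (b.repr (b i)) = _
    rw [b.repr_self, OrthogonalFamily.linearIsometry_apply_single]
    simp
  obtain ⟨V, hV⟩ := key g hg
  obtain ⟨V', hV'⟩ := key g' hg'
  have h1 : ContinuousLinearMap.adjoint V.toContinuousLinearMap = V'.toContinuousLinearMap := by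
    refine ContinuousLinearMap.ext_on
      (Submodule.dense_iff_topologicalClosure_eq_top.2 b.dense_span) ?_
    rintro _ ⟨i, rfl⟩
    refine HilbertBasis.ext_inner_left b fun j => ?_
    rw [ContinuousLinearMap.adjoint_inner_right]
    change (inner ℂ (V (b j)) (b i) : ℂ) = inner ℂ (b j) (V' (b i))
    rw [hV, hV', ← inner_conj_symm, ← hadj, inner_conj_symm]
  have h2 : ∀ x, V (V' x) = x := fun x => by
    refine ext_inner_left ℂ fun z => ?_
    have h3 : (inner ℂ z (V (V' x)) : ℂ) =
        inner ℂ (ContinuousLinearMap.adjoint V.toContinuousLinearMap z) (V' x) :=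
      (ContinuousLinearMap.adjoint_inner_left V.toContinuousLinearMap (V' x) z).symm
    rw [h3, h1]
    exact V'.inner_map_map z x
  exact ⟨LinearIsometryEquiv.ofSurjective V fun x => ⟨V' x, h2 x⟩, hV⟩

variable {k : Type*} [NormedAddCommGroup k] [InnerProductSpace ℂ k]
  [TopologicalSpace.SeparableSpace k]

theorem exists_measurableUnitaries {ι : Type*} [Countable ι] (b : HilbertBasis ι ℂ (TensorSquare k))
    [MeasurableSpace (TensorSquare k)] [BorelSpace (TensorSquare k)] {g g' : ι → ℝ → TensorSquare k}
    (hgm : ∀ i, Measurable (g i)) (hgm' : ∀ i, Measurable (g' i))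
    (h : ∀ᵐ r : ℝ, 0 < r → ∀ i j, (inner ℂ (g i r) (g j r) : ℂ) = inner ℂ (b i) (b j) ∧
      (inner ℂ (g' i r) (g' j r) : ℂ) = inner ℂ (b i) (b j) ∧
      (inner ℂ (g' i r) (b j) : ℂ) = inner ℂ (b i) (g j r)) :
    ∃ F : MeasurableUnitaries k, ∀ᵐ r : ℝ, 0 < r → ∀ i, F.1 r.toNNReal (b i) = g i r := by
  classical
  have : SecondCountableTopology (TensorSquare k) :=
    UniformSpace.secondCountable_of_separable (TensorSquare k)
  let G : Set ℝ := {r | ∀ i j, (inner ℂ (g i r) (g j r) : ℂ) = inner ℂ (b i) (b j) ∧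
      (inner ℂ (g' i r) (g' j r) : ℂ) = inner ℂ (b i) (b j) ∧
      (inner ℂ (g' i r) (b j) : ℂ) = inner ℂ (b i) (g j r)}
  have hG : MeasurableSet G := by
    have h1 : G = ⋂ i, ⋂ j, ({r | (inner ℂ (g i r) (g j r) : ℂ) = inner ℂ (b i) (b j)} ∩
        ({r | (inner ℂ (g' i r) (g' j r) : ℂ) = inner ℂ (b i) (b j)} ∩
        {r | (inner ℂ (g' i r) (b j) : ℂ) = inner ℂ (b i) (g j r)})) := by
      ext r
      simp only [Set.mem_iInter]
      rfl
    rw [h1]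
    refine MeasurableSet.iInter fun i => MeasurableSet.iInter fun j =>
      (measurableSet_eq_fun ((hgm i).inner (hgm j)) measurable_const).inter
        ((measurableSet_eq_fun ((hgm' i).inner (hgm' j)) measurable_const).inter
          (measurableSet_eq_fun ((hgm' i).inner measurable_const) (measurable_const.inner (hgm j))))
  -- Outside the measurable set `G` of good gaps the unitary is set to the identity, so that `F` is
  -- defined and measurable everywhere.
  have hU : ∀ r, ∃ U : TensorSquare k ≃ₗᵢ[ℂ] TensorSquare k, ∀ i, U (b i) =
      if r ∈ G then g i r else b i := by
    intro r
    by_cases hr : r ∈ G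
    · obtain ⟨U, hU⟩ := exists_unitary_of_basis b (fun i j => (hr i j).1) (fun i j => (hr i j).2.1)
        fun i j => (hr i j).2.2
      exact ⟨U, fun i => by rw [hU, if_pos hr]⟩
    · exact ⟨LinearIsometryEquiv.refl ℂ _, fun i => by rw [if_neg hr]; rfl⟩
  choose U hU using hU
  have hm : ∀ v w, Measurable fun r : ℝ => (inner ℂ v (U r w) : ℂ) := by
    intro v w
    have h1 : ∀ r, HasSum (fun i => b.repr w i * (inner ℂ v (U r (b i)) : ℂ)) (inner ℂ v (U r w)) := by
      intro r
      have h2 := (b.hasSum_repr w).mapL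
        ((innerSL ℂ v).comp (U r).toContinuousLinearEquiv.toContinuousLinearMap)
      simp only [map_smul, smul_eq_mul] at h2
      exact h2
    refine measurable_of_tendsto_metrizable' (Filter.atTop : Filter (Finset ι))
      (f := fun s r => ∑ i ∈ s, b.repr w i * (inner ℂ v (U r (b i)) : ℂ))
      (fun s => Finset.measurable_sum _ fun i _ => measurable_const.mul ?_)
      (tendsto_pi_nhds.2 fun r => h1 r)
    simp only [hU]
    have h3 : Measurable fun r => if r ∈ G then g i r else b i :=
      (hgm i).ite hG measurable_const
    exact measurable_const.inner h3
  refine ⟨⟨fun r => U r, fun v w => (hm v w).comp measurable_subtype_coe⟩, ?_⟩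
  filter_upwards [h] with r hr hr0 i
  change U (r.toNNReal : ℝ) (b i) = _
  rw [Real.coe_toNNReal _ hr0.le, hU, if_pos (show r ∈ G from hr hr0)]

theorem ae_of_windows {p : ℝ → Prop} (h : ∀ t : Time, ∀ᵐ z : ℝ × ℝ, 0 < z.1 → 0 < z.2 →
    z.1 + z.2 < t → p z.1) : ∀ᵐ r : ℝ, 0 < r → p r := by
  have h1 : ∀ᵐ z : ℝ × ℝ, z ∈ {z : ℝ × ℝ | 0 < z.1 ∧ 0 < z.2} → p z.1 := by
    have h2 : ∀ᵐ z : ℝ × ℝ, ∀ N : ℕ, 0 < z.1 → 0 < z.2 → z.1 + z.2 < N + 1 → p z.1 :=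
      ae_all_iff.2 fun N => h ⟨N + 1, by positivity⟩
    filter_upwards [h2] with z hz h3
    obtain ⟨N, hN⟩ := exists_nat_gt (z.1 + z.2)
    exact hz N h3.1 h3.2 (by linarith)
  have ho : IsOpen {z : ℝ × ℝ | 0 < z.1 ∧ 0 < z.2} :=
    (isOpen_lt continuous_const continuous_fst).inter (isOpen_lt continuous_const continuous_snd)
  filter_upwards [ae_of_ae_prod_open ho h1] with r hr h2
  exact hr ⟨1, h2, one_pos⟩

theorem constVec_gap (t : Time) (κ : TensorSquare k) : ∀ᵐ z : ℝ × ℝ, 0 < z.1 → 0 < z.2 →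
    z.1 + z.2 < t → fiberTwist 1 t (constVec t κ) (gapConfig z) = tprodOne k κ := by
  filter_upwards [ae_gap (constVec_ae t κ)] with z h h1 h2 h3
  rw [h h1, Set.indicator_of_mem (show gapConfig z ∈ pairWindow t from
    ⟨rfl, (gapConfig_mem_window h1).2 ⟨h2.le, h3.le⟩⟩)]

/-- The gap functions of a Hilbert basis under `θ` and `θ⁻¹` inherit their inner products from the
pointwise unitarity of `θ`, so they define unitaries for almost every gap. -/
theorem exists_unitary_of_aut {θ : Aut k} (hθ : ∀ t, θ.1 t (vacuum k t) = vacuum k t) :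
    ∃ F : MeasurableUnitaries k, ∀ (t : Time) (κ : TensorSquare k), ∀ᵐ z : ℝ × ℝ, 0 < z.1 →
      0 < z.2 → z.1 + z.2 < t → fiberTwist 1 t (θ.1 t (constVec t κ)) (gapConfig z) =
        tprodOne k (F.1 z.1.toNNReal κ) := by
  borelize (TensorSquare k)
  have hθ' : ∀ t, (θ⁻¹).1 t (vacuum k t) = vacuum k t := fun t => by
    have h1 := aut_inv_apply θ t (vacuum k t)
    rwa [hθ] at h1
  obtain ⟨e, b, -⟩ := exists_hilbertBasis ℂ (TensorSquare k)
  have hc : Countable e := countable_of_orthonormal b.orthonormal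
  choose g hgm hg using fun i => exists_gapVal hθ (b i)
  choose g' hgm' hg' using fun i => exists_gapVal hθ' (b i)
  have hrel : ∀ᵐ r : ℝ, 0 < r → ∀ i j, (inner ℂ (g i r) (g j r) : ℂ) = inner ℂ (b i) (b j) ∧
      (inner ℂ (g' i r) (g' j r) : ℂ) = inner ℂ (b i) (b j) ∧
      (inner ℂ (g' i r) (b j) : ℂ) = inner ℂ (b i) (g j r) := by
    have h1 : ∀ i j, ∀ᵐ r : ℝ, 0 < r → (inner ℂ (g i r) (g j r) : ℂ) = inner ℂ (b i) (b j) ∧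
      (inner ℂ (g' i r) (g' j r) : ℂ) = inner ℂ (b i) (b j) ∧
      (inner ℂ (g' i r) (b j) : ℂ) = inner ℂ (b i) (g j r) := by
      intro i j
      refine ae_of_windows fun t => ?_
      -- Comparing `θ θ⁻¹ bᵢ = bᵢ` with `θ bⱼ` yields the adjointness relation between `g'` and `g`.
      have h2 := aut_inner_ae θ t ((θ⁻¹).1 t (constVec t (b i))) (constVec t (b j))
      rw [aut_apply_inv] at h2
      filter_upwards [hg i t, hg j t, hg' i t, hg' j t, constVec_gap t (b i), constVec_gap t (b j),
        ae_gap (aut_inner_ae θ t (constVec t (b i)) (constVec t (b j))),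
        ae_gap (aut_inner_ae θ⁻¹ t (constVec t (b i)) (constVec t (b j))), ae_gap h2]
        with z h3 h4 h5 h6 h7 h8 h9 h10 h11 p1 p2 p3
      have h9 := h9 p1
      have h10 := h10 p1
      have h11 := h11 p1
      rw [h3 p1 p2 p3, h4 p1 p2 p3, h7 p1 p2 p3, h8 p1 p2 p3, LinearIsometry.inner_map_map,
        LinearIsometry.inner_map_map] at h9
      rw [h5 p1 p2 p3, h6 p1 p2 p3, h7 p1 p2 p3, h8 p1 p2 p3, LinearIsometry.inner_map_map,
        LinearIsometry.inner_map_map] at h10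
      rw [h4 p1 p2 p3, h5 p1 p2 p3, h7 p1 p2 p3, h8 p1 p2 p3, LinearIsometry.inner_map_map,
        LinearIsometry.inner_map_map] at h11
      exact ⟨h9, h10, h11.symm⟩
    have h2 : ∀ᵐ r : ℝ, ∀ i j, 0 < r → (inner ℂ (g i r) (g j r) : ℂ) = inner ℂ (b i) (b j) ∧
      (inner ℂ (g' i r) (g' j r) : ℂ) = inner ℂ (b i) (b j) ∧
      (inner ℂ (g' i r) (b j) : ℂ) = inner ℂ (b i) (g j r) :=
      ae_all_iff.2 fun i => ae_all_iff.2 fun j => h1 i j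
    filter_upwards [h2] with r hr h0 i j
    exact hr i j h0
  obtain ⟨F, hF⟩ := exists_measurableUnitaries b hgm hgm' hrel
  refine ⟨F, fun t κ => ?_⟩
  have hF' : ∀ᵐ z : ℝ × ℝ, 0 < z.1 → ∀ i, F.1 z.1.toNNReal (b i) = g i z.1 :=
    Measure.quasiMeasurePreserving_fst.ae hF
  -- For general `κ` the value of `θ κ` is determined by its inner products with the basis images
  -- `gᵢ`, which are those of `κ` with `bᵢ`.
  have hall : ∀ᵐ z : ℝ × ℝ, ∀ i, 0 < z.1 → 0 < z.2 → z.1 + z.2 < t →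
      (inner ℂ (g i z.1) (pairVal θ κ t z) : ℂ) = inner ℂ (b i) κ := by
    rw [ae_all_iff]
    intro i
    filter_upwards [hg i t, pairVal_ae θ κ t, constVec_gap t (b i), constVec_gap t κ,
      ae_gap (aut_inner_ae θ t (constVec t (b i)) (constVec t κ))] with z h1 h2 h3 h4 h5 p1 p2 p3
    have h5 := h5 p1
    rwa [h1 p1 p2 p3, h2 p1, h3 p1 p2 p3, h4 p1 p2 p3, LinearIsometry.inner_map_map,
      LinearIsometry.inner_map_map] at h5
  filter_upwards [hF', hall, pairVal_ae θ κ t] with z h1 h2 h3 p1 p2 p3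
  rw [h3 p1]
  congr 1
  have h4 : (F.1 z.1.toNNReal).symm (pairVal θ κ t z) = κ := by
    refine HilbertBasis.ext_inner_left b fun i => ?_
    rw [← h2 i p1 p2 p3, ← h1 p1 i, ← LinearIsometryEquiv.inner_map_map (F.1 z.1.toNNReal),
      LinearIsometryEquiv.apply_symm_apply]
  rw [← h4, LinearIsometryEquiv.apply_symm_apply, h4]

/-- On the simplex a two-particle box vector is the constant function `v₀ ⊗ v₁` cut down to the box,
and `θ` commutes with this restriction. -/
theorem aut_boxVec_one {θ : Aut k} {F : MeasurableUnitaries k}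
    (hF : ∀ (t : Time) (κ : TensorSquare k), ∀ᵐ z : ℝ × ℝ, 0 < z.1 →
      0 < z.2 → z.1 + z.2 < t → fiberTwist 1 t (θ.1 t (constVec t κ)) (gapConfig z) =
        tprodOne k (F.1 z.1.toNNReal κ)) (t : Time) {A : Fin (2 * 1) → Set ℝ}
    (hA : ∀ i, MeasurableSet (A i)) (hO : Ordered t A) (v : Fin (2 * 1) → k) :
    θ.1 t (boxVec t hA v) = fiberUnitary F t (boxVec t hA v) := by
  classical
  have hCm : MeasurableSet (sector 1 '' Set.univ.pi A) :=
    (measurableEmbedding_mk 1).measurableSet_image.2 (MeasurableSet.univ_pi hA)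
  have h1 : ∀ᵐ ω ∂configMeasure, fiberTwist 1 t (boxVec t hA v) ω = (sector 1 '' Set.univ.pi A).indicator
      (fiberTwist 1 t (constVec t (pairTmul (v 0) (v 1)))) ω := by
    filter_upwards [genVec_cell_ae 1 t hA hO v, constVec_ae t (pairTmul (v 0) (v 1))] with ω h2 h3
    rw [h2]
    by_cases h4 : ω ∈ sector 1 '' Set.univ.pi A
    · rw [Set.indicator_of_mem h4, h3]
      obtain ⟨x, hx, rfl⟩ := h4
      rw [Set.indicator_of_mem (show sector 1 x ∈ pairWindow t from
        ⟨rfl, fun i => Set.Ioo_subset_Icc_self (hO.2 i (hx i trivial))⟩), sector, onSector_same,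
        if_pos hx, tprodOne_apply]
      change tprod _ = tprod _
      congr 1
      ext1 j
      obtain rfl : j = 0 := Subsingleton.elim _ _
      rfl
    · rw [Set.indicator_of_notMem h4]
      obtain ⟨n, x⟩ := ω
      by_cases hn : 1 = n
      · subst hn
        rw [onSector_same, if_neg fun h => h4 ⟨x, h, rfl⟩]
      · rw [onSector_ne hn]
  have h2 := aut_restrict θ hCm h1
  refine (fiberTwist 1 t).injective ?_
  rw [fiberTwist_fiberUnitary]
  refine Lp.ext ?_
  have h3 : ∀ᵐ ω ∂configMeasure, ω.1 = 1 → fiberTwist 1 t (θ.1 t (boxVec t hA v)) ω =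
      fiberTwist F t (boxVec t hA v) ω := by
    refine ae_config_of_gap ?_
    filter_upwards [ae_gap h2, fiberTwist_box_gap F t hA hO v, hF t (pairTmul (v 0) (v 1))]
      with z h4 h5 h6 p1
    rw [h4 p1]
    by_cases h7 : z.1 + z.2 ∈ A 0 ∧ z.2 ∈ A 1
    · have h8 : gapConfig z ∈ sector 1 '' Set.univ.pi A := ⟨gapEquiv z, fun i _ =>
        forall_fin_two_mul_one (p := fun i => gapEquiv z i ∈ A i) h7.1 h7.2 i, rfl⟩
      rw [Set.indicator_of_mem h8, (h5 p1).1 h7.1 h7.2, h6 p1 (hO.2 1 h7.2).1 (hO.2 0 h7.1).2]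
    · have h8 : gapConfig z ∉ sector 1 '' Set.univ.pi A := by
        rintro ⟨x, hx, hxz⟩
        obtain rfl : x = gapEquiv z := sigma_mk_injective hxz
        exact h7 ⟨hx 0 trivial, hx 1 trivial⟩
      rw [Set.indicator_of_notMem h8, (h5 p1).2 h7]
  have h4 := mem_fiberSupported_iff.1
    (preserved_of_measurableSet (measurableSet_number 1) θ t _ (boxVec_mem t hA hO v))
  filter_upwards [h3, h4, boxVec_ae_sector F t hA hO v] with ω h5 h6 h7
  by_cases h8 : ω.1 = 1
  · exact h5 h8
  · rw [h6 h8, h7 h8]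

/-- The separator is the midpoint of the second and third points, or half of the second point if
there is no third. -/
theorem exists_separator {n : ℕ} {t : ℝ} {x : Fin (2 * (1 + n)) → ℝ} (hx : StrictAnti x)
    (ht : ∀ i, x i ∈ Set.Ioo 0 t) :
    ∃ s, 0 < s ∧ s < t ∧ (∀ i, s < x (inlIdx n i)) ∧ ∀ i, x (inrIdx 1 i) < s := by
  have h1 : ∀ i : Fin (2 * 1), x (inlIdx n 1) ≤ x (inlIdx n i) := by
    refine forall_fin_two_mul_one (hx.antitone ?_) le_rfl
    rw [Fin.le_def]
    exact Nat.zero_le _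
  rcases Nat.eq_zero_or_pos n with rfl | hn
  · have h2 := ht (inlIdx 0 1)
    refine ⟨x (inlIdx 0 1) / 2, by linarith [h2.1], by linarith [h2.1, h2.2], fun i => ?_,
      fun i => i.elim0⟩
    linarith [h1 i, h2.1]
  · have h3 : x (inrIdx 1 ⟨0, by omega⟩) < x (inlIdx n 1) := hx (by
      rw [Fin.lt_def]
      exact Nat.lt_succ_self 1)
    have h2 := ht (inlIdx n 1)
    have h4 := ht (inrIdx 1 (⟨0, by omega⟩ : Fin (2 * n)))
    refine ⟨(x (inrIdx 1 ⟨0, by omega⟩) + x (inlIdx n 1)) / 2, by linarith [h2.1, h4.1],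
      by linarith [h2.2, h4.2], fun i => by linarith [h1 i], fun i => ?_⟩
    have h5 : x (inrIdx 1 i) ≤ x (inrIdx 1 ⟨0, by omega⟩) := hx.antitone (by
      rw [Fin.le_def]
      exact Nat.add_le_add_left (Nat.zero_le _) _)
    linarith

/-- Near a configuration of `2(1 + n)` points, every small box vector is the product of an `n`-pair
box below a separator and a one-pair box above it. Both operators are multiplicative and agree on
the factors; local totality extends the agreement to the whole sector. -/
theorem eq_fiberUnitary_succ {θ : Aut k} {F : MeasurableUnitaries k}
    (h1 : ∀ (t : Time) {A : Fin (2 * 1) → Set ℝ} (hA : ∀ i, MeasurableSet (A i)) (_ : Ordered t A)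
      (v : Fin (2 * 1) → k), θ.1 t (boxVec t hA v) = fiberUnitary F t (boxVec t hA v)) {n : ℕ}
    (ih : ∀ (t : Time), ∀ y ∈ fiberSupported k t {ω | ω.1 = n}, θ.1 t y = fiberUnitary F t y)
    (t : Time) (y : Fiber k t) (hy : y ∈ fiberSupported k t {ω | ω.1 = 1 + n}) :
    θ.1 t y = fiberUnitary F t y := by
  have hlt : ∀ i : Fin (2 * 1), (inlIdx n i : ℕ) < 2 * 1 := fun i => i.2
  have hge : ∀ i : Fin (2 * n), ¬ (inrIdx 1 i : ℕ) < 2 * 1 := fun i =>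
    Nat.not_lt.2 (Nat.le_add_right _ _)
  let X : Set (Fiber k t) := {y | y ∈ fiberSupported k t {ω | ω.1 = 1 + n} ∧
    θ.1 t y = fiberUnitary F t y}
  have hX : y ∈ (Submodule.span ℂ X).topologicalClosure := by
    refine mem_closure_span (fun x hx => hx.1) (fun h hh H => ?_) hy
    refine eq_zero_of_inner_box t Set.inter_subset_right hh fun m => ?_
    filter_upwards [ae_mem_Ioo t m, ae_restrict_mem (measurableSet_simplex m)] with x h2 h3 h4
    obtain rfl : m = 1 + n := h4.1
    obtain ⟨s, hs0, hst, hs1, hs2⟩ := exists_separator h3 (h2 h4.2)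
    refine ⟨fun i => if (i : ℕ) < 2 * 1 then Set.Ioi s else Set.Iio s, fun i => ?_, fun i => ?_,
      fun C hC u hCU hO => H _ ⟨boxVec_mem t hC hO u, ?_⟩⟩
    · dsimp only
      split_ifs
      · exact isOpen_Ioi
      · exact isOpen_Iio
    · revert i
      refine forall_inl_inr (fun i => ?_) fun i => ?_
      · dsimp only
        rw [if_pos (hlt i)]
        exact hs1 i
      · dsimp only
        rw [if_neg (hge i)]
        exact hs2 i
    · clear H hh h X
      obtain ⟨s', t', rfl, rfl⟩ : ∃ s' t' : Time, (s' : ℝ) = s ∧ t = s' + t' :=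
        ⟨⟨s, hs0⟩, ⟨t - s, by linarith⟩, rfl, Subtype.ext (by rw [Positive.coe_add]; simp)⟩
      obtain ⟨A, hA, v, B, hB, w, hAO, hBO, he⟩ := exists_mul_eq_boxVec s' t' hC u hO
        (fun i => (hCU (inlIdx n i)).trans_eq (if_pos (hlt i)))
        (fun i => (hCU (inrIdx 1 i)).trans_eq (if_neg (hge i)))
      rw [← he, aut_mul, fiberUnitary_map_mul, ih s' _ (boxVec_mem s' hA hAO v), h1 t' hB hBO w]
  have hle : (Submodule.span ℂ X).topologicalClosure ≤ LinearMap.eqLocus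
      (θ.1 t).toLinearEquiv.toLinearMap (fiberUnitary F t).toLinearEquiv.toLinearMap :=
    Submodule.topologicalClosure_minimal _ (Submodule.span_le.2 fun x hx => hx.2)
      (isClosed_eq (θ.1 t).continuous (fiberUnitary F t).continuous)
  exact hle hX

theorem exists_eq_fiberUnitary {θ : Aut k} (hθ : ∀ t, θ.1 t (vacuum k t) = vacuum k t) :
    ∃ F : MeasurableUnitaries k, ∀ (t : Time) (y : Fiber k t), θ.1 t y = fiberUnitary F t y := by
  obtain ⟨F, hF⟩ := exists_unitary_of_aut hθ
  have h1 : ∀ (n : ℕ) (t : Time), ∀ y ∈ fiberSupported k t {ω | ω.1 = n},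
      θ.1 t y = fiberUnitary F t y := by
    intro n
    induction n with
    | zero =>
      intro t y hy
      rw [eq_smul_vacuum hy, map_smul, map_smul, hθ, fiberUnitary_vacuum]
    | succ n ih =>
      rw [add_comm]
      exact eq_fiberUnitary_succ (fun t _ hA hO v => aut_boxVec_one hF t hA hO v) ih
  refine ⟨F, fun t y => ?_⟩
  refine boxes_induction (W := LinearMap.eqLocus
      (θ.1 t).toLinearEquiv.toLinearMap (fiberUnitary F t).toLinearEquiv.toLinearMap)
      (isClosed_eq (θ.1 t).continuous (fiberUnitary F t).continuous) ?_ y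
  rintro _ ⟨n, A, hA, v, hO, rfl⟩
  exact h1 n t _ (boxVec_mem t hA hO v)

theorem aut_mul_apply (θ φ : Aut k) (t : Time) (x : Fiber k t) :
    (θ * φ).1 t x = θ.1 t (φ.1 t x) := rfl

theorem vacuum_fixed_of_smul {E θ : Aut k} {c : Time → ℂ} (hE : ∀ t x, E.1 t x = c t • x)
    (hθ : ∀ t, θ.1 t (vacuum k t) = c t • vacuum k t) (t : Time) :
    (E⁻¹ * θ).1 t (vacuum k t) = vacuum k t := by
  rw [aut_mul_apply, hθ, ← hE]
  exact aut_inv_apply E t _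

theorem surjective_autHom : Function.Surjective (autHom k) := by
  intro θ
  obtain ⟨l, hl⟩ := exists_aut_vacuum θ
  -- Dividing by the scalar automorphism with the same vacuum eigenvalue leaves an automorphism that
  -- fixes all vacua.
  obtain ⟨E, hE⟩ : ∃ E : Aut k, ∀ t x, E.1 t x = Complex.exp (Complex.I * l * (t : ℝ)) • x :=
    ⟨expAut k (Multiplicative.ofAdd l), expAut_apply _⟩
  obtain ⟨F, hF⟩ := exists_eq_fiberUnitary (θ := E⁻¹ * θ) (vacuum_fixed_of_smul hE hl)
  refine ⟨(Multiplicative.ofAdd l, QuotientGroup.mk F), ?_⟩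
  refine Subtype.ext (funext fun t => LinearIsometryEquiv.ext fun x => ?_)
  rw [autHom_apply, ← hF, ← hE, aut_mul_apply]
  exact aut_apply_inv E t (θ.1 t x)

end Surjective
end
end CliffordSystem

theorem mainTheorem4 (k : Type*) [NormedAddCommGroup k] [InnerProductSpace ℂ k] [CompleteSpace k]
    [TopologicalSpace.SeparableSpace k] :
    ∃ Φ : Multiplicative ℝ × CliffordSystem.MeasurableUnitaryGroup k ≃* CliffordSystem.Aut k,
      ∀ (l : ℝ) (F : CliffordSystem.MeasurableUnitaries k) (t : CliffordSystem.Time) (n : ℕ)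
        (η ξ : Fin (2 * n) → CliffordSystem.L2Interval k t),
        (inner ℂ (CliffordSystem.evenWedge t η)
          ((Φ (Multiplicative.ofAdd l, QuotientGroup.mk F)).1 t (CliffordSystem.evenWedge t ξ)) : ℂ)
        = Complex.exp (Complex.I * l * (t : ℝ)) *
          CliffordSystem.pairCoeff F.1 (fun i => ⇑(η i).1) (fun i => ⇑(ξ i).1) :=
  ⟨MulEquiv.ofBijective (CliffordSystem.autHom k)
      ⟨CliffordSystem.injective_autHom, CliffordSystem.surjective_autHom⟩,
    fun l F t _ η ξ => CliffordSystem.inner_autHom l F t η ξ⟩
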